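/- **Setting.** Let $4\le n\le\infty$, let $U\subseteq\mathbb R^2$ be open (a coordinate domain of a surface), and let $\nabla$ be a torsion-free affine connection of class $C^n$ on $U$ with Christoffel symbols $\Gamma^c_{ab}$. For an open $V\subseteq U$, the projective structure $[\nabla]$ on $V$ is the set of all torsion-free $C^n$ connections on $V$ with the same unparametrised geodesics as $\nabla$. It is *metrisable on $V$* if it contains the Levi-Civita connection of a (pseudo-)Riemannian metric of class $C^{n+1}$ on $V$. Let $\Pi^c_{ab}=\Gamma^c_{ab}-\tfrac13\Gamma^d_{da}\delta^c_b-\tfrac13\Gamma^d_{db}\delta^c_a$ be the Thomas symbols. They are the representative of $[\nabla]$ that annihilates the volume form $dx^1\wedge dx^2$; from here on $\nabla$ denotes this representative. The *metrisability equations* on $V$ are the linear equations $\nabla_{(a}\sigma_{bc)}=0$ for symmetric tensors $\sigma_{ab}$ of class $C^{n+1}$ on $V$; let $\mathcal S(V)$ be their real vector space of solutions. Let $\epsilon^{12}=-\epsilon^{21}=1$, let $P_{ab}$ be the Schouten tensor (here $P_{ab}=R_{ab}=R_{ca}{}^c{}_b$, where $[\nabla_a,\nabla_b]X^c=R_{ab}{}^c{}_dX^d$),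 and put $L_b=\epsilon^{cd}\nabla_cP_{db}$, $L^a=\epsilon^{ab}L_b$, $$\nu_5=L^aL^b\nabla_aL_b .$$ With $F_a=\tfrac13L_a$, $N_a=-F_a$, $M_a{}^b=\tfrac13\epsilon^{bc}\nabla_aL_c$, $U^b{}_{ca}=\tfrac13\epsilon^{bd}\nabla_c\nabla_aL_d+\epsilon^{bd}N_aP_{dc}$ and $V_{ca}=-\tfrac13(\nabla_aL_c+\nabla_cL_a)$, put $$W_{abc}=F_eM_a{}^eV_{(bc)}-F_eU^e{}_{(bc)}N_a,$$ and let $w_1=W_{111}/L_1^3$ where $L_1\ne0$, $w_1=W_{222}/L_2^3$ where $L_1=0\ne L_2$, and $w_1=0$ where $L_1=L_2=0$. **Corollary 5.5 (local form, at generic points).** There is an open subset $G$ of $U$, dense in $U$, such that every $p\in G$ has an open neighbourhood $V_0\subseteq U$ with the following property. For every nonempty connected open $V\subseteq V_0$, the projective structure is metrisable on $V$ if and only if one of the following holds: 1. $\dim\mathcal S(V)\ge2$; 2. $\dim\mathcal S(V)=1$, and $\nu_5$ and $w_1$ do not both vanish identically on $V$. -/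

import Mathlib

open TopologicalSpace

noncomputable section

namespace ProjSurf

/-- The coordinate plane, with coordinates `x 0`, `x 1` (the paper's `x¹ = x`, `x² = y`). -/
abbrev Plane : Type := Fin 2 → ℝ

/-- The partial derivative `∂_a f` at `x`. -/
def pd (a : Fin 2) (f : Plane → ℝ) (x : Plane) : ℝ :=
  fderiv ℝ f x (Pi.single a 1)

/-- Christoffel symbols: `Γ x c a b` is `Γ^c_{ab}` at `x`. -/
abbrev Christoffel : Type := Plane → Fin 2 → Fin 2 → Fin 2 → ℝ

/-- `Γ` is a torsion-free affine connection of class `C^n` on `V`. -/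
structure IsTorsionFreeConnection (n : ℕ∞) (V : Opens Plane) (Γ : Christoffel) : Prop where
  contDiffOn : ∀ c a b, ContDiffOn ℝ (n : WithTop ℕ∞) (fun x => Γ x c a b) (V : Set Plane)
  symm : ∀ x ∈ V, ∀ c a b, Γ x c a b = Γ x c b a

/-- The regular `C²` curve `γ : (s, t) → V` is an unparametrised geodesic of `Γ`:
its acceleration `γ̈^c + Γ^c_{ab} γ̇^a γ̇^b` is everywhere a multiple of its velocity. -/
structure IsUnparametrisedGeodesic (V : Opens Plane) (Γ : Christoffel)
    (s t : ℝ) (γ : ℝ → Plane) : Prop where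
  mapsTo : ∀ τ ∈ Set.Ioo s t, γ τ ∈ V
  contDiffOn : ContDiffOn ℝ 2 γ (Set.Ioo s t)
  regular : ∀ τ ∈ Set.Ioo s t, deriv γ τ ≠ 0
  geodesic : ∃ v : ℝ → ℝ, ∀ τ ∈ Set.Ioo s t, ∀ c,
    deriv (deriv γ) τ c + ∑ a, ∑ b, Γ (γ τ) c a b * deriv γ τ a * deriv γ τ b
      = v τ * deriv γ τ c

/-- The projective structure `[Γ]` on `V`: all torsion-free connections of class `C^n` on `V` with
the same unparametrised geodesics as `Γ`. -/
def projectiveStructure (n : ℕ∞) (V : Opens Plane) (Γ : Christoffel) : Set Christoffel :=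
  {Γ' | IsTorsionFreeConnection n V Γ' ∧ ∀ (s t : ℝ) (γ : ℝ → Plane),
    IsUnparametrisedGeodesic V Γ s t γ ↔ IsUnparametrisedGeodesic V Γ' s t γ}

/-- `g` is a (pseudo-)Riemannian metric of class `C^(n+1)` on `V`. -/
structure IsMetric (n : ℕ∞) (V : Opens Plane) (g : Plane → Matrix (Fin 2) (Fin 2) ℝ) : Prop where
  contDiffOn : ∀ a b,
    ContDiffOn ℝ ((n + 1 : ℕ∞) : WithTop ℕ∞) (fun x => g x a b) (V : Set Plane)
  symm : ∀ x ∈ V, (g x).IsSymm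
  nondegenerate : ∀ x ∈ V, (g x).det ≠ 0

/-- The Christoffel symbols of the Levi-Civita connection of `g`. -/
def leviCivita (g : Plane → Matrix (Fin 2) (Fin 2) ℝ) : Christoffel := fun x c a b =>
  (1 / 2) * ∑ d, (g x)⁻¹ c d *
    (pd a (fun y => g y d b) x + pd b (fun y => g y d a) x - pd d (fun y => g y a b) x)

/-- The projective structure `[Γ]` is metrisable on `V`: it contains the Levi-Civita connection of
a (pseudo-)Riemannian metric on `V`. -/
def IsMetrisable (n : ℕ∞) (V : Opens Plane) (Γ : Christoffel) : Prop :=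
  ∃ g, IsMetric n V g ∧ leviCivita g ∈ projectiveStructure n V Γ

/-- The Thomas symbols `Π^c_{ab} = Γ^c_{ab} - (1/3) Γ^d_{da} δ^c_b - (1/3) Γ^d_{db} δ^c_a`. They are
the Christoffel symbols of the representative of `[Γ]` that annihilates the volume form with
`ε_{12} = 1`. -/
def thomas (Γ : Christoffel) : Christoffel := fun x c a b =>
  Γ x c a b - (1 / 3) * (∑ d, Γ x d d a) * (if c = b then 1 else 0)
    - (1 / 3) * (∑ d, Γ x d d b) * (if c = a then 1 else 0)

/-- `∇_a ω_b` for a covector field `ω`. -/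
def nablaCovector (Γ : Christoffel) (ω : Plane → Fin 2 → ℝ) (x : Plane) (a b : Fin 2) : ℝ :=
  pd a (fun y => ω y b) x - ∑ d, Γ x d a b * ω x d

/-- `∇_a T_{bc}` for a covariant two-tensor field `T`. -/
def nablaTwoTensor (Γ : Christoffel) (T : Plane → Fin 2 → Fin 2 → ℝ) (x : Plane)
    (a b c : Fin 2) : ℝ :=
  pd a (fun y => T y b c) x - ∑ d, (Γ x d a b * T x d c + Γ x d a c * T x b d)

/-- The metrisability equations `∇_{(a} σ_{bc)} = 0` on `V`, where `∇` is the special connection in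
`[Γ]` given by the Thomas symbols and `σ` is symmetric of class `C^(n+1)`. -/
structure IsMetrisabilitySolution (n : ℕ∞) (V : Opens Plane) (Γ : Christoffel)
    (σ : Plane → Fin 2 → Fin 2 → ℝ) : Prop where
  contDiffOn : ∀ a b,
    ContDiffOn ℝ ((n + 1 : ℕ∞) : WithTop ℕ∞) (fun x => σ x a b) (V : Set Plane)
  symm : ∀ x ∈ V, ∀ a b, σ x a b = σ x b a
  killing : ∀ x ∈ V, ∀ a b c,
    nablaTwoTensor (thomas Γ) σ x a b c + nablaTwoTensor (thomas Γ) σ x b c a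
      + nablaTwoTensor (thomas Γ) σ x c a b = 0

theorem IsMetrisabilitySolution.differentiableAt {n : ℕ∞} {V : Opens Plane} {Γ : Christoffel}
    {σ : Plane → Fin 2 → Fin 2 → ℝ} (h : IsMetrisabilitySolution n V Γ σ) {x : Plane}
    (hx : x ∈ V) (a b : Fin 2) : DifferentiableAt ℝ (fun y => σ y a b) x := by
  refine ((h.contDiffOn a b).contDiffAt (V.isOpen.mem_nhds hx)).differentiableAt ?_
  simp

theorem nablaTwoTensor_add (Γ : Christoffel) {S T : Plane → Fin 2 → Fin 2 → ℝ} {x : Plane}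
    (hS : ∀ a b, DifferentiableAt ℝ (fun y => S y a b) x)
    (hT : ∀ a b, DifferentiableAt ℝ (fun y => T y a b) x) (a b c : Fin 2) :
    nablaTwoTensor Γ (S + T) x a b c = nablaTwoTensor Γ S x a b c + nablaTwoTensor Γ T x a b c := by
  have h : fderiv ℝ (fun y => S y b c + T y b c) x
      = fderiv ℝ (fun y => S y b c) x + fderiv ℝ (fun y => T y b c) x :=
    fderiv_add (hS b c) (hT b c)
  simp only [nablaTwoTensor, pd, Pi.add_apply, h, add_apply, Fin.sum_univ_two]
  ring

theorem nablaTwoTensor_smul (Γ : Christoffel) (k : ℝ) {T : Plane → Fin 2 → Fin 2 → ℝ} {x : Plane}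
    (hT : ∀ a b, DifferentiableAt ℝ (fun y => T y a b) x) (a b c : Fin 2) :
    nablaTwoTensor Γ (k • T) x a b c = k * nablaTwoTensor Γ T x a b c := by
  have h : fderiv ℝ (fun y => k * T y b c) x = k • fderiv ℝ (fun y => T y b c) x :=
    fderiv_const_mul (hT b c) k
  simp only [nablaTwoTensor, pd, Pi.smul_apply, smul_eq_mul, h, smul_apply, Fin.sum_univ_two]
  ring

/-- The vector space of solutions on `V` of the metrisability equations. A tensor field on `V` is
represented by its extension by zero to the plane, so that a solution is determined by its values
on `V`. -/
def solutionSpace (n : ℕ∞) (V : Opens Plane) (Γ : Christoffel) :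
    Submodule ℝ (Plane → Fin 2 → Fin 2 → ℝ) where
  carrier := {σ | IsMetrisabilitySolution n V Γ σ ∧ ∀ x ∉ V, σ x = 0}
  zero_mem' := by
    refine ⟨⟨fun a b => contDiffOn_const, fun x _ a b => rfl, fun x _ a b c => ?_⟩, fun x _ => rfl⟩
    simp [nablaTwoTensor, pd]
  add_mem' := by
    rintro S T ⟨hS, hS0⟩ ⟨hT, hT0⟩
    refine ⟨⟨fun a b => (hS.contDiffOn a b).add (hT.contDiffOn a b), fun x hx a b => ?_,
      fun x hx a b c => ?_⟩, fun x hx => ?_⟩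
    · simp [hS.symm x hx a b, hT.symm x hx a b]
    · have h := nablaTwoTensor_add (thomas Γ) (fun a b => hS.differentiableAt hx a b)
        (fun a b => hT.differentiableAt hx a b)
      rw [h, h, h]
      linarith [hS.killing x hx a b c, hT.killing x hx a b c]
    · simp [hS0 x hx, hT0 x hx]
  smul_mem' := by
    rintro k T ⟨hT, hT0⟩
    refine ⟨⟨fun a b => contDiffOn_const.mul (hT.contDiffOn a b), fun x hx a b => ?_,
      fun x hx a b c => ?_⟩, fun x hx => ?_⟩
    · simp [hT.symm x hx a b]
    · have h := nablaTwoTensor_smul (thomas Γ) k (fun a b => hT.differentiableAt hx a b)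
      rw [h, h, h, ← mul_add, ← mul_add, hT.killing x hx a b c, mul_zero]
    · simp [hT0 x hx]

/-- The Ricci tensor `R_{bd} = R_{ab}{}^a{}_d`, with `[∇_a, ∇_b] X^c = R_{ab}{}^c{}_d X^d`. -/
def ricci (Γ : Christoffel) (x : Plane) (b d : Fin 2) : ℝ :=
  ∑ a, (pd a (fun y => Γ y a b d) x - pd b (fun y => Γ y a a d) x
    + ∑ e, (Γ x a a e * Γ x e b d - Γ x a b e * Γ x e a d))

/-- The Schouten tensor `P_{ab} = (2/3) R_{ab} + (1/3) R_{ba}`. -/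
def schouten (Γ : Christoffel) (x : Plane) (a b : Fin 2) : ℝ :=
  (2 / 3) * ricci Γ x a b + (1 / 3) * ricci Γ x b a

/-- The symbol `ε^{ab}` with `ε^{12} = 1`. It satisfies `ε^{ab} ε_{cb} = δ^a_c` for `ε_{12} = 1`. -/
def eps (a b : Fin 2) : ℝ := !![0, 1; -1, 0] a b

/-- The Cotton tensor `L_b = ε^{cd} ∇_c P_{db}`, that is, the one-form of Liouville invariants. -/
def cotton (Γ : Christoffel) (x : Plane) (b : Fin 2) : ℝ :=
  ∑ c, ∑ d, eps c d * nablaTwoTensor Γ (schouten Γ) x c d b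

/-- `∇_a L_b`. -/
def nablaCotton (Γ : Christoffel) (x : Plane) (a b : Fin 2) : ℝ :=
  nablaCovector Γ (cotton Γ) x a b

/-- `L^a = ε^{ab} L_b`. -/
def cottonUp (Γ : Christoffel) (x : Plane) (a : Fin 2) : ℝ :=
  ∑ b, eps a b * cotton Γ x b

/-- Liouville's invariant `ν₅ = L^a L^b ∇_a L_b` of the projective structure `[Γ]`, computed with
the representative that annihilates the volume form with `ε_{12} = 1`. -/
def nu5 (Γ : Christoffel) (x : Plane) : ℝ :=
  ∑ a, ∑ b, cottonUp (thomas Γ) x a * cottonUp (thomas Γ) x b * nablaCotton (thomas Γ) x a b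

/-! For a connection that annihilates the volume form with `ε_{12} = 1` (so that the Ricci tensor
is symmetric and `β = 0`), the obstruction tensor `W_{abc}` to the existence of Killing forms. It is
the determinant of `V`, `D_a V`, `D_{(b} D_{c)} V`, where `V = (F^1, F^2, 0)` is the section of the
dual of the prolongation bundle that annihilates every Killing form, and `D` is the dual of the
prolongation connection:
`D_a V = (M_a{}^b, N_a)` and `D_c D_a V = (U^b_{ca}, V_{ca})`. -/

/-- `F_a = (1/3) L_a`, which is `F^a = (1/3) ε^{ab} L_b` with its index lowered. -/
def FDown (Γ : Christoffel) (x : Plane) (a : Fin 2) : ℝ := (1 / 3) * cotton Γ x a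

/-- `M_a{}^b = ∇_a F^b = (1/3) ε^{bc} ∇_a L_c`. -/
def MTensor (Γ : Christoffel) (x : Plane) (a b : Fin 2) : ℝ :=
  (1 / 3) * ∑ c, eps b c * nablaCotton Γ x a c

/-- `N_a = -F_a`. -/
def NForm (Γ : Christoffel) (x : Plane) (a : Fin 2) : ℝ := -FDown Γ x a

/-- `U^b_{ca} = (1/3) ε^{bd} ∇_c ∇_a L_d + ε^{bd} N_a P_{dc}`. -/
def UTensor (Γ : Christoffel) (x : Plane) (b c a : Fin 2) : ℝ :=
  ∑ d, eps b d * ((1 / 3) * nablaTwoTensor Γ (nablaCotton Γ) x c a d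
    + NForm Γ x a * schouten Γ x d c)

/-- `V_{ca} = -M_{ac} - (1/3) ∇_c L_a = -(1/3) (∇_a L_c + ∇_c L_a)`. -/
def VTensor (Γ : Christoffel) (x : Plane) (c a : Fin 2) : ℝ :=
  -(1 / 3) * (nablaCotton Γ x a c + nablaCotton Γ x c a)

/-- `W_{abc} = F_e M_a{}^e V_{(bc)} - F_e U^e_{(bc)} N_a`. -/
def WTensor (Γ : Christoffel) (x : Plane) (a b c : Fin 2) : ℝ :=
  (∑ e, FDown Γ x e * MTensor Γ x a e) * ((VTensor Γ x b c + VTensor Γ x c b) / 2)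
    - (∑ e, FDown Γ x e * ((UTensor Γ x e b c + UTensor Γ x e c b) / 2)) * NForm Γ x a

open Classical in
/-- Liouville's invariant `w₁` of `[Γ]` (up to a constant factor), obtained from `W_{111}` where
`L_1 ≠ 0` and from `W_{222}` where `L_1 = 0` and `L_2 ≠ 0`, with the representative that annihilates
the volume form with `ε_{12} = 1`. Where `ν₅` vanishes identically, it is the scalar with
`W_{abc} = w₁ L_a L_b L_c`, and the two formulas agree. Where `L = 0`, its value is `0`. -/
def w1 (Γ : Christoffel) (x : Plane) : ℝ :=
  if cotton (thomas Γ) x 0 ≠ 0 then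
    WTensor (thomas Γ) x 0 0 0 / cotton (thomas Γ) x 0 ^ 3
  else
    WTensor (thomas Γ) x 1 1 1 / cotton (thomas Γ) x 1 ^ 3

end ProjSurf

end

/-! Metrics and solutions are the same data up to a weight. If `g` is a metric whose Levi-Civita
connection lies in `[Γ]`, then `|det g|^(-2/3) g` solves the metrisability equations; conversely a
nowhere degenerate solution `σ` gives the metric `σ / (det σ)²` (`exists_solution_of_isMetrisable`,
`isMetrisable_of_solution`, resting on Weyl's theorem that geodesics determine the Thomas symbols).
So metrisability on `V` means a solution with nowhere vanishing determinant.

What remains is to understand degenerate solutions. Locally, near a point where it is nonzero, such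
a solution is up to sign the square `ω ⊗ ω` of a Killing form. The integrability condition of the
Killing equation forces `ω = f L` where `L ≠ 0`, and then `∇_(a L_b) = α_(a L_b)` with `α = -d log
|f|` closed. The vanishing of `ν₅` expresses the existence of such an `α`, and `w₁` is, up to a
constant, its exterior derivative (`WTensor_eq_of_symm`). Hence a Killing form without zeros makes
both invariants vanish, and the vanishing of both produces a nonzero Killing form on some open
subset (`exists_isKillingForm`): by integrating `dY = -αY` where `L ≠ 0`, or by parallel sections of
the flat prolongation of the Killing equation if `L` vanishes identically.

Two further facts control dimensions. Solutions on a connected set are determined near any point, so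
restriction is injective and dimensions can only grow on smaller sets (`rank_solutionSpace_mono`).
If all solutions are degenerate, any two are constant multiples of one another
(`rank_solutionSpace_le_one`), so dimension two yields a solution that is nondegenerate somewhere.

Genericity enters by shrinking. Any nonempty open set `W` contains a good nonempty open set, in one
of four ways: some connected subset has at least two independent solutions; none has, but some
solution is nondegenerate somewhere; all solutions are degenerate, but one is nonzero; there are no
nonzero solutions at all (`exists_metrisabilityCriterion`). The union of all good sets is therefore
dense. -/

namespace ProjSurf

open scoped Topology

/-! ### Calculus of coordinate partial derivatives. -/

section Calculus

variable {f g : Plane → ℝ} {x : Plane}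

theorem pd_congr (h : f =ᶠ[𝓝 x] g) (a : Fin 2) : pd a f x = pd a g x := by
  simp only [pd, h.fderiv_eq]

theorem pd_congr_of_eqOn {V : Set Plane} (hV : IsOpen V) (h : Set.EqOn f g V) (hx : x ∈ V)
    (a : Fin 2) : pd a f x = pd a g x :=
  pd_congr (h.eventuallyEq_of_mem (hV.mem_nhds hx)) a

theorem pd_add (hf : DifferentiableAt ℝ f x) (hg : DifferentiableAt ℝ g x) (a : Fin 2) :
    pd a (fun y => f y + g y) x = pd a f x + pd a g x := by
  simp only [pd, fderiv_fun_add hf hg, add_apply]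

theorem pd_sub (hf : DifferentiableAt ℝ f x) (hg : DifferentiableAt ℝ g x) (a : Fin 2) :
    pd a (fun y => f y - g y) x = pd a f x - pd a g x := by
  simp only [pd, fderiv_fun_sub hf hg, sub_apply]

theorem pd_neg (a : Fin 2) : pd a (fun y => -f y) x = -pd a f x := by
  simp only [pd, fderiv_fun_neg, neg_apply]

theorem pd_mul (hf : DifferentiableAt ℝ f x) (hg : DifferentiableAt ℝ g x) (a : Fin 2) :
    pd a (fun y => f y * g y) x = f x * pd a g x + pd a f x * g x := by
  simp only [pd, fderiv_fun_mul hf hg, add_apply, smul_apply, smul_eq_mul]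
  ring

theorem pd_const (c : ℝ) (a : Fin 2) : pd a (fun _ => c) x = 0 := by
  simp [pd]

theorem pd_const_mul (c : ℝ) (hf : DifferentiableAt ℝ f x) (a : Fin 2) :
    pd a (fun y => c * f y) x = c * pd a f x := by
  rw [pd_mul (differentiableAt_const c) hf, pd_const]
  ring

theorem pd_inv (hf : DifferentiableAt ℝ f x) (h : f x ≠ 0) (a : Fin 2) :
    pd a (fun y => (f y)⁻¹) x = -pd a f x / f x ^ 2 := by
  have := ((hasDerivAt_inv h).comp_hasFDerivAt x hf.hasFDerivAt).fderiv
  simp only [pd]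
  change fderiv ℝ (Inv.inv ∘ f) x _ = _
  rw [this]
  simp [div_eq_mul_inv, mul_comm]

theorem pd_div (hf : DifferentiableAt ℝ f x) (hg : DifferentiableAt ℝ g x) (h : g x ≠ 0)
    (a : Fin 2) : pd a (fun y => f y / g y) x = (pd a f x * g x - f x * pd a g x) / g x ^ 2 := by
  simp only [div_eq_mul_inv]
  rw [pd_mul hf (hg.fun_inv h), pd_inv hg h]
  field_simp
  ring

theorem fderiv_apply_eq_pd (v : Plane) : fderiv ℝ f x v = v 0 * pd 0 f x + v 1 * pd 1 f x := by
  have hv : v = v 0 • Pi.single 0 1 + v 1 • Pi.single 1 1 := by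
    ext i; fin_cases i <;> simp
  conv_lhs => rw [hv]
  simp [pd]

theorem contDiffOn_pd {V : Set Plane} (hV : IsOpen V) {m n : WithTop ℕ∞}
    (hf : ContDiffOn ℝ n f V) (hmn : m + 1 ≤ n) (a : Fin 2) : ContDiffOn ℝ m (pd a f) V :=
  (hf.fderiv_of_isOpen hV hmn).clm_apply contDiffOn_const

theorem pd_comm (hf : ContDiffAt ℝ 2 f x) (a b : Fin 2) : pd a (pd b f) x = pd b (pd a f) x := by
  have hd : DifferentiableAt ℝ (fderiv ℝ f) x :=
    (hf.fderiv_right (m := 1) (by norm_num)).differentiableAt (by norm_num)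
  have key (c d : Fin 2) : pd c (pd d f) x
      = fderiv ℝ (fderiv ℝ f) x (Pi.single c 1) (Pi.single d 1) := by
    change fderiv ℝ (fun y => fderiv ℝ f y (Pi.single d 1)) x (Pi.single c 1) = _
    rw [fderiv_clm_apply hd (differentiableAt_const _)]
    simp
  rw [key, key]
  exact (hf.isSymmSndFDerivAt (by simp)) _ _

theorem contDiffOn_succ_of_pd {V : Set Plane} (hV : IsOpen V) {k : ℕ}
    (hf : ∀ x ∈ V, DifferentiableAt ℝ f x) (h : ∀ a, ContDiffOn ℝ k (pd a f) V) :
    ContDiffOn ℝ (k + 1 : ℕ) f V := by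
  have : ((k + 1 : ℕ) : WithTop ℕ∞) = (k : WithTop ℕ∞) + 1 := by push_cast; rfl
  rw [this, contDiffOn_succ_iff_fderiv_of_isOpen hV]
  refine ⟨fun x hx => (hf x hx).differentiableWithinAt, by simp, ?_⟩
  have e : fderiv ℝ f = fun y => pd 0 f y • (ContinuousLinearMap.proj 0 : Plane →L[ℝ] ℝ)
      + pd 1 f y • (ContinuousLinearMap.proj 1 : Plane →L[ℝ] ℝ) := by
    ext y v
    rw [fderiv_apply_eq_pd]
    simp [mul_comm]
  rw [e]
  exact ((h 0).smul contDiffOn_const).add ((h 1).smul contDiffOn_const)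

theorem _root_.ContDiffOn.differentiableAt_of_isOpen {V : Set Plane} {n : WithTop ℕ∞}
    (hf : ContDiffOn ℝ n f V) (hV : IsOpen V) (hn : n ≠ 0) (hx : x ∈ V) :
    DifferentiableAt ℝ f x :=
  (hf.contDiffAt (hV.mem_nhds hx)).differentiableAt hn

end Calculus

/-! ### Flat linear systems in two variables with `C¹` coefficients. -/

section Frobenius

variable {E : Type*} [NormedAddCommGroup E] [NormedSpace ℝ E]

/-- A linear ordinary differential equation with a parameter has a local flow that is continuous in
time, parameter and initial value. -/
theorem exists_linear_flow [CompleteSpace E] {B : ℝ × ℝ → E →L[ℝ] E} {x₀ y₀ : ℝ}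
    (hB : ContDiffAt ℝ 1 B (x₀, y₀)) (e₀ : E) :
    ∃ h > 0, ∃ Φ : (ℝ × E) × ℝ → E,
      (∀ q ∈ Metric.closedBall (x₀, e₀) h, Φ (q, y₀) = q.2 ∧
        ∀ t ∈ Set.Icc (y₀ - h) (y₀ + h),
          HasDerivWithinAt (fun t => Φ (q, t)) (B (q.1, t) (Φ (q, t)))
            (Set.Icc (y₀ - h) (y₀ + h)) t) ∧
      ContinuousOn Φ (Metric.closedBall (x₀, e₀) h ×ˢ Set.Icc (y₀ - h) (y₀ + h)) := by
  -- Parameter and time are adjoined to the state. The equation becomes autonomous, and continuity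
  -- in the initial point includes continuity in the parameter.
  let v : (ℝ × ℝ) × E → (ℝ × ℝ) × E := fun z => ((0, 1), B z.1 z.2)
  have hv : ContDiffAt ℝ 1 v ((x₀, y₀), e₀) := by
    refine contDiffAt_const.prodMk ?_
    refine ContDiffAt.clm_apply ?_ contDiffAt_snd
    exact ContDiffAt.comp (x := ((x₀, y₀), e₀)) (g := B) (f := Prod.fst) hB contDiffAt_fst
  obtain ⟨ε, hε, a, r, Λ, K, hr, hP⟩ := IsPicardLindelof.of_contDiffAt_one hv
  obtain ⟨α, hα, hαc⟩ := (hP y₀).exists_forall_mem_closedBall_eq_hasDerivWithinAt_continuousOn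
  have hr' : (0 : ℝ) < r := hr
  refine ⟨min r ε, lt_min hr' hε, fun q => (α (((q.1.1, y₀), q.1.2), q.2)).2, ?_, ?_⟩
  · rintro ⟨x, e⟩ hq
    have hmem : ((x, y₀), e) ∈ Metric.closedBall ((x₀, y₀), e₀) (r : ℝ) := by
      simp only [Metric.mem_closedBall, Prod.dist_eq, dist_self] at hq ⊢
      have h1 := (max_le_iff.1 hq).1
      have h2 := (max_le_iff.1 hq).2
      have h3 := min_le_left (r : ℝ) ε
      exact max_le (max_le (h1.trans h3) hr'.le) (h2.trans h3)
    obtain ⟨h0, hd⟩ := hα _ hmem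
    have hsub : Set.Icc (y₀ - min (r : ℝ) ε) (y₀ + min (r : ℝ) ε) ⊆ Set.Icc (y₀ - ε) (y₀ + ε) := by
      have := min_le_right (r : ℝ) ε
      exact Set.Icc_subset_Icc (by linarith) (by linarith)
    -- The adjoined component has constant velocity `(0, 1)` and starts at `(x, y₀)`, so the other
    -- component solves the original equation.
    have hfst : ∀ t ∈ Set.Icc (y₀ - ε) (y₀ + ε), (α (((x, y₀), e), t)).1 = (x, t) := by
      have hc : ∀ t ∈ Set.Icc (y₀ - ε) (y₀ + ε),
          HasDerivWithinAt (fun t => (α (((x, y₀), e), t)).1 - (x, t)) 0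
            (Set.Icc (y₀ - ε) (y₀ + ε)) t := by
        intro t ht
        have h1 : HasDerivWithinAt (fun t => (α (((x, y₀), e), t)).1) ((0 : ℝ), (1 : ℝ))
            (Set.Icc (y₀ - ε) (y₀ + ε)) t :=
          (ContinuousLinearMap.fst ℝ (ℝ × ℝ) E).hasFDerivAt.comp_hasDerivWithinAt t (hd t ht)
        have h2 : HasDerivWithinAt (fun t : ℝ => (x, t)) ((0 : ℝ), (1 : ℝ))
            (Set.Icc (y₀ - ε) (y₀ + ε)) t :=
          (hasDerivWithinAt_const t _ x).prodMk (hasDerivWithinAt_id t _)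
        have h3 := h1.fun_sub h2
        rw [sub_self] at h3
        exact h3
      have hconst := constant_of_has_deriv_right_zero
        (fun t ht => (hc t ht).continuousWithinAt)
        (fun t ht => ((hc t ⟨ht.1, ht.2.le⟩).mono_of_mem_nhdsWithin
          (Icc_mem_nhdsGE_of_mem ht)))
      intro t ht
      have e1 := hconst t ht
      have e2 := hconst y₀ ⟨by linarith, by linarith⟩
      rw [h0] at e2
      have : (α (((x, y₀), e), t)).1 - (x, t) = 0 := by
        rw [e1, ← e2]; simp
      exact sub_eq_zero.1 this
    refine ⟨by simp [h0], fun t ht => ?_⟩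
    have h1 : HasDerivWithinAt (fun t => (α (((x, y₀), e), t)).2)
        (v (α (((x, y₀), e), t))).2 (Set.Icc (y₀ - ε) (y₀ + ε)) t :=
      (ContinuousLinearMap.snd ℝ (ℝ × ℝ) E).hasFDerivAt.comp_hasDerivWithinAt t (hd t (hsub ht))
    have h2 : (v (α (((x, y₀), e), t))).2 = B (x, t) (α (((x, y₀), e), t)).2 := by
      simp only [v, hfst t (hsub ht)]
    rw [h2] at h1
    exact h1.mono hsub
  · refine (continuous_snd.comp_continuousOn hαc).comp (t := Metric.closedBall ((x₀, y₀), e₀) (r : ℝ) ×ˢ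
      Set.Icc (y₀ - ε) (y₀ + ε)) (f := fun q : (ℝ × E) × ℝ => (((q.1.1, y₀), q.1.2), q.2))
      (by fun_prop) ?_
    rintro ⟨⟨x, e⟩, t⟩ ⟨hq, ht⟩
    simp only [Metric.mem_closedBall, Prod.dist_eq, Set.mem_prod, Set.mem_Icc, dist_self] at hq ht ⊢
    have h1 := (max_le_iff.1 hq).1
    have h2 := (max_le_iff.1 hq).2
    have h3 := min_le_left (r : ℝ) ε
    have h4 := min_le_right (r : ℝ) ε
    exact ⟨max_le (max_le (h1.trans h3) hr'.le) (h2.trans h3), by linarith [ht.1], by linarith [ht.2]⟩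

/-- Taking `K ≥ 1` removes the division by `K`, so that the bound is visibly linear in the errors
`δ` and `ε`. -/
theorem gronwallBound_le {δ K ε x h : ℝ} (hδ : 0 ≤ δ) (hε : 0 ≤ ε) (hK : 1 ≤ K) (hx : x ≤ h) :
    gronwallBound δ K ε x ≤ (δ + ε) * Real.exp (K * h) := by
  have hK0 : K ≠ 0 := by positivity
  have h1 : Real.exp (K * x) ≤ Real.exp (K * h) := by gcongr
  have h2 : ε / K ≤ ε := div_le_self hε hK
  rw [gronwallBound_of_K_ne_0 hK0]
  have h3 : 0 < Real.exp (K * x) := Real.exp_pos _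
  have h4 : 0 ≤ ε / K := by positivity
  nlinarith [mul_le_mul_of_nonneg_left h1 hδ, mul_le_mul_of_nonneg_left h1 hε,
    mul_le_mul_of_nonneg_right h2 h3.le]

/-- In a flat linear system `∂ₓX = AX`, `∂ᵧX = BX`, the second equation propagates the first. -/
theorem hasDerivAt_fst_of_flat {A B : ℝ × ℝ → E →L[ℝ] E} {Ω : Set (ℝ × ℝ)} (hΩ : IsOpen Ω)
    (hA : ContDiffOn ℝ 1 A Ω) (hB : ContDiffOn ℝ 1 B Ω)
    (flat : ∀ z ∈ Ω, ∀ e, fderiv ℝ A z (0, 1) e + A z (B z e)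
      = fderiv ℝ B z (1, 0) e + B z (A z e))
    {x₀ y₀ h : ℝ} (hbox : Set.Icc (x₀ - h) (x₀ + h) ×ˢ Set.Icc y₀ (y₀ + h) ⊆ Ω)
    {X : ℝ × ℝ → E}
    (hX : ContinuousOn X (Set.Icc (x₀ - h) (x₀ + h) ×ˢ Set.Icc y₀ (y₀ + h)))
    (hXy : ∀ x ∈ Set.Icc (x₀ - h) (x₀ + h), ∀ y ∈ Set.Icc y₀ (y₀ + h),
      HasDerivWithinAt (fun y => X (x, y)) (B (x, y) (X (x, y))) (Set.Icc y₀ (y₀ + h)) y)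
    (hXx : ∀ x ∈ Set.Ioo (x₀ - h) (x₀ + h),
      HasDerivAt (fun x => X (x, y₀)) (A (x, y₀) (X (x, y₀))) x)
    {x y : ℝ} (hx : x ∈ Set.Ioo (x₀ - h) (x₀ + h)) (hy : y ∈ Set.Icc y₀ (y₀ + h)) :
    HasDerivAt (fun x => X (x, y)) (A (x, y) (X (x, y))) x := by
  set Q : Set (ℝ × ℝ) := Set.Icc (x₀ - h) (x₀ + h) ×ˢ Set.Icc y₀ (y₀ + h) with hQ
  have hQc : IsCompact Q := isCompact_Icc.prod isCompact_Icc
  have hBx : ContinuousOn (fun z => fderiv ℝ B z (1, 0)) Q :=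
    ((hB.continuousOn_fderiv_of_isOpen hΩ le_rfl).mono hbox).clm_apply continuousOn_const
  obtain ⟨K, hK⟩ := hQc.exists_bound_of_continuousOn (hB.continuousOn.mono hbox)
  obtain ⟨M, hM⟩ := hQc.exists_bound_of_continuousOn hX
  obtain ⟨C, hC⟩ := hQc.exists_bound_of_continuousOn hBx
  have hxI : x ∈ Set.Icc (x₀ - h) (x₀ + h) := Set.Ioo_subset_Icc_self hx
  have hM0 : 0 ≤ M := (norm_nonneg _).trans (hM (x, y) ⟨hxI, hy⟩)
  have hC0 : 0 ≤ C := (norm_nonneg _).trans (hC (x, y) ⟨hxI, hy⟩)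
  have hQy {s : ℝ} (hs : s ∈ Set.Icc (x₀ - h) (x₀ + h)) {t : ℝ} (ht : t ∈ Set.Icc y₀ (y₀ + h)) :
      (s, t) ∈ Q := ⟨hs, ht⟩
  rw [hasDerivAt_iff_isLittleO_nhds_zero, Asymptotics.isLittleO_iff]
  intro ε hε
  -- Chosen so that the final Grönwall bound `η |δ| (1 + M + C) exp (max K 1 * h)` equals `ε |δ|`.
  set G : ℝ := (1 + M + C) * Real.exp (max K 1 * h) with hG
  have hG0 : 0 < G := by positivity
  set η : ℝ := ε / G with hη
  have hη0 : 0 < η := by positivity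
  obtain ⟨δ₁, hδ₁, H1⟩ := Metric.uniformContinuousOn_iff.1
    (hQc.uniformContinuousOn_of_continuous hX) η hη0
  obtain ⟨δ₂, hδ₂, H2⟩ := Metric.uniformContinuousOn_iff.1
    (hQc.uniformContinuousOn_of_continuous hBx) η hη0
  have H3 := (Asymptotics.isLittleO_iff.1
    (hasDerivAt_iff_isLittleO_nhds_zero.1 (hXx x hx))) hη0
  obtain ⟨δ₃, hδ₃, H4⟩ := Metric.isOpen_iff.1 isOpen_Ioo x hx
  filter_upwards [H3, Metric.ball_mem_nhds (0 : ℝ) hδ₁, Metric.ball_mem_nhds (0 : ℝ) hδ₂,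
    Metric.ball_mem_nhds (0 : ℝ) hδ₃] with δ D0 hd1 hd2 hd3
  rw [mem_ball_zero_iff, Real.norm_eq_abs] at hd1 hd2 hd3
  have hball : Metric.closedBall x |δ| ⊆ Set.Icc (x₀ - h) (x₀ + h) :=
    (Metric.closedBall_subset_ball hd3).trans (H4.trans Set.Ioo_subset_Icc_self)
  have hxδ : x + δ ∈ Metric.closedBall x |δ| := by simp
  -- First-order expansion of `B` in `x`, uniform in `t`: the mean value inequality for `s ↦ B (s,
  -- t) - s • ∂ₓB (x, t)`.
  have hR : ∀ t ∈ Set.Icc y₀ (y₀ + h),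
      ‖B (x + δ, t) - B (x, t) - δ • fderiv ℝ B (x, t) (1, 0)‖ ≤ η * |δ| := by
    intro t ht
    have hder : ∀ s ∈ Metric.closedBall x |δ|, HasDerivWithinAt
        (fun s => B (s, t) - s • fderiv ℝ B (x, t) (1, 0))
        (fderiv ℝ B (s, t) (1, 0) - fderiv ℝ B (x, t) (1, 0)) (Metric.closedBall x |δ|) s := by
      intro s hs
      have hBs : HasFDerivAt B (fderiv ℝ B (s, t)) (s, t) :=
        ((hB.contDiffAt (hΩ.mem_nhds (hbox (hQy (hball hs) ht)))).differentiableAt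
          one_ne_zero).hasFDerivAt
      have h1 : HasDerivAt (fun s => B (s, t)) (fderiv ℝ B (s, t) (1, 0)) s :=
        hBs.comp_hasDerivAt s ((hasDerivAt_id s).prodMk (hasDerivAt_const s t))
      have h2 : HasDerivAt (fun s : ℝ => s • fderiv ℝ B (x, t) (1, 0))
          (fderiv ℝ B (x, t) (1, 0)) s := by
        simpa using (hasDerivAt_id s).smul_const (fderiv ℝ B (x, t) (1, 0))
      exact (h1.sub h2).hasDerivWithinAt
    have hb : ∀ s ∈ Metric.closedBall x |δ|,
        ‖fderiv ℝ B (s, t) (1, 0) - fderiv ℝ B (x, t) (1, 0)‖ ≤ η := by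
      intro s hs
      rw [← dist_eq_norm]
      refine (H2 _ (hQy (hball hs) ht) _ (hQy hxI ht) ?_).le
      rw [Prod.dist_eq, dist_self, max_eq_left dist_nonneg]
      exact (Metric.mem_closedBall.1 hs).trans_lt hd2
    have := (convex_closedBall x |δ|).norm_image_sub_le_of_norm_hasDerivWithin_le hder hb
      (Metric.mem_closedBall_self (abs_nonneg δ)) hxδ
    simp only [add_sub_cancel_left, Real.norm_eq_abs] at this
    rwa [add_smul, show ∀ a b c d : E →L[ℝ] E, a - (c + d) - (b - c) = a - b - d by
      intros; abel] at this
  -- `D` is the error of the expected first-order expansion of `X` in `x`. It solves `D' = B D` up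
  -- to a term of size `η |δ|` and is small at `y₀`, so Grönwall's inequality shows that it is
  -- `o(δ)`. Differentiability of the flow in the parameter is thus never needed beforehand.
  set D : ℝ → E := fun t => X (x + δ, t) - X (x, t) - δ • A (x, t) (X (x, t)) with hD
  set D' : ℝ → E := fun t => B (x + δ, t) (X (x + δ, t)) - B (x, t) (X (x, t))
    - δ • (fderiv ℝ A (x, t) (0, 1) (X (x, t)) + A (x, t) (B (x, t) (X (x, t)))) with hD'
  have hDder : ∀ t ∈ Set.Icc y₀ (y₀ + h), HasDerivWithinAt D (D' t) (Set.Icc y₀ (y₀ + h)) t := by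
    intro t ht
    have hAt : HasFDerivAt A (fderiv ℝ A (x, t)) (x, t) :=
      ((hA.contDiffAt (hΩ.mem_nhds (hbox (hQy hxI ht)))).differentiableAt
        one_ne_zero).hasFDerivAt
    have h1 : HasDerivWithinAt (fun t => A (x, t)) (fderiv ℝ A (x, t) (0, 1))
        (Set.Icc y₀ (y₀ + h)) t :=
      (hAt.comp_hasDerivAt t ((hasDerivAt_const t x).prodMk (hasDerivAt_id t))).hasDerivWithinAt
    exact ((hXy _ (hball hxδ) t ht).sub (hXy x hxI t ht)).sub
      ((h1.clm_apply (hXy x hxI t ht)).const_smul δ)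
  have hbound : ∀ t ∈ Set.Icc y₀ (y₀ + h),
      ‖D' t‖ ≤ max K 1 * ‖D t‖ + η * |δ| * (M + C) := by
    intro t ht
    have e : D' t = (B (x + δ, t) - B (x, t) - δ • fderiv ℝ B (x, t) (1, 0)) (X (x + δ, t))
        + δ • fderiv ℝ B (x, t) (1, 0) (X (x + δ, t) - X (x, t)) + B (x, t) (D t) := by
      simp only [hD, hD']
      -- Flatness trades `∂ᵧA + AB` for `∂ₓB + BA`, which makes the terms of first order in `δ`
      -- cancel.
      rw [flat _ (hbox (hQy hxI ht)) (X (x, t))]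
      simp only [sub_apply, smul_apply, map_sub, map_smul,
        smul_sub, smul_add]
      abel
    have n1 : ‖(B (x + δ, t) - B (x, t) - δ • fderiv ℝ B (x, t) (1, 0)) (X (x + δ, t))‖
        ≤ η * |δ| * M :=
      (ContinuousLinearMap.le_opNorm _ _).trans
        (mul_le_mul (hR t ht) (hM _ (hQy (hball hxδ) ht)) (norm_nonneg _) (by positivity))
    have n2 : ‖δ • fderiv ℝ B (x, t) (1, 0) (X (x + δ, t) - X (x, t))‖ ≤ η * |δ| * C := by
      rw [norm_smul, Real.norm_eq_abs]
      have : ‖X (x + δ, t) - X (x, t)‖ ≤ η := by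
        rw [← dist_eq_norm]
        refine (H1 _ (hQy (hball hxδ) ht) _ (hQy hxI ht) ?_).le
        rw [Prod.dist_eq, dist_self, max_eq_left dist_nonneg, Real.dist_eq, add_sub_cancel_left]
        exact hd1
      have h5 := (ContinuousLinearMap.le_opNorm (fderiv ℝ B (x, t) (1, 0))
        (X (x + δ, t) - X (x, t))).trans
        (mul_le_mul (hC _ (hQy hxI ht)) this (norm_nonneg _) hC0)
      nlinarith [mul_le_mul_of_nonneg_left h5 (abs_nonneg δ)]
    have n3 : ‖B (x, t) (D t)‖ ≤ max K 1 * ‖D t‖ :=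
      (ContinuousLinearMap.le_opNorm _ _).trans
        (mul_le_mul_of_nonneg_right ((hK _ (hQy hxI ht)).trans (le_max_left _ _)) (norm_nonneg _))
    rw [e]
    refine (norm_add₃_le).trans ?_
    linarith
  have hinit : ‖D y₀‖ ≤ η * |δ| := by simpa [hD] using D0
  have key := norm_le_gronwallBound_of_norm_deriv_right_le
    (fun t ht => (hDder t ht).continuousWithinAt)
    (fun t ht => (hDder t ⟨ht.1, ht.2.le⟩).mono_of_mem_nhdsWithin (Icc_mem_nhdsGE_of_mem ht))
    hinit (fun t ht => hbound t ⟨ht.1, ht.2.le⟩) y hy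
  have h6 := gronwallBound_le (δ := η * |δ|) (ε := η * |δ| * (M + C)) (by positivity)
    (by positivity) (le_max_right K 1) (show y - y₀ ≤ h by linarith [hy.2])
  refine (key.trans h6).trans (le_of_eq ?_)
  rw [Real.norm_eq_abs, hη, hG]
  field_simp
  ring

/-- A flat linear system `∂ₓX = AX`, `∂ᵧX = BX` has a nonzero solution on some open set. -/
theorem exists_ne_zero_of_flat [CompleteSpace E] {A B : ℝ × ℝ → E →L[ℝ] E} {Ω : Set (ℝ × ℝ)}
    (hΩ : IsOpen Ω) (hA : ContDiffOn ℝ 1 A Ω) (hB : ContDiffOn ℝ 1 B Ω)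
    (flat : ∀ z ∈ Ω, ∀ e, fderiv ℝ A z (0, 1) e + A z (B z e)
      = fderiv ℝ B z (1, 0) e + B z (A z e))
    {z₀ : ℝ × ℝ} (hz₀ : z₀ ∈ Ω) {e₀ : E} (he₀ : e₀ ≠ 0) :
    ∃ (X : ℝ × ℝ → E) (O : Set (ℝ × ℝ)), IsOpen O ∧ O ⊆ Ω ∧
      (∀ z ∈ O, HasFDerivAt X ((ContinuousLinearMap.fst ℝ ℝ ℝ).smulRight (A z (X z))
        + (ContinuousLinearMap.snd ℝ ℝ ℝ).smulRight (B z (X z))) z) ∧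
      ∃ z ∈ O, X z ≠ 0 := by
  obtain ⟨x₀, y₀⟩ := z₀
  have hAc : ContDiffAt ℝ 1 (fun w : ℝ × ℝ => A (w.2, w.1)) (y₀, x₀) :=
    ContDiffAt.comp (g := A) (f := fun w : ℝ × ℝ => (w.2, w.1)) (y₀, x₀)
      (hA.contDiffAt (hΩ.mem_nhds hz₀)) (contDiffAt_snd.prodMk contDiffAt_fst)
  obtain ⟨h₁, hh₁, Ψ, hΨ, -⟩ := exists_linear_flow hAc e₀
  obtain ⟨hΨ0, hΨd⟩ := hΨ (y₀, e₀) (Metric.mem_closedBall_self hh₁.le)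
  obtain ⟨h₂, hh₂, Φ, hΦ, hΦc⟩ := exists_linear_flow (hB.contDiffAt (hΩ.mem_nhds hz₀)) e₀
  have hΨc : ContinuousOn (fun x => Ψ ((y₀, e₀), x)) (Set.Icc (x₀ - h₁) (x₀ + h₁)) :=
    fun t ht => (hΨd t ht).continuousWithinAt
  have hnear : ∀ᶠ x in 𝓝 x₀, Ψ ((y₀, e₀), x) ∈ Metric.closedBall e₀ h₂ := by
    have : ContinuousAt (fun x => Ψ ((y₀, e₀), x)) x₀ :=
      hΨc.continuousAt (Icc_mem_nhds (by linarith) (by linarith))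
    have h0 : Ψ ((y₀, e₀), x₀) = e₀ := hΨ0
    refine this.eventually (?_ : Metric.closedBall e₀ h₂ ∈ 𝓝 (Ψ ((y₀, e₀), x₀)))
    rw [h0]
    exact Metric.closedBall_mem_nhds e₀ hh₂
  obtain ⟨h₃, hh₃, H3⟩ := Metric.eventually_nhds_iff_ball.1 hnear
  obtain ⟨h₄, hh₄, H4⟩ := Metric.isOpen_iff.1 hΩ _ hz₀
  obtain ⟨h, hh, l1, l2, l3, l4⟩ : ∃ h > 0, h ≤ h₁ ∧ h ≤ h₂ ∧ h < h₃ ∧ h < h₄ := by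
    refine ⟨min (min h₁ h₂) (min (h₃ / 2) (h₄ / 2)), by positivity, ?_, ?_, ?_, ?_⟩
    · exact (min_le_left _ _).trans (min_le_left _ _)
    · exact (min_le_left _ _).trans (min_le_right _ _)
    · linarith [(min_le_right (min h₁ h₂) (min (h₃ / 2) (h₄ / 2))).trans (min_le_left _ _)]
    · linarith [(min_le_right (min h₁ h₂) (min (h₃ / 2) (h₄ / 2))).trans (min_le_right _ _)]
  have habs {x : ℝ} (hx : x ∈ Set.Icc (x₀ - h) (x₀ + h)) : dist x x₀ ≤ h := by
    rw [Real.dist_eq, abs_le]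
    constructor <;> linarith [hx.1, hx.2]
  have hbox : Set.Icc (x₀ - h) (x₀ + h) ×ˢ Set.Icc y₀ (y₀ + h) ⊆ Ω := by
    rintro ⟨x, y⟩ ⟨hx, hy⟩
    apply H4
    rw [Metric.mem_ball, Prod.dist_eq]
    refine max_lt ((habs hx).trans_lt l4) ?_
    rw [Real.dist_eq, abs_lt]
    constructor <;> linarith [hy.1, hy.2]
  have hq {x : ℝ} (hx : x ∈ Set.Icc (x₀ - h) (x₀ + h)) :
      (x, Ψ ((y₀, e₀), x)) ∈ Metric.closedBall (x₀, e₀) h₂ := by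
    rw [Metric.mem_closedBall, Prod.dist_eq]
    exact max_le ((habs hx).trans l2) (H3 x ((habs hx).trans_lt l3))
  -- The equation in `x` is solved along the line `y = y₀`, and each value is then transported by
  -- the equation in `y`.
  set X : ℝ × ℝ → E := fun z => Φ ((z.1, Ψ ((y₀, e₀), z.1)), z.2) with hXdef
  have hyI : Set.Icc y₀ (y₀ + h) ⊆ Set.Icc (y₀ - h₂) (y₀ + h₂) :=
    Set.Icc_subset_Icc (by linarith) (by linarith)
  have hxI : Set.Icc (x₀ - h) (x₀ + h) ⊆ Set.Icc (x₀ - h₁) (x₀ + h₁) :=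
    Set.Icc_subset_Icc (by linarith) (by linarith)
  have hXc : ContinuousOn X (Set.Icc (x₀ - h) (x₀ + h) ×ˢ Set.Icc y₀ (y₀ + h)) := by
    refine hΦc.comp (f := fun z : ℝ × ℝ => ((z.1, Ψ ((y₀, e₀), z.1)), z.2)) ?_ ?_
    · refine (continuousOn_fst.prodMk ?_).prodMk continuousOn_snd
      exact (hΨc.mono hxI).comp continuousOn_fst (fun z hz => hz.1)
    · rintro ⟨x, y⟩ ⟨hx, hy⟩
      exact ⟨hq hx, hyI hy⟩
  have hXy : ∀ x ∈ Set.Icc (x₀ - h) (x₀ + h), ∀ y ∈ Set.Icc y₀ (y₀ + h),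
      HasDerivWithinAt (fun y => X (x, y)) (B (x, y) (X (x, y))) (Set.Icc y₀ (y₀ + h)) y :=
    fun x hx y hy => ((hΦ _ (hq hx)).2 y (hyI hy)).mono hyI
  have hX0 : ∀ x ∈ Set.Icc (x₀ - h) (x₀ + h), X (x, y₀) = Ψ ((y₀, e₀), x) :=
    fun x hx => (hΦ _ (hq hx)).1
  have hXx : ∀ x ∈ Set.Ioo (x₀ - h) (x₀ + h),
      HasDerivAt (fun x => X (x, y₀)) (A (x, y₀) (X (x, y₀))) x := by
    intro x hx
    rw [hX0 x (Set.Ioo_subset_Icc_self hx)]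
    refine ((hΨd x (hxI (Set.Ioo_subset_Icc_self hx))).hasDerivAt ?_).congr_of_eventuallyEq ?_
    · exact Icc_mem_nhds (by linarith [hx.1]) (by linarith [hx.2])
    · filter_upwards [Ioo_mem_nhds hx.1 hx.2] with t ht
      exact hX0 t (Set.Ioo_subset_Icc_self ht)
  -- The Grönwall estimate runs only towards larger `y`, so `(x₀, y₀)` lies on the boundary of `O`.
  -- Continuity along `x = x₀` still gives a nonzero value inside.
  set O : Set (ℝ × ℝ) := Set.Ioo (x₀ - h) (x₀ + h) ×ˢ Set.Ioo y₀ (y₀ + h) with hO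
  have hOo : IsOpen O := isOpen_Ioo.prod isOpen_Ioo
  have hOQ : O ⊆ Set.Icc (x₀ - h) (x₀ + h) ×ˢ Set.Icc y₀ (y₀ + h) :=
    Set.prod_mono Set.Ioo_subset_Icc_self Set.Ioo_subset_Icc_self
  have hAX : ContinuousOn (fun z => A z (X z)) O :=
    (hA.continuousOn.mono (hOQ.trans hbox)).clm_apply (hXc.mono hOQ)
  have hBX : ContinuousOn (fun z => B z (X z)) O :=
    (hB.continuousOn.mono (hOQ.trans hbox)).clm_apply (hXc.mono hOQ)
  refine ⟨X, O, hOo, hOQ.trans hbox, fun z hz => ?_, ?_⟩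
  -- Both partial derivatives exist and are continuous, hence `X` is differentiable.
  · have := hasStrictFDerivAt_uncurry_coprod (𝕜 := ℝ) (u := z) (f := fun x y => X (x, y))
      (f₁ := fun x y => ContinuousLinearMap.smulRight (1 : ℝ →L[ℝ] ℝ) (A (x, y) (X (x, y))))
      (f₂ := fun x y => ContinuousLinearMap.smulRight (1 : ℝ →L[ℝ] ℝ) (B (x, y) (X (x, y))))
      ?_ ?_ ?_ ?_
    · have hd : HasFDerivAt X (ContinuousLinearMap.coprod
          (ContinuousLinearMap.smulRight (1 : ℝ →L[ℝ] ℝ) (A z (X z)))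
          (ContinuousLinearMap.smulRight (1 : ℝ →L[ℝ] ℝ) (B z (X z)))) z := this.hasFDerivAt
      refine hd.congr_fderiv ?_
      ext <;> simp
    · filter_upwards [hOo.mem_nhds hz] with w hw
      exact (hasDerivAt_fst_of_flat hΩ hA hB flat hbox hXc hXy hXx hw.1
        (Set.Ioo_subset_Icc_self hw.2)).hasFDerivAt
    · filter_upwards [hOo.mem_nhds hz] with w hw
      exact ((hXy w.1 (Set.Ioo_subset_Icc_self hw.1) w.2
        (Set.Ioo_subset_Icc_self hw.2)).hasDerivAt (Icc_mem_nhds hw.2.1 hw.2.2)).hasFDerivAt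
    · exact ((ContinuousLinearMap.smulRightL ℝ ℝ E (1 : ℝ →L[ℝ] ℝ)).continuous.continuousAt.comp
          (hAX.continuousAt (hOo.mem_nhds hz)))
    · exact ((ContinuousLinearMap.smulRightL ℝ ℝ E (1 : ℝ →L[ℝ] ℝ)).continuous.continuousAt.comp
          (hBX.continuousAt (hOo.mem_nhds hz)))
  · have hx₀ : x₀ ∈ Set.Icc (x₀ - h) (x₀ + h) := ⟨by linarith, by linarith⟩
    have hy₀ : y₀ ∈ Set.Icc y₀ (y₀ + h) := ⟨le_rfl, by linarith⟩
    have hc := (hXy x₀ hx₀ y₀ hy₀).continuousWithinAt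
    have h0 : X (x₀, y₀) = e₀ := (hX0 x₀ hx₀).trans hΨ0
    have hne : ∀ᶠ y in 𝓝[Set.Icc y₀ (y₀ + h)] y₀, X (x₀, y) ≠ 0 :=
      hc.eventually_ne (by change X (x₀, y₀) ≠ 0; rw [h0]; exact he₀)
    have hne' : ∀ᶠ y in 𝓝[>] y₀, X (x₀, y) ≠ 0 ∧ y ∈ Set.Ioo y₀ (y₀ + h) := by
      have hioo : Set.Ioo y₀ (y₀ + h) ∈ 𝓝[>] y₀ := Ioo_mem_nhdsGT (by linarith)
      refine Filter.Eventually.and ?_ hioo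
      refine hne.filter_mono ?_
      rw [← nhdsWithin_Ioo_eq_nhdsGT (show y₀ < y₀ + h by linarith)]
      exact nhdsWithin_mono _ Set.Ioo_subset_Icc_self
    obtain ⟨y, hy, hyI⟩ := hne'.exists
    exact ⟨(x₀, y), ⟨⟨by linarith, by linarith⟩, hyI⟩, hy⟩

end Frobenius

/-! ### Linear systems in components and uniqueness of their solutions. -/

section Systems

/-- A flat linear system of first order partial differential equations in the plane has a nonzero
solution on some open set. -/
theorem exists_ne_zero_of_flat_system {k : ℕ} (hk : 0 < k) {V : Set Plane} (hV : IsOpen V)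
    (hne : V.Nonempty) (C : Fin 2 → Fin k → Fin k → Plane → ℝ)
    (hC : ∀ a i j, ContDiffOn ℝ 1 (C a i j) V)
    (flat : ∀ x ∈ V, ∀ i j, pd 1 (C 0 i j) x + ∑ l, C 0 i l x * C 1 l j x
      = pd 0 (C 1 i j) x + ∑ l, C 1 i l x * C 0 l j x) :
    ∃ (Y : Fin k → Plane → ℝ) (O : Set Plane), IsOpen O ∧ O ⊆ V ∧
      (∀ x ∈ O, ∀ i, DifferentiableAt ℝ (Y i) x ∧ ∀ a, pd a (Y i) x = ∑ j, C a i j x * Y j x) ∧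
      ∃ x ∈ O, ∃ i, Y i x ≠ 0 := by
  let ι : ℝ × ℝ →L[ℝ] Plane :=
    ContinuousLinearMap.pi ![ContinuousLinearMap.fst ℝ ℝ ℝ, ContinuousLinearMap.snd ℝ ℝ ℝ]
  let π : Plane →L[ℝ] ℝ × ℝ :=
    (ContinuousLinearMap.proj 0).prod (ContinuousLinearMap.proj 1)
  have hιπ : ∀ x, ι (π x) = x := by
    intro x; ext i; fin_cases i <;> simp [ι, π]
  have hι0 : ι (1, 0) = Pi.single 0 1 := by ext i; fin_cases i <;> simp [ι]
  have hι1 : ι (0, 1) = Pi.single 1 1 := by ext i; fin_cases i <;> simp [ι]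
  let T₀ : (Fin k → Fin k → ℝ) →ₗ[ℝ] ((Fin k → ℝ) →L[ℝ] (Fin k → ℝ)) :=
    { toFun := fun M => LinearMap.toContinuousLinearMap (Matrix.toLin' (Matrix.of M))
      map_add' := fun M N => by
        ext; simp [Matrix.mulVec, dotProduct, add_mul, Finset.sum_add_distrib]
      map_smul' := fun c M => by
        ext; simp [Matrix.mulVec, dotProduct, mul_assoc, Finset.mul_sum] }
  let T := LinearMap.toContinuousLinearMap T₀
  have hT : ∀ M e i, T M e i = ∑ j, M i j * e j := by
    intro M e i
    simp [T, T₀, Matrix.mulVec, dotProduct]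
  let A : Fin 2 → ℝ × ℝ → (Fin k → ℝ) →L[ℝ] (Fin k → ℝ) :=
    fun a z => T (fun i j => C a i j (ι z))
  have hΩ : IsOpen (ι ⁻¹' V) := hV.preimage ι.continuous
  have hA (a : Fin 2) : ContDiffOn ℝ 1 (A a) (ι ⁻¹' V) := by
    refine T.contDiff.comp_contDiffOn (contDiffOn_pi.2 fun i => contDiffOn_pi.2 fun j => ?_)
    exact (hC a i j).comp ι.contDiff.contDiffOn (fun z hz => hz)
  have hdA (a b : Fin 2) (w : ℝ × ℝ) (hw : ι w = Pi.single b 1) (z) (hz : z ∈ ι ⁻¹' V) (e i) :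
      fderiv ℝ (A a) z w e i = ∑ j, pd b (C a i j) (ι z) * e j := by
    have h1 (i j) : HasFDerivAt (fun z => C a i j (ι z))
        ((fderiv ℝ (C a i j) (ι z)).comp ι) z :=
      ((hC a i j).differentiableAt_of_isOpen hV one_ne_zero hz).hasFDerivAt.comp z ι.hasFDerivAt
    have h2 : HasFDerivAt (A a) (T.comp (ContinuousLinearMap.pi fun i =>
        ContinuousLinearMap.pi fun j => (fderiv ℝ (C a i j) (ι z)).comp ι)) z :=
      T.hasFDerivAt.comp z (hasFDerivAt_pi.2 fun i => hasFDerivAt_pi.2 fun j => h1 i j)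
    rw [h2.fderiv, ContinuousLinearMap.comp_apply, hT]
    simp [pd, hw]
  obtain ⟨x₀, hx₀⟩ := hne
  obtain ⟨X, O, hO, hOV, hX, z₁, hz₁, hne₁⟩ := exists_ne_zero_of_flat hΩ (hA 0) (hA 1)
    (fun z hz e => by
      ext i
      simp only [Pi.add_apply, hdA 0 1 _ hι1 z hz, hdA 1 0 _ hι0 z hz]
      simp only [A, hT, Finset.mul_sum]
      rw [Finset.sum_comm, ← Finset.sum_add_distrib]
      conv_rhs => rw [Finset.sum_comm, ← Finset.sum_add_distrib]
      refine Finset.sum_congr rfl fun j _ => ?_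
      have := flat (ι z) hz i j
      simp only [← mul_assoc, ← Finset.sum_mul, ← add_mul]
      rw [this])
    (z₀ := π x₀) (by simpa [hιπ] using hx₀) (e₀ := fun _ => (1 : ℝ))
    (fun h => one_ne_zero (congrFun h ⟨0, hk⟩))
  refine ⟨fun i x => X (π x) i, π ⁻¹' O, hO.preimage π.continuous, fun x hx => ?_, ?_, ?_⟩
  · simpa [hιπ] using hOV hx
  · intro x hx i
    have h1 := (hasFDerivAt_pi'.1 ((hX _ hx).comp x π.hasFDerivAt)) i
    refine ⟨h1.differentiableAt, fun a => ?_⟩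
    have h2 := h1.fderiv
    have h3 : fderiv ℝ (fun x => X (π x) i) x = _ := h2
    rw [pd, h3]
    fin_cases a <;> simp [π, A, hT]
    all_goals
      have e : ι (x 0, x 1) = x := hιπ x
      rw [e]
  · refine ⟨ι z₁, ?_, ?_⟩
    · have : π (ι z₁) = z₁ := by simp [ι, π]
      simpa [this] using hz₁
    · have : π (ι z₁) = z₁ := by simp [ι, π]
      simpa [this] using Function.ne_iff.1 hne₁

/-- Functions whose derivatives are bounded by a multiple of their values vanish identically on a
connected open set if they vanish at a point. -/
theorem eq_zero_of_pd_isBigO {ι : Type*} [Fintype ι] {V : Set Plane} (hV : IsOpen V)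
    (hc : IsPreconnected V) {J : ι → Plane → ℝ} (hd : ∀ i, ∀ x ∈ V, DifferentiableAt ℝ (J i) x)
    (hb : ∀ x ∈ V, ∀ a i, pd a (J i) =O[𝓝 x] fun y => ∑ j, |J j y|)
    {x₀ : Plane} (hx₀ : x₀ ∈ V) (h₀ : ∀ i, J i x₀ = 0) : ∀ x ∈ V, ∀ i, J i x = 0 := by
  -- The common zero set is open: Grönwall's inequality applies to the vector of all `J i` along the
  -- segment from `x` to a nearby point.
  have loc : ∀ x ∈ V, (∀ i, J i x = 0) → ∀ᶠ y in 𝓝 x, ∀ i, J i y = 0 := by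
    intro x hx hJ
    choose c hc using fun a i => (hb x hx a i).bound
    have hc' : ∀ᶠ y in 𝓝 x, y ∈ V ∧ ∀ a i, ‖pd a (J i) y‖ ≤ c a i * ‖∑ j, |J j y|‖ :=
      Filter.Eventually.and (hV.mem_nhds hx) (Filter.eventually_all.2 fun a => Filter.eventually_all.2 fun i => hc a i)
    obtain ⟨ρ, hρ, H⟩ := Metric.eventually_nhds_iff_ball.1 hc'
    filter_upwards [Metric.ball_mem_nhds x hρ] with y hy
    set K := ∑ a, ∑ i, |c a i| with hK
    have hcK (a i) : c a i ≤ K := by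
      refine (le_abs_self _).trans ((Finset.single_le_sum (f := fun i => |c a i|)
        (fun _ _ => abs_nonneg _) (Finset.mem_univ i)).trans ?_)
      exact Finset.single_le_sum (f := fun a => ∑ i, |c a i|)
        (fun _ _ => Finset.sum_nonneg fun _ _ => abs_nonneg _) (Finset.mem_univ a)
    have hK0 : 0 ≤ K := Finset.sum_nonneg fun _ _ => Finset.sum_nonneg fun _ _ => abs_nonneg _
    let γ : ℝ → Plane := fun t => x + t • (y - x)
    have hγ : ∀ t, HasDerivAt γ (y - x) t := fun t => by
      have := ((hasDerivAt_id t).smul_const (y - x)).const_add x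
      rwa [one_smul] at this
    have hγm : ∀ t ∈ Set.Icc (0 : ℝ) 1, γ t ∈ Metric.ball x ρ := fun t ht => by
      rw [Metric.mem_ball, dist_eq_norm] at hy ⊢
      simp only [γ, add_sub_cancel_left, norm_smul, Real.norm_eq_abs, abs_of_nonneg ht.1]
      nlinarith [norm_nonneg (y - x), ht.2]
    have hder : ∀ t ∈ Set.Icc (0 : ℝ) 1, HasDerivAt (fun t i => J i (γ t))
        (fun i => fderiv ℝ (J i) (γ t) (y - x)) t := fun t ht =>
      hasDerivAt_pi.2 fun i => ((hd i _ (H _ (hγm t ht)).1).hasFDerivAt.comp_hasDerivAt t (hγ t))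
    -- In the constant, `2` counts the coordinates of `y - x`, `K` dominates all the local constants
    -- `c a i`, and the cardinality compares the sum of the `|J j|` with the supremum norm.
    have key := eq_zero_of_abs_deriv_le_mul_abs_self_of_eq_zero_right
      (f := fun t i => J i (γ t)) (f' := fun t i => fderiv ℝ (J i) (γ t) (y - x))
      (K := 2 * ‖y - x‖ * K * Fintype.card ι) (a := 0) (b := 1)
      (fun t ht => (hder t ht).continuousAt.continuousWithinAt)
      (fun t ht => (hder t ⟨ht.1, ht.2.le⟩).hasDerivWithinAt)
      (by ext i; simp [γ, hJ i])
      (fun t ht => by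
        rw [pi_norm_le_iff_of_nonneg (by positivity)]
        intro i
        have hB := (H _ (hγm t ⟨ht.1, ht.2.le⟩)).2
        have hsum : ‖∑ j, |J j (γ t)|‖ ≤ Fintype.card ι * ‖fun i => J i (γ t)‖ := by
          rw [Real.norm_of_nonneg (Finset.sum_nonneg fun _ _ => abs_nonneg _)]
          refine (Finset.sum_le_card_nsmul _ _ ‖fun i => J i (γ t)‖ fun j _ => ?_).trans ?_
          · exact norm_le_pi_norm (fun i => J i (γ t)) j
          · rw [nsmul_eq_mul, Finset.card_univ]
        have hB' (a) : ‖pd a (J i) (γ t)‖ ≤ K * (Fintype.card ι * ‖fun i => J i (γ t)‖) :=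
          (hB a i).trans (mul_le_mul (hcK a i) hsum (norm_nonneg _) hK0)
        have hv (a) : ‖(y - x) a‖ ≤ ‖y - x‖ := norm_le_pi_norm _ a
        rw [fderiv_apply_eq_pd]
        refine (norm_add_le _ _).trans ?_
        rw [norm_mul, norm_mul]
        have m0 := mul_le_mul (hv 0) (hB' 0) (norm_nonneg _) (norm_nonneg _)
        have m1 := mul_le_mul (hv 1) (hB' 1) (norm_nonneg _) (norm_nonneg _)
        linarith)
    intro i
    have := congrFun (key 1 (by simp)) i
    simpa [γ] using this
  have hsub := hc.subset_left_of_subset_union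
    (u := {x | ∀ᶠ y in 𝓝 x, ∀ i, J i y = 0}) (v := {x | x ∈ V ∧ ∃ i, J i x ≠ 0})
    (isOpen_setOfPred_eventually_nhds) ?_ ?_ ?_ ⟨x₀, hx₀, loc x₀ hx₀ h₀⟩
  · exact fun x hx i => (hsub hx).self_of_nhds i
  · rw [isOpen_iff_mem_nhds]
    rintro x ⟨hx, i, hi⟩
    filter_upwards [hV.mem_nhds hx, (hd i x hx).continuousAt.eventually_ne hi] with y h1 h2
    exact ⟨h1, i, h2⟩
  · rw [Set.disjoint_left]
    rintro x hx ⟨-, i, hi⟩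
    exact hi (hx.self_of_nhds i)
  · intro x hx
    by_cases h : ∀ i, J i x = 0
    · exact Or.inl (loc x hx h)
    · push Not at h
      exact Or.inr ⟨hx, h⟩

end Systems

/-! ### Weyl's theorem: geodesics and Thomas symbols. -/

section Weyl

variable {n : ℕ∞} {V : Opens Plane} {Γ Γ' : Christoffel}

theorem thomas_symm (hΓ : IsTorsionFreeConnection n V Γ) {x : Plane} (hx : x ∈ V) (c a b : Fin 2) :
    thomas Γ x c a b = thomas Γ x c b a := by
  simp only [thomas, hΓ.symm x hx c a b]
  ring

theorem thomas_trace (Γ : Christoffel) (x : Plane) (a : Fin 2) :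
    thomas Γ x 0 0 a + thomas Γ x 1 1 a = 0 := by
  fin_cases a <;> simp [thomas, Fin.sum_univ_two] <;> ring

theorem contDiffOn_thomas (hΓ : IsTorsionFreeConnection n V Γ) (c a b : Fin 2) :
    ContDiffOn ℝ n (fun x => thomas Γ x c a b) V := by
  have h := hΓ.contDiffOn
  unfold thomas
  exact ((h c a b).sub ((contDiffOn_const.mul (ContDiffOn.sum fun d _ => h d d a)).mul
    contDiffOn_const)).sub ((contDiffOn_const.mul (ContDiffOn.sum fun d _ => h d d b)).mul
    contDiffOn_const)

/-- Connections with equal Thomas symbols differ by `δ^c_a υ_b + δ^c_b υ_a`, where `υ` is a third of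
the difference of the traces. This changes the acceleration by `2 υ(γ̇) γ̇`, a multiple of the
velocity. -/
theorem IsUnparametrisedGeodesic.of_thomas_eq
    (h : ∀ x ∈ V, ∀ c a b, thomas Γ x c a b = thomas Γ' x c a b) {s t : ℝ} {γ : ℝ → Plane}
    (hγ : IsUnparametrisedGeodesic V Γ s t γ) : IsUnparametrisedGeodesic V Γ' s t γ := by
  refine ⟨hγ.mapsTo, hγ.contDiffOn, hγ.regular, ?_⟩
  obtain ⟨v, hv⟩ := hγ.geodesic
  refine ⟨fun τ => v τ + (2 / 3) * ∑ a, (∑ d, Γ' (γ τ) d d a - ∑ d, Γ (γ τ) d d a) * deriv γ τ a,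
    fun τ hτ c => ?_⟩
  have h1 := hv τ hτ c
  have h2 := h _ (hγ.mapsTo τ hτ) c
  have e00 := h2 0 0
  have e01 := h2 0 1
  have e10 := h2 1 0
  have e11 := h2 1 1
  simp only [thomas, Fin.sum_univ_two] at h1 e00 e01 e10 e11 ⊢
  set u := deriv γ τ 0
  set w := deriv γ τ 1
  fin_cases c <;> simp at h1 e00 e01 e10 e11 ⊢ <;>
  linear_combination h1 - u * u * e00 - u * w * e01 - w * u * e10 - w * w * e11

theorem mem_projectiveStructure_of_thomas_eq (hΓ' : IsTorsionFreeConnection n V Γ')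
    (h : ∀ x ∈ V, ∀ c a b, thomas Γ x c a b = thomas Γ' x c a b) :
    Γ' ∈ projectiveStructure n V Γ :=
  ⟨hΓ', fun _ _ _ => ⟨fun hγ => hγ.of_thomas_eq h,
    fun hγ => hγ.of_thomas_eq fun x hx c a b => (h x hx c a b).symm⟩⟩

/-- Picard–Lindelöf for the geodesic equation as a first-order system in position and velocity; on a
short interval the curve stays in `V` and the velocity stays nonzero. -/
theorem exists_isUnparametrisedGeodesic (hn : 1 ≤ n) (hΓ : IsTorsionFreeConnection n V Γ)
    {x v : Plane} (hx : x ∈ V) (hv : v ≠ 0) :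
    ∃ ε > 0, ∃ γ, IsUnparametrisedGeodesic V Γ (-ε) ε γ ∧ γ 0 = x ∧ deriv γ 0 = v := by
  let f : Plane × Plane → Plane × Plane :=
    fun z => (z.2, fun c => -∑ a, ∑ b, Γ z.1 c a b * z.2 a * z.2 b)
  have hΓ1 (c a b : Fin 2) : ContDiffOn ℝ 1 (fun x => Γ x c a b) V :=
    (hΓ.contDiffOn c a b).of_le (by exact_mod_cast hn)
  have hfst (c a b : Fin 2) : ContDiffOn ℝ 1 (fun z : Plane × Plane => Γ z.1 c a b)
      ((V : Set Plane) ×ˢ Set.univ) :=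
    (hΓ1 c a b).comp contDiffOn_fst (fun z hz => hz.1)
  have hsnd (a : Fin 2) : ContDiffOn ℝ 1 (fun z : Plane × Plane => z.2 a)
      ((V : Set Plane) ×ˢ Set.univ) := by fun_prop
  have hf : ContDiffOn ℝ 1 f ((V : Set Plane) ×ˢ Set.univ) := by
    refine contDiffOn_snd.prodMk (contDiffOn_pi.2 fun c => ContDiffOn.neg ?_)
    exact ContDiffOn.sum fun a _ => ContDiffOn.sum fun b _ =>
      ((hfst c a b).mul (hsnd a)).mul (hsnd b)
  have hW : IsOpen ((V : Set Plane) ×ˢ (Set.univ : Set Plane)) := V.isOpen.prod isOpen_univ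
  have hf0 : ContDiffAt ℝ 1 f (x, v) := hf.contDiffAt (hW.mem_nhds ⟨hx, trivial⟩)
  obtain ⟨α, hα0, ε₁, hε₁, hα⟩ :=
    hf0.exists_forall_mem_closedBall_exists_eq_forall_mem_Ioo_hasDerivAt₀ 0
  have hαc : ContinuousAt α 0 := (hα 0 ⟨by linarith, by linarith⟩).continuousAt
  have hopen : IsOpen ((V : Set Plane) ×ˢ ({0}ᶜ : Set Plane)) :=
    V.isOpen.prod isOpen_compl_singleton
  have hev : ∀ᶠ t in 𝓝 (0 : ℝ), α t ∈ (V : Set Plane) ×ˢ ({0}ᶜ : Set Plane) :=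
    hαc.eventually_mem (hopen.mem_nhds (by rw [hα0]; exact ⟨hx, hv⟩))
  obtain ⟨ε₂, hε₂, H⟩ := Metric.eventually_nhds_iff_ball.1 hev
  refine ⟨min ε₁ ε₂, lt_min hε₁ hε₂, fun t => (α t).1, ?_, by simp [hα0], ?_⟩
  all_goals
    have hI : ∀ t ∈ Set.Ioo (-min ε₁ ε₂) (min ε₁ ε₂),
        HasDerivAt α (f (α t)) t ∧ α t ∈ (V : Set Plane) ×ˢ ({0}ᶜ : Set Plane) := by
      intro t ht
      have h1 := min_le_left ε₁ ε₂
      have h2 := min_le_right ε₁ ε₂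
      refine ⟨hα t ⟨by linarith [ht.1], by linarith [ht.2]⟩, H t ?_⟩
      rw [mem_ball_zero_iff, Real.norm_eq_abs, abs_lt]
      exact ⟨by linarith [ht.1], by linarith [ht.2]⟩
    have hd1 : ∀ t ∈ Set.Ioo (-min ε₁ ε₂) (min ε₁ ε₂),
        HasDerivAt (fun t => (α t).1) (α t).2 t := fun t ht =>
      (ContinuousLinearMap.fst ℝ Plane Plane).hasFDerivAt.comp_hasDerivAt t (hI t ht).1
    have hd2 : ∀ t ∈ Set.Ioo (-min ε₁ ε₂) (min ε₁ ε₂),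
        HasDerivAt (fun t => (α t).2) (f (α t)).2 t := fun t ht =>
      (ContinuousLinearMap.snd ℝ Plane Plane).hasFDerivAt.comp_hasDerivAt t (hI t ht).1
  · have hdd : ∀ t ∈ Set.Ioo (-min ε₁ ε₂) (min ε₁ ε₂),
        deriv (deriv fun t => (α t).1) t = (f (α t)).2 := by
      intro t ht
      have : deriv (fun t => (α t).1) =ᶠ[𝓝 t] fun t => (α t).2 := by
        filter_upwards [Ioo_mem_nhds ht.1 ht.2] with s hs using (hd1 s hs).deriv
      rw [this.deriv_eq, (hd2 t ht).deriv]
    refine ⟨fun t ht => (hI t ht).2.1, ?_, fun t ht => ?_, fun _ => 0, fun t ht c => ?_⟩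
    · have e2 : (2 : WithTop ℕ∞) = 1 + 1 := by norm_num
      rw [e2, contDiffOn_succ_iff_deriv_of_isOpen isOpen_Ioo]
      refine ⟨fun t ht => (hd1 t ht).differentiableAt.differentiableWithinAt, by simp, ?_⟩
      refine ContDiffOn.congr (f := fun t => (α t).2) ?_ fun t ht => (hd1 t ht).deriv
      have e1 : (1 : WithTop ℕ∞) = 0 + 1 := by norm_num
      rw [e1, contDiffOn_succ_iff_deriv_of_isOpen isOpen_Ioo]
      refine ⟨fun t ht => (hd2 t ht).differentiableAt.differentiableWithinAt, by simp, ?_⟩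
      rw [contDiffOn_zero]
      refine ContinuousOn.congr (f := fun t => (f (α t)).2) ?_ fun t ht => (hd2 t ht).deriv
      refine continuous_snd.comp_continuousOn (hf.continuousOn.comp
        (fun t ht => (hI t ht).1.continuousAt.continuousWithinAt) fun t ht => ?_)
      exact ⟨(hI t ht).2.1, trivial⟩
    · rw [(hd1 t ht).deriv]
      exact (hI t ht).2.2
    · rw [hdd t ht, (hd1 t ht).deriv]
      simp only [f, neg_add_cancel, zero_mul]
  · rw [(hd1 0 ⟨by simp [hε₁, hε₂], by simp [hε₁, hε₂]⟩).deriv, hα0]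

/-- Weyl's theorem: connections with the same unparametrised geodesics have the same Thomas
symbols. -/
theorem thomas_eq_of_mem_projectiveStructure (hn : 1 ≤ n) (hΓ : IsTorsionFreeConnection n V Γ)
    (h : Γ' ∈ projectiveStructure n V Γ) {x : Plane} (hx : x ∈ V) (c a b : Fin 2) :
    thomas Γ' x c a b = thomas Γ x c a b := by
  -- On a common geodesic the two accelerations differ by a multiple of the velocity, so the
  -- difference of the connections, evaluated on `(v, v)`, is parallel to `v`. This is the vanishing
  -- of a binary cubic form in `v`.
  have key (v : Plane) (hv : v ≠ 0) :
      (∑ a, ∑ b, (Γ' x 0 a b - Γ x 0 a b) * v a * v b) * v 1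
        = (∑ a, ∑ b, (Γ' x 1 a b - Γ x 1 a b) * v a * v b) * v 0 := by
    obtain ⟨ε, hε, γ, hγ, h0, h1⟩ := exists_isUnparametrisedGeodesic hn hΓ hx hv
    have hmem : (0 : ℝ) ∈ Set.Ioo (-ε) ε := ⟨by linarith, hε⟩
    obtain ⟨μ, hμ⟩ := hγ.geodesic
    obtain ⟨μ', hμ'⟩ := ((h.2 _ _ _).1 hγ).geodesic
    have a0 := hμ 0 hmem 0
    have a1 := hμ 0 hmem 1
    have b0 := hμ' 0 hmem 0
    have b1 := hμ' 0 hmem 1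
    simp only [h0, h1, Fin.sum_univ_two] at a0 a1 b0 b1 ⊢
    linear_combination v 1 * (b0 - a0) - v 0 * (b1 - a1)
  -- A binary cubic that vanishes in four pairwise independent directions is zero. Its four
  -- coefficients are multiples of the independent components of the difference of the Thomas
  -- symbols.
  have k1 := key ![1, 0] (fun h => by simpa using congrFun h 0)
  have k2 := key ![0, 1] (fun h => by simpa using congrFun h 1)
  have k3 := key ![1, 1] (fun h => by simpa using congrFun h 0)
  have k4 := key ![1, -1] (fun h => by simpa using congrFun h 0)
  simp [Fin.sum_univ_two] at k1 k2 k3 k4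
  have s0 := hΓ.symm x hx 0 0 1
  have s1 := hΓ.symm x hx 1 0 1
  have s0' := h.1.symm x hx 0 0 1
  have s1' := h.1.symm x hx 1 0 1
  fin_cases c <;> fin_cases a <;> fin_cases b <;> simp [thomas, Fin.sum_univ_two] <;> grind

end Weyl

/-! ### The metrisability equations for a Levi-Civita connection. -/

section LeviCivita

/-- Here `E`, `F`, `G` are the components of a nondegenerate solution and `p`, `q`, `r`, `s` the
differences between two sets of Thomas symbols for which it solves the equations. The linear system
has determinant `-(E G - F²)²`; the combinations below come from its adjugate. -/
theorem eq_zero_of_cyclic {E F G p q r s : ℝ} (hD : E * G - F * F ≠ 0)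
    (h0 : p * E + s * F = 0) (h1 : s * G - 2 * q * E - p * F = 0)
    (h2 : r * E - 2 * p * G - q * F = 0) (h3 : r * F + q * G = 0) :
    p = 0 ∧ q = 0 ∧ r = 0 ∧ s = 0 := by
  have hD2 : (E * G - F * F) ^ 2 ≠ 0 := pow_ne_zero 2 hD
  refine ⟨?_, ?_, ?_, ?_⟩ <;> apply (mul_eq_zero_iff_left hD2).1
  · linear_combination (F ^ 2 * G + E * G ^ 2) * h0 - (F ^ 3 + E * F * G) * h1
      + 2 * E * F ^ 2 * h2 - 2 * E ^ 2 * F * h3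
  · linear_combination -2 * F * G ^ 2 * h0 + 2 * F ^ 2 * G * h1 - (E * F * G + F ^ 3) * h2
      + (E ^ 2 * G + E * F ^ 2) * h3
  · linear_combination 2 * G ^ 3 * h0 - 2 * F * G ^ 2 * h1 + (E * G ^ 2 + F ^ 2 * G) * h2
      - (3 * E * F * G - F ^ 3) * h3
  · linear_combination (F ^ 3 - 3 * E * F * G) * h0 + (E * F ^ 2 + E ^ 2 * G) * h1
      - 2 * E ^ 2 * F * h2 + 2 * E ^ 3 * h3

variable {n : ℕ∞} {V : Opens Plane}

theorem det_eq (g : Plane → Matrix (Fin 2) (Fin 2) ℝ) (y : Plane) :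
    (g y).det = g y 0 0 * g y 1 1 - g y 0 1 * g y 1 0 := Matrix.det_fin_two _

theorem inv_zero_zero (M : Matrix (Fin 2) (Fin 2) ℝ) : M⁻¹ 0 0 = M 1 1 / M.det := by
  simp [Matrix.inv_def, Matrix.adjugate_fin_two, div_eq_inv_mul]

theorem inv_zero_one (M : Matrix (Fin 2) (Fin 2) ℝ) : M⁻¹ 0 1 = -M 0 1 / M.det := by
  simp [Matrix.inv_def, Matrix.adjugate_fin_two, div_eq_inv_mul]

theorem inv_one_zero (M : Matrix (Fin 2) (Fin 2) ℝ) : M⁻¹ 1 0 = -M 1 0 / M.det := by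
  simp [Matrix.inv_def, Matrix.adjugate_fin_two, div_eq_inv_mul]

theorem inv_one_one (M : Matrix (Fin 2) (Fin 2) ℝ) : M⁻¹ 1 1 = M 0 0 / M.det := by
  simp [Matrix.inv_def, Matrix.adjugate_fin_two, div_eq_inv_mul]

/-- The metrisability equations hold for `σ = f g` and the Levi-Civita connection of `g` if `f` is a
constant multiple of `|det g|^(-2/3)`. -/
theorem cyclic_leviCivita {g : Plane → Matrix (Fin 2) (Fin 2) ℝ} (hV : ∀ x ∈ V, (g x).IsSymm)
    {x : Plane} (hx : x ∈ V) (hg : ∀ a b, DifferentiableAt ℝ (fun y => g y a b) x)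
    (hD : (g x).det ≠ 0) {f : Plane → ℝ} (hf : DifferentiableAt ℝ f x)
    (hfD : ∀ a, pd a f x * (g x).det = -(2 / 3) * f x * pd a (fun y => (g y).det) x)
    (a b c : Fin 2) :
    nablaTwoTensor (thomas (leviCivita g)) (fun y a b => f y * g y a b) x a b c
      + nablaTwoTensor (thomas (leviCivita g)) (fun y a b => f y * g y a b) x b c a
      + nablaTwoTensor (thomas (leviCivita g)) (fun y a b => f y * g y a b) x c a b = 0 := by
  have hs (y : Plane) (hy : y ∈ V) : g y 1 0 = g y 0 1 := (hV y hy).apply 0 1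
  have hs' : ∀ a, pd a (fun y => g y 1 0) x = pd a (fun y => g y 0 1) x :=
    pd_congr_of_eqOn V.isOpen hs hx
  have hdet (a : Fin 2) : pd a (fun y => (g y).det) x = pd a (fun y => g y 0 0) x * g x 1 1
      + g x 0 0 * pd a (fun y => g y 1 1) x - 2 * g x 0 1 * pd a (fun y => g y 0 1) x := by
    simp only [det_eq]
    rw [pd_sub ((hg 0 0).fun_mul (hg 1 1)) ((hg 0 1).fun_mul (hg 1 0)), pd_mul (hg 0 0) (hg 1 1),
      pd_mul (hg 0 1) (hg 1 0), hs', hs x hx]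
    ring
  have hσ (a b c : Fin 2) : pd a (fun y => f y * g y b c) x
      = f x * pd a (fun y => g y b c) x + pd a f x * g x b c := pd_mul hf (hg b c) a
  have hf0 : pd 0 f x = -(2 / 3) * f x * pd 0 (fun y => (g y).det) x / (g x).det := by
    rw [eq_div_iff hD, hfD]
  have hf1 : pd 1 f x = -(2 / 3) * f x * pd 1 (fun y => (g y).det) x / (g x).det := by
    rw [eq_div_iff hD, hfD]
  simp only [nablaTwoTensor, hσ, Fin.sum_univ_two]
  have hD' : (g x).det = g x 0 0 * g x 1 1 - g x 0 1 * g x 0 1 := by rw [det_eq, hs x hx]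
  fin_cases a <;> fin_cases b <;> fin_cases c <;>
  · simp [thomas, leviCivita, Fin.sum_univ_two, inv_zero_zero, inv_zero_one, inv_one_zero,
      inv_one_one, hs', hs x hx, hf0, hf1, hdet]
    field_simp
    rw [hD']
    ring

end LeviCivita

/-! ### Metrics correspond to nondegenerate solutions. -/

section Metrisable

variable {n : ℕ∞} {V : Opens Plane} {Γ : Christoffel}

/-- The determinant of a symmetric two-tensor. -/
def detTwo (σ : Plane → Fin 2 → Fin 2 → ℝ) (x : Plane) : ℝ :=
  σ x 0 0 * σ x 1 1 - σ x 0 1 * σ x 0 1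

theorem nablaTwoTensor_congr (Γ : Christoffel) {S T : Plane → Fin 2 → Fin 2 → ℝ}
    (h : ∀ y ∈ V, ∀ a b, S y a b = T y a b) {x : Plane} (hx : x ∈ V) (a b c : Fin 2) :
    nablaTwoTensor Γ S x a b c = nablaTwoTensor Γ T x a b c := by
  simp only [nablaTwoTensor, h x hx]
  rw [pd_congr_of_eqOn V.isOpen (fun y hy => h y hy b c) hx]

theorem nablaTwoTensor_congr_left {Γ Γ' : Christoffel} {x : Plane}
    (h : ∀ c a b, Γ x c a b = Γ' x c a b) (S : Plane → Fin 2 → Fin 2 → ℝ) (a b c : Fin 2) :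
    nablaTwoTensor Γ S x a b c = nablaTwoTensor Γ' S x a b c := by
  simp only [nablaTwoTensor, h]

theorem isTorsionFreeConnection_leviCivita {g : Plane → Matrix (Fin 2) (Fin 2) ℝ}
    (hg : IsMetric n V g) : IsTorsionFreeConnection n V (leviCivita g) := by
  have hle : (n : WithTop ℕ∞) ≤ ((n + 1 : ℕ∞) : WithTop ℕ∞) := by
    exact_mod_cast le_self_add
  have hC (a b : Fin 2) : ContDiffOn ℝ n (fun x => g x a b) V := (hg.contDiffOn a b).of_le hle
  have hP (a b c : Fin 2) : ContDiffOn ℝ n (fun x => pd a (fun y => g y b c) x) V :=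
    contDiffOn_pd V.isOpen (hg.contDiffOn b c) (by push_cast; rfl) a
  have hdet : ContDiffOn ℝ n (fun x => (g x).det) V := by
    simp only [det_eq]
    exact ((hC 0 0).mul (hC 1 1)).sub ((hC 0 1).mul (hC 1 0))
  have hinv (c d : Fin 2) : ContDiffOn ℝ n (fun x => (g x)⁻¹ c d) V := by
    fin_cases c <;> fin_cases d <;>
    simp only [Fin.zero_eta, Fin.mk_one, Fin.isValue, inv_zero_zero, inv_zero_one, inv_one_zero,
      inv_one_one]
    · exact (hC 1 1).div hdet hg.nondegenerate
    · exact (hC 0 1).neg.div hdet hg.nondegenerate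
    · exact (hC 1 0).neg.div hdet hg.nondegenerate
    · exact (hC 0 0).div hdet hg.nondegenerate
  refine ⟨fun c a b => ?_, fun x hx c a b => ?_⟩
  · unfold leviCivita
    exact contDiffOn_const.mul (ContDiffOn.sum fun d _ =>
      (hinv c d).mul (((hP a d b).add (hP b d a)).sub (hP d a b)))
  · have hs (d : Fin 2) : pd d (fun y => g y a b) x = pd d (fun y => g y b a) x :=
      pd_congr_of_eqOn V.isOpen (fun y hy => (hg.symm y hy).apply b a) hx d
    simp only [leviCivita, hs]
    simp only [add_comm]

theorem exists_solution_of_isMetrisable (hn : 1 ≤ n) (hΓ : IsTorsionFreeConnection n V Γ)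
    (h : IsMetrisable n V Γ) :
    ∃ σ, IsMetrisabilitySolution n V Γ σ ∧ ∀ x ∈ V, detTwo σ x ≠ 0 := by
  obtain ⟨g, hg, hgΓ⟩ := h
  have hdet : ContDiffOn ℝ ((n + 1 : ℕ∞) : WithTop ℕ∞) (fun x => (g x).det) V := by
    simp only [det_eq]
    exact ((hg.contDiffOn 0 0).mul (hg.contDiffOn 1 1)).sub
      ((hg.contDiffOn 0 1).mul (hg.contDiffOn 1 0))
  have hn1 : ((n + 1 : ℕ∞) : WithTop ℕ∞) ≠ 0 := by simp
  -- This is `|det g|^(-2/3)`; squaring first covers indefinite metrics, whose determinant is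
  -- negative.
  set f : Plane → ℝ := fun x => ((g x).det ^ 2) ^ (-(1 / 3) : ℝ) with hf
  have hfC : ContDiffOn ℝ ((n + 1 : ℕ∞) : WithTop ℕ∞) f V :=
    (hdet.pow 2).rpow_const_of_ne fun x hx => pow_ne_zero 2 (hg.nondegenerate x hx)
  have hpos (x) (hx : x ∈ V) : 0 < (g x).det ^ 2 :=
    lt_of_le_of_ne (sq_nonneg _) (pow_ne_zero 2 (hg.nondegenerate x hx)).symm
  have hfD (x) (hx : x ∈ V) (a : Fin 2) :
      pd a f x * (g x).det = -(2 / 3) * f x * pd a (fun y => (g y).det) x := by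
    have hd := (hdet.differentiableAt_of_isOpen V.isOpen hn1 hx).hasFDerivAt
    have h1 := (hd.pow 2).rpow_const (p := (-(1 / 3) : ℝ)) (Or.inl (hpos x hx).ne')
    have h2 : pd a f x = _ := congrArg (fun L => L (Pi.single a 1)) h1.fderiv
    have h3 := hg.nondegenerate x hx
    rw [h2]
    have h4 : ((g x).det ^ 2) ^ (-(1 / 3) - 1 : ℝ) = f x / (g x).det ^ 2 := by
      rw [Real.rpow_sub (hpos x hx), Real.rpow_one]
    simp only [smul_apply, smul_eq_mul, h4, pd]
    field_simp
    simp only [nsmul_eq_mul, Nat.cast_ofNat, Nat.add_one_sub_one, pow_one]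
    ring
  refine ⟨fun x a b => f x * g x a b, ⟨fun a b => hfC.mul (hg.contDiffOn a b),
    fun x hx a b => ?_, fun x hx a b c => ?_⟩, fun x hx => ?_⟩
  · rw [(hg.symm x hx).apply a b]
  · have ht := thomas_eq_of_mem_projectiveStructure hn hΓ hgΓ hx
    simp only [← nablaTwoTensor_congr_left ht]
    exact cyclic_leviCivita hg.symm hx
      (fun a b => (hg.contDiffOn a b).differentiableAt_of_isOpen V.isOpen hn1 hx)
      (hg.nondegenerate x hx) (hfC.differentiableAt_of_isOpen V.isOpen hn1 hx) (hfD x hx) a b c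
  · have h1 : detTwo (fun x a b => f x * g x a b) x = f x ^ 2 * (g x).det := by
      rw [detTwo, det_eq, (hg.symm x hx).apply 0 1]
      ring
    rw [h1]
    exact mul_ne_zero (pow_ne_zero 2 (Real.rpow_pos_of_pos (hpos x hx) _).ne')
      (hg.nondegenerate x hx)

/-- For `g = σ / (det σ)²` one has `det g = (det σ)⁻³`, so the weighted metric `|det g|^(-2/3) g` is
`σ` again. Thus `σ` solves the equations for the Thomas symbols of `Γ` and for those of `g`.
Subtracting removes all derivatives of `σ`, and the algebraic system left over is that of
`eq_zero_of_cyclic`. -/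
theorem isMetrisable_of_solution (hΓ : IsTorsionFreeConnection n V Γ)
    {σ : Plane → Fin 2 → Fin 2 → ℝ} (hσ : IsMetrisabilitySolution n V Γ σ)
    (hd : ∀ x ∈ V, detTwo σ x ≠ 0) : IsMetrisable n V Γ := by
  have hn1 : ((n + 1 : ℕ∞) : WithTop ℕ∞) ≠ 0 := by simp
  have hdC : ContDiffOn ℝ ((n + 1 : ℕ∞) : WithTop ℕ∞) (detTwo σ) V :=
    ((hσ.contDiffOn 0 0).mul (hσ.contDiffOn 1 1)).sub
      ((hσ.contDiffOn 0 1).mul (hσ.contDiffOn 0 1))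
  set g : Plane → Matrix (Fin 2) (Fin 2) ℝ :=
    fun x => Matrix.of fun a b => σ x a b / detTwo σ x ^ 2 with hg
  have hdet (x) (hx : x ∈ V) : (g x).det = (detTwo σ x ^ 3)⁻¹ := by
    have h1 := hd x hx
    rw [det_eq]
    simp only [hg, Matrix.of_apply, hσ.symm x hx 1 0]
    field_simp
    rw [detTwo]
    ring
  have hgm : IsMetric n V g := by
    refine ⟨fun a b => (hσ.contDiffOn a b).div (hdC.pow 2) fun x hx => pow_ne_zero 2 (hd x hx),
      fun x hx => ?_, fun x hx => ?_⟩
    · ext a b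
      simp [hg, hσ.symm x hx a b]
    · rw [hdet x hx]
      exact inv_ne_zero (pow_ne_zero 3 (hd x hx))
  refine ⟨g, hgm, mem_projectiveStructure_of_thomas_eq (isTorsionFreeConnection_leviCivita hgm) ?_⟩
  intro x hx
  have hdd := hdC.differentiableAt_of_isOpen V.isOpen hn1 hx
  have hpow {k : ℕ} (a : Fin 2) : pd a (fun y => detTwo σ y ^ k) x
      = k * detTwo σ x ^ (k - 1) * pd a (detTwo σ) x := by
    have h2 : pd a (fun y => detTwo σ y ^ k) x = _ :=
      congrArg (fun L => L (Pi.single a 1)) (hdd.hasFDerivAt.pow k).fderiv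
    rw [h2]
    simp [pd]
  have hcyc := cyclic_leviCivita hgm.symm hx
      (fun a b => (hgm.contDiffOn a b).differentiableAt_of_isOpen V.isOpen hn1 hx)
      (hgm.nondegenerate x hx) (f := fun y => detTwo σ y ^ 2) (hdd.fun_pow 2) (fun a => by
        rw [pd_congr_of_eqOn V.isOpen hdet hx, hpow,
          pd_inv (hdd.fun_pow 3) (pow_ne_zero 3 (hd x hx)), hpow, hdet x hx]
        have := hd x hx
        field_simp
        norm_num
        ring)
  have hfg : ∀ y ∈ V, ∀ a b, detTwo σ y ^ 2 * g y a b = σ y a b := by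
    intro y hy a b
    have := hd y hy
    simp only [hg, Matrix.of_apply]
    field_simp
  simp only [nablaTwoTensor_congr _ hfg hx] at hcyc
  have hk := hσ.killing x hx
  have hLC := isTorsionFreeConnection_leviCivita hgm
  have sA := fun c => thomas_symm hΓ hx c 1 0
  have sB := fun c => thomas_symm hLC hx c 1 0
  have tA := thomas_trace Γ x
  have tB := thomas_trace (leviCivita g) x
  have tA0 := tA 0
  have tA1 := tA 1
  have tB0 := tB 0
  have tB1 := tB 1
  rw [sA] at tA0
  rw [sB] at tB0
  have hs := hσ.symm x hx 1 0
  have k0 := hk 0 0 0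
  have k1 := hk 0 0 1
  have k2 := hk 0 1 1
  have k3 := hk 1 1 1
  have c0 := hcyc 0 0 0
  have c1 := hcyc 0 0 1
  have c2 := hcyc 0 1 1
  have c3 := hcyc 1 1 1
  simp only [nablaTwoTensor, Fin.sum_univ_two, sA, sB, hs] at k0 k1 k2 k3 c0 c1 c2 c3
  obtain ⟨hp, hq, hr, hs'⟩ := eq_zero_of_cyclic
    (E := σ x 0 0) (F := σ x 0 1) (G := σ x 1 1)
    (p := thomas Γ x 0 0 0 - thomas (leviCivita g) x 0 0 0)
    (q := thomas Γ x 1 1 1 - thomas (leviCivita g) x 1 1 1)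
    (r := thomas Γ x 0 1 1 - thomas (leviCivita g) x 0 1 1)
    (s := thomas Γ x 1 0 0 - thomas (leviCivita g) x 1 0 0)
    (hd x hx) (by linear_combination (c0 - k0) / 6)
    (by linear_combination (c1 - k1) / 2 - 2 * σ x 0 0 * (tA1 - tB1) - 2 * σ x 0 1 * (tA0 - tB0))
    (by linear_combination (c2 - k2) / 2 - 2 * σ x 1 1 * (tA0 - tB0) - 2 * σ x 0 1 * (tA1 - tB1))
    (by linear_combination (c3 - k3) / 6)
  intro c a b
  fin_cases c <;> fin_cases a <;> fin_cases b <;>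
  simp only [Fin.zero_eta, Fin.mk_one, Fin.isValue, sA, sB] <;> linarith

end Metrisable

/-! ### Estimates on two-jets for unique continuation. -/

section UniqueContinuation

/-- Near `x`, the two-jet of the `C²` function `f` is bounded by a multiple of `N`. -/
structure JetBound (V : Set Plane) (N : Plane → ℝ) (x : Plane) (f : Plane → ℝ) : Prop where
  contDiffOn : ContDiffOn ℝ 2 f V
  zero : f =O[𝓝 x] N
  one : ∀ a, pd a f =O[𝓝 x] N
  two : ∀ a b, pd a (pd b f) =O[𝓝 x] N

variable {V : Set Plane} {N : Plane → ℝ} {x : Plane} {f g : Plane → ℝ}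

theorem pd_pd_add (hV : IsOpen V) (hf : ContDiffOn ℝ 2 f V) (hg : ContDiffOn ℝ 2 g V) (hx : x ∈ V)
    (a b : Fin 2) :
    pd a (pd b fun y => f y + g y) x = pd a (pd b f) x + pd a (pd b g) x := by
  rw [pd_congr_of_eqOn hV (fun y hy => pd_add (hf.differentiableAt_of_isOpen hV two_ne_zero hy)
    (hg.differentiableAt_of_isOpen hV two_ne_zero hy) b) hx]
  have h (f : Plane → ℝ) (hf : ContDiffOn ℝ 2 f V) : DifferentiableAt ℝ (pd b f) x :=
    (contDiffOn_pd hV (m := 1) hf (by norm_num) b).differentiableAt_of_isOpen hV one_ne_zero hx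
  exact pd_add (h f hf) (h g hg) a

theorem pd_pd_mul (hV : IsOpen V) (hf : ContDiffOn ℝ 2 f V) (hg : ContDiffOn ℝ 2 g V) (hx : x ∈ V)
    (a b : Fin 2) :
    pd a (pd b fun y => f y * g y) x = f x * pd a (pd b g) x + pd a f x * pd b g x
      + (pd b f x * pd a g x + pd a (pd b f) x * g x) := by
  have d {f : Plane → ℝ} (hf : ContDiffOn ℝ 2 f V) {y} (hy : y ∈ V) : DifferentiableAt ℝ f y :=
    hf.differentiableAt_of_isOpen hV two_ne_zero hy
  have h {f : Plane → ℝ} (hf : ContDiffOn ℝ 2 f V) : DifferentiableAt ℝ (pd b f) x :=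
    (contDiffOn_pd hV (m := 1) hf (by norm_num) b).differentiableAt_of_isOpen hV one_ne_zero hx
  rw [pd_congr_of_eqOn hV (fun y hy => pd_mul (d hf hy) (d hg hy) b) hx,
    pd_add ((d hf hx).fun_mul (h hg)) ((h hf).fun_mul (d hg hx)), pd_mul (d hf hx) (h hg),
    pd_mul (h hf) (d hg hx)]

theorem JetBound.add (hV : IsOpen V) (hx : x ∈ V) (hf : JetBound V N x f) (hg : JetBound V N x g) :
    JetBound V N x fun y => f y + g y := by
  refine ⟨hf.contDiffOn.add hg.contDiffOn, hf.zero.add hg.zero, fun a => ?_, fun a b => ?_⟩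
  · refine ((hf.one a).add (hg.one a)).congr' ?_ .rfl
    filter_upwards [hV.mem_nhds hx] with y hy
    exact (pd_add (hf.contDiffOn.differentiableAt_of_isOpen hV two_ne_zero hy)
      (hg.contDiffOn.differentiableAt_of_isOpen hV two_ne_zero hy) a).symm
  · refine ((hf.two a b).add (hg.two a b)).congr' ?_ .rfl
    filter_upwards [hV.mem_nhds hx] with y hy
    exact (pd_pd_add hV hf.contDiffOn hg.contDiffOn hy a b).symm

/-- By Leibniz' rule every derivative of order at most two of the product is a sum of derivatives of
`g` with continuous, hence locally bounded, coefficients. -/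
theorem JetBound.mul (hV : IsOpen V) (hx : x ∈ V) (hf : ContDiffOn ℝ 2 f V)
    (hg : JetBound V N x g) : JetBound V N x fun y => f y * g y := by
  have bd {h : Plane → ℝ} (hh : ContDiffOn ℝ 0 h V) {k : Plane → ℝ} (hk : k =O[𝓝 x] N) :
      (fun y => h y * k y) =O[𝓝 x] N := by
    have h1 : h =O[𝓝 x] fun _ => (1 : ℝ) :=
      (hh.continuousOn.continuousAt (hV.mem_nhds hx)).isBigO_one ℝ
    simpa using h1.mul hk
  have c0 := hf.of_le (show (0 : WithTop ℕ∞) ≤ 2 by norm_num)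
  have c1 (a) : ContDiffOn ℝ 1 (pd a f) V := contDiffOn_pd hV hf (by norm_num) a
  have c1' (a) := (c1 a).of_le (show (0 : WithTop ℕ∞) ≤ 1 by norm_num)
  have c2 (a b) : ContDiffOn ℝ 0 (pd a (pd b f)) V := contDiffOn_pd hV (c1 b) (by norm_num) a
  refine ⟨hf.mul hg.contDiffOn, bd c0 hg.zero, fun a => ?_, fun a b => ?_⟩
  · refine ((bd c0 (hg.one a)).add (bd (c1' a) hg.zero)).congr' ?_ .rfl
    filter_upwards [hV.mem_nhds hx] with y hy
    exact (pd_mul (hf.differentiableAt_of_isOpen hV two_ne_zero hy)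
      (hg.contDiffOn.differentiableAt_of_isOpen hV two_ne_zero hy) a).symm
  · refine (((bd c0 (hg.two a b)).add (bd (c1' a) (hg.one b))).add
      ((bd (c1' b) (hg.one a)).add (bd (c2 a b) hg.zero))).congr' ?_ .rfl
    filter_upwards [hV.mem_nhds hx] with y hy
    exact (pd_pd_mul hV hf hg.contDiffOn hy a b).symm

/-- A tensor in `S³ ⊗ S²` is determined by its symmetrisation over the last three indices. -/
theorem eq_of_symmetrisation {t : Fin 2 → Fin 2 → Fin 2 → Fin 2 → Fin 2 → ℝ}
    (h₁ : ∀ a b c d e, t a b c d e = t b a c d e) (h₂ : ∀ a b c d e, t a b c d e = t a c b d e)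
    (h₃ : ∀ a b c d e, t a b c d e = t a b c e d)
    {k : Fin 2 → Fin 2 → Fin 2 → Fin 2 → Fin 2 → ℝ}
    (hk : ∀ a b c d e, k a b c d e = t a b c d e + t a b d e c + t a b e c d) (a b c d e : Fin 2) :
    t a b c d e = (1 / 3) * (k a b c d e + k b c a d e + k a c b d e + k d e a b c)
      - (1 / 6) * (k a d b c e + k b d a c e + k c d a b e
        + k a e b c d + k b e a c d + k c e a b d) := by
  have e1 : ∀ d e, t 1 0 0 d e = t 0 0 1 d e := fun d e => by rw [h₁, h₂]
  have e2 : ∀ d e, t 0 1 0 d e = t 0 0 1 d e := fun d e => by rw [h₂]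
  have e3 : ∀ d e, t 1 0 1 d e = t 0 1 1 d e := fun d e => by rw [h₁]
  have e4 : ∀ d e, t 1 1 0 d e = t 0 1 1 d e := fun d e => by rw [h₂, h₁]
  have e5 : ∀ a b c, t a b c 1 0 = t a b c 0 1 := fun a b c => by rw [h₃]
  fin_cases a <;> fin_cases b <;> fin_cases c <;> fin_cases d <;> fin_cases e <;>
  simp only [Fin.zero_eta, Fin.mk_one, Fin.isValue, hk, e1, e2, e3, e4, e5] <;> ring

end UniqueContinuation

/-! ### Unique continuation for the metrisability equations. -/

section Solutions

variable {n : ℕ∞} {V : Opens Plane} {Γ : Christoffel}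

/-- The components of the two-jet of a two-tensor field. -/
noncomputable def twoJet (σ : Plane → Fin 2 → Fin 2 → ℝ) :
    Fin 2 × Fin 2 × (Unit ⊕ Fin 2 ⊕ Fin 2 × Fin 2) → Plane → ℝ
  | (b, c, .inl _) => fun x => σ x b c
  | (b, c, .inr (.inl a)) => pd a fun x => σ x b c
  | (b, c, .inr (.inr (a, d))) => pd a (pd d fun x => σ x b c)

/-- The equations are of finite type: differentiated twice, they express all third derivatives of
`σ` through its two-jet. The two-jet therefore satisfies the estimate of `eq_zero_of_pd_isBigO`. -/
theorem IsMetrisabilitySolution.eq_zero_of_eventually (hn : 2 ≤ n)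
    (hΓ : IsTorsionFreeConnection n V Γ) {σ : Plane → Fin 2 → Fin 2 → ℝ}
    (hσ : IsMetrisabilitySolution n V Γ σ) (hV : IsPreconnected (V : Set Plane)) {x₀ : Plane}
    (hx₀ : x₀ ∈ V) (h₀ : ∀ᶠ y in 𝓝 x₀, σ y = 0) : ∀ x ∈ V, σ x = 0 := by
  have hO := V.isOpen
  have C3 (b c) : ContDiffOn ℝ 3 (fun x => σ x b c) V := by
    refine (hσ.contDiffOn b c).of_le ?_
    have : (3 : ℕ∞) ≤ n + 1 := le_trans (by norm_num) (add_le_add_left hn 1)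
    exact WithTop.coe_le_coe.2 this
  have C2 (a b c) : ContDiffOn ℝ 2 (pd a fun x => σ x b c) V :=
    contDiffOn_pd hO (C3 b c) (by norm_num) a
  have C1 (a d b c) : ContDiffOn ℝ 1 (pd a (pd d fun x => σ x b c)) V :=
    contDiffOn_pd hO (C2 d b c) (by norm_num) a
  have hT (c a b) : ContDiffOn ℝ 2 (fun x => thomas Γ x c a b) V :=
    (contDiffOn_thomas hΓ c a b).of_le (WithTop.coe_le_coe.2 hn)
  have hb : ∀ x ∈ (V : Set Plane), ∀ a i,
      pd a (twoJet σ i) =O[𝓝 x] fun y => ∑ j, |twoJet σ j y| := by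
    intro x hx
    set N : Plane → ℝ := fun y => ∑ j, |twoJet σ j y| with hN
    have base (j) : twoJet σ j =O[𝓝 x] N := by
      refine Asymptotics.isBigO_of_le _ fun y => ?_
      rw [Real.norm_eq_abs, Real.norm_of_nonneg (Finset.sum_nonneg fun _ _ => abs_nonneg _)]
      exact Finset.single_le_sum (f := fun j => |twoJet σ j y|) (fun _ _ => abs_nonneg _)
        (Finset.mem_univ j)
    have hJ (b c) : JetBound V N x fun y => σ y b c :=
      ⟨(C3 b c).of_le (by norm_num), base (b, c, .inl ()), fun a => base (b, c, .inr (.inl a)),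
        fun a d => base (b, c, .inr (.inr (a, d)))⟩
    have hterm (c a b d e) : JetBound V N x fun y => thomas Γ y c a b * σ y d e :=
      (hJ d e).mul hO hx (hT c a b)
    let R : Fin 2 → Fin 2 → Fin 2 → Plane → ℝ := fun a b c y =>
      (thomas Γ y 0 a b * σ y 0 c + thomas Γ y 0 a c * σ y b 0)
        + (thomas Γ y 1 a b * σ y 1 c + thomas Γ y 1 a c * σ y b 1)
    have hR (a b c) : JetBound V N x (R a b c) :=
      ((hterm _ _ _ _ _).add hO hx (hterm _ _ _ _ _)).add hO hx
        ((hterm _ _ _ _ _).add hO hx (hterm _ _ _ _ _))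
    -- `t` collects the third derivatives of `σ`, and `k` the second derivatives of the zeroth-order
    -- part of the equations. The equations say that `k` is the cyclic sum of `t` over its last
    -- three indices, from which `eq_of_symmetrisation` recovers `t`.
    let t : Plane → Fin 2 → Fin 2 → Fin 2 → Fin 2 → Fin 2 → ℝ := fun y a b c d e =>
      pd a (pd b (pd c fun y => σ y d e)) y
    let k : Fin 2 → Fin 2 → Fin 2 → Fin 2 → Fin 2 → Plane → ℝ := fun a b c d e y =>
      pd a (pd b fun y => R c d e y + R d e c y + R e c d y) y
    have hkO (a b c d e) : k a b c d e =O[𝓝 x] N :=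
      (((hR c d e).add hO hx (hR d e c)).add hO hx (hR e c d)).two a b
    have hk (y) (hy : y ∈ V) (a b c d e) :
        k a b c d e y = t y a b c d e + t y a b d e c + t y a b e c d := by
      have h1 : Set.EqOn (fun y => R c d e y + R d e c y + R e c d y)
          (fun y => pd c (fun y => σ y d e) y + pd d (fun y => σ y e c) y
            + pd e (fun y => σ y c d) y) V := by
        intro z hz
        have := hσ.killing z hz c d e
        simp only [nablaTwoTensor, Fin.sum_univ_two] at this
        simp only [R]
        linarith
      have h2 : pd a (pd b fun y => R c d e y + R d e c y + R e c d y) y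
          = pd a (pd b fun y => pd c (fun y => σ y d e) y + pd d (fun y => σ y e c) y
            + pd e (fun y => σ y c d) y) y :=
        pd_congr_of_eqOn hO (fun z hz => pd_congr_of_eqOn hO h1 hz b) hy a
      simp only [k, t]
      rw [h2, pd_pd_add hO ((C2 c d e).add (C2 d e c)) (C2 e c d) hy,
        pd_pd_add hO (C2 c d e) (C2 d e c) hy]
    have ht (y) (hy : y ∈ V) (a b c d e) := eq_of_symmetrisation (t := t y)
      (fun a b c d e => pd_comm ((C2 c d e).contDiffAt (hO.mem_nhds hy)) a b)
      (fun a b c d e => pd_congr_of_eqOn hO (fun z hz => pd_comm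
        (((C3 d e).contDiffAt (hO.mem_nhds hz)).of_le (by norm_num)) b c) hy a)
      (fun a b c d e => pd_congr_of_eqOn hO (fun z hz => pd_congr_of_eqOn hO
        (fun w hw => pd_congr_of_eqOn hO (fun v hv => hσ.symm v hv d e) hw c) hz b) hy a)
      (k := fun a b c d e => k a b c d e y) (hk y hy) a b c d e
    have htO (a b c d e) : (fun y => t y a b c d e) =O[𝓝 x] N := by
      have := (((((hkO a b c d e).add (hkO b c a d e)).add (hkO a c b d e)).add
        (hkO d e a b c)).const_mul_left (1 / 3)).sub
        (((((((hkO a d b c e).add (hkO b d a c e)).add (hkO c d a b e)).add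
          (hkO a e b c d)).add (hkO b e a c d)).add (hkO c e a b d)).const_mul_left (1 / 6))
      refine this.congr' ?_ .rfl
      filter_upwards [hO.mem_nhds hx] with y hy
      exact (ht y hy a b c d e).symm
    rintro a ⟨b, c, _ | d | ⟨d, e⟩⟩
    · exact base (b, c, .inr (.inl a))
    · exact base (b, c, .inr (.inr (a, d)))
    · exact htO a d e b c
  have hd : ∀ i, ∀ x ∈ (V : Set Plane), DifferentiableAt ℝ (twoJet σ i) x := by
    rintro ⟨b, c, _ | d | ⟨d, e⟩⟩ x hx
    · exact (C3 b c).differentiableAt_of_isOpen hO three_ne_zero hx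
    · exact (C2 d b c).differentiableAt_of_isOpen hO two_ne_zero hx
    · exact (C1 d e b c).differentiableAt_of_isOpen hO one_ne_zero hx
  have hz : ∀ b c, (fun y => σ y b c) =ᶠ[𝓝 x₀] fun _ => 0 := fun b c => by
    filter_upwards [h₀] with y hy
    rw [hy]
    rfl
  have hz1 : ∀ a b c, pd a (fun y => σ y b c) =ᶠ[𝓝 x₀] fun _ => 0 := fun a b c => by
    filter_upwards [(hz b c).eventually_nhds] with y hy
    rw [pd_congr hy, pd_const]
  have h0 : ∀ i, twoJet σ i x₀ = 0 := by
    rintro ⟨b, c, _ | d | ⟨d, e⟩⟩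
    · exact (hz b c).self_of_nhds
    · exact (hz1 d b c).self_of_nhds
    · simp only [twoJet]
      rw [pd_congr (hz1 e b c), pd_const]
  have := eq_zero_of_pd_isBigO hO hV hd hb hx₀ h0
  intro x hx
  ext b c
  exact this x hx (b, c, .inl ())

end Solutions

/-! ### Curvature of the Thomas symbols in components. -/

section Components

variable {n : ℕ∞} {V : Opens Plane} {Γ : Christoffel} {x : Plane}

/-- Being symmetric and trace-free, the Thomas symbols have four independent components. This lemma
and its companions rewrite everything in terms of `Π⁰₀₀`, `Π¹₁₁`, `Π⁰₁₁` and `Π¹₀₀`. -/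
theorem thomas_one_one_zero (Γ : Christoffel) (x : Plane) :
    thomas Γ x 1 1 0 = -thomas Γ x 0 0 0 := by
  linarith [thomas_trace Γ x 0]

theorem thomas_zero_zero_one (Γ : Christoffel) (x : Plane) :
    thomas Γ x 0 0 1 = -thomas Γ x 1 1 1 := by
  linarith [thomas_trace Γ x 1]

theorem thomas_one_zero_one (hΓ : IsTorsionFreeConnection n V Γ) (hx : x ∈ V) :
    thomas Γ x 1 0 1 = -thomas Γ x 0 0 0 := by
  rw [thomas_symm hΓ hx, thomas_one_one_zero]

theorem thomas_zero_one_zero (hΓ : IsTorsionFreeConnection n V Γ) (hx : x ∈ V) :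
    thomas Γ x 0 1 0 = -thomas Γ x 1 1 1 := by
  rw [thomas_symm hΓ hx, thomas_zero_zero_one]

theorem ricci_thomas (hΓ : IsTorsionFreeConnection n V Γ) (hx : x ∈ V) :
    ricci (thomas Γ) x 0 0 = pd 0 (fun y => thomas Γ y 0 0 0) x + pd 1 (fun y => thomas Γ y 1 0 0) x
        - 2 * thomas Γ x 0 0 0 ^ 2 + 2 * thomas Γ x 1 1 1 * thomas Γ x 1 0 0 ∧
    ricci (thomas Γ) x 0 1 = -pd 0 (fun y => thomas Γ y 1 1 1) x - pd 1 (fun y => thomas Γ y 0 0 0) x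
        + thomas Γ x 0 0 0 * thomas Γ x 1 1 1 - thomas Γ x 0 1 1 * thomas Γ x 1 0 0 ∧
    ricci (thomas Γ) x 1 0 = ricci (thomas Γ) x 0 1 ∧
    ricci (thomas Γ) x 1 1 = pd 0 (fun y => thomas Γ y 0 1 1) x + pd 1 (fun y => thomas Γ y 1 1 1) x
        - 2 * thomas Γ x 1 1 1 ^ 2 + 2 * thomas Γ x 0 0 0 * thomas Γ x 0 1 1 := by
  have h1 (a) : pd a (fun y => thomas Γ y 1 0 1) x = -pd a (fun y => thomas Γ y 0 0 0) x := by
    rw [pd_congr_of_eqOn V.isOpen (fun y hy => thomas_one_zero_one hΓ hy) hx, pd_neg]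
  have h2 (a) : pd a (fun y => thomas Γ y 0 1 0) x = -pd a (fun y => thomas Γ y 1 1 1) x := by
    rw [pd_congr_of_eqOn V.isOpen (fun y hy => thomas_zero_one_zero hΓ hy) hx, pd_neg]
  simp only [ricci, Fin.sum_univ_two, thomas_one_one_zero, thomas_zero_zero_one, pd_neg, h1, h2,
    thomas_one_zero_one hΓ hx, thomas_zero_one_zero hΓ hx]
  refine ⟨?_, ?_, ?_, ?_⟩ <;> ring

/-- The connection preserves a volume form, so its Ricci tensor is symmetric and the two weights in
the definition add up to one. -/
theorem schouten_thomas (hΓ : IsTorsionFreeConnection n V Γ) (hx : x ∈ V) (a b : Fin 2) :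
    schouten (thomas Γ) x a b = ricci (thomas Γ) x a b := by
  obtain ⟨-, -, h, -⟩ := ricci_thomas hΓ hx
  fin_cases a <;> fin_cases b <;> simp [schouten, h] <;> ring

theorem schouten_thomas_symm (hΓ : IsTorsionFreeConnection n V Γ) (hx : x ∈ V) :
    schouten (thomas Γ) x 1 0 = schouten (thomas Γ) x 0 1 := by
  rw [schouten_thomas hΓ hx, schouten_thomas hΓ hx]
  exact (ricci_thomas hΓ hx).2.2.1

theorem schouten_thomas_zero_zero (hΓ : IsTorsionFreeConnection n V Γ) (hx : x ∈ V) :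
    schouten (thomas Γ) x 0 0
      = pd 0 (fun y => thomas Γ y 0 0 0) x + pd 1 (fun y => thomas Γ y 1 0 0) x
        - 2 * thomas Γ x 0 0 0 ^ 2 + 2 * thomas Γ x 1 1 1 * thomas Γ x 1 0 0 := by
  rw [schouten_thomas hΓ hx, (ricci_thomas hΓ hx).1]

theorem schouten_thomas_zero_one (hΓ : IsTorsionFreeConnection n V Γ) (hx : x ∈ V) :
    schouten (thomas Γ) x 0 1
      = -pd 0 (fun y => thomas Γ y 1 1 1) x - pd 1 (fun y => thomas Γ y 0 0 0) x
        + thomas Γ x 0 0 0 * thomas Γ x 1 1 1 - thomas Γ x 0 1 1 * thomas Γ x 1 0 0 := by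
  rw [schouten_thomas hΓ hx, (ricci_thomas hΓ hx).2.1]

theorem schouten_thomas_one_one (hΓ : IsTorsionFreeConnection n V Γ) (hx : x ∈ V) :
    schouten (thomas Γ) x 1 1
      = pd 0 (fun y => thomas Γ y 0 1 1) x + pd 1 (fun y => thomas Γ y 1 1 1) x
        - 2 * thomas Γ x 1 1 1 ^ 2 + 2 * thomas Γ x 0 0 0 * thomas Γ x 0 1 1 := by
  rw [schouten_thomas hΓ hx, (ricci_thomas hΓ hx).2.2.2]

theorem cotton_thomas_zero (hΓ : IsTorsionFreeConnection n V Γ) (hx : x ∈ V) :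
    cotton (thomas Γ) x 0 = pd 0 (fun y => schouten (thomas Γ) y 0 1) x
      - pd 1 (fun y => schouten (thomas Γ) y 0 0) x
      - (2 * thomas Γ x 0 0 0 * schouten (thomas Γ) x 0 1
        + thomas Γ x 1 0 0 * schouten (thomas Γ) x 1 1
        + thomas Γ x 1 1 1 * schouten (thomas Γ) x 0 0) := by
  simp only [cotton, nablaTwoTensor, Fin.sum_univ_two, thomas_one_one_zero, thomas_zero_zero_one,
    thomas_one_zero_one hΓ hx, thomas_zero_one_zero hΓ hx, schouten_thomas_symm hΓ hx,
    pd_congr_of_eqOn V.isOpen (fun y hy => schouten_thomas_symm hΓ hy) hx]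
  simp [eps]
  ring

theorem cotton_thomas_one (hΓ : IsTorsionFreeConnection n V Γ) (hx : x ∈ V) :
    cotton (thomas Γ) x 1 = pd 0 (fun y => schouten (thomas Γ) y 1 1) x
      - pd 1 (fun y => schouten (thomas Γ) y 0 1) x
      + 2 * thomas Γ x 1 1 1 * schouten (thomas Γ) x 0 1
        + thomas Γ x 0 0 0 * schouten (thomas Γ) x 1 1
        + thomas Γ x 0 1 1 * schouten (thomas Γ) x 0 0 := by
  simp only [cotton, nablaTwoTensor, Fin.sum_univ_two, thomas_one_one_zero, thomas_zero_zero_one,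
    thomas_one_zero_one hΓ hx, thomas_zero_one_zero hΓ hx, schouten_thomas_symm hΓ hx]
  simp [eps]
  ring

theorem contDiffOn_schouten (hΓ : IsTorsionFreeConnection n V Γ) {m : ℕ∞} (hm : m + 1 ≤ n)
    (a b : Fin 2) : ContDiffOn ℝ m (fun x => schouten (thomas Γ) x a b) V := by
  have hm' : (m : WithTop ℕ∞) + 1 ≤ n := WithTop.coe_le_coe.2 hm
  have hT (c a b) : ContDiffOn ℝ m (fun x => thomas Γ x c a b) V :=
    (contDiffOn_thomas hΓ c a b).of_le (le_self_add.trans hm')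
  have hP (d c a b) : ContDiffOn ℝ m (pd d fun x => thomas Γ x c a b) V :=
    contDiffOn_pd V.isOpen (contDiffOn_thomas hΓ c a b) hm' d
  have hR (a b) : ContDiffOn ℝ m (fun x => ricci (thomas Γ) x a b) V := by
    unfold ricci
    exact ContDiffOn.sum fun d _ => ((hP _ _ _ _).sub (hP _ _ _ _)).add
      (ContDiffOn.sum fun e _ => ((hT _ _ _).mul (hT _ _ _)).sub ((hT _ _ _).mul (hT _ _ _)))
  exact (contDiffOn_const.mul (hR a b)).add (contDiffOn_const.mul (hR b a))

theorem contDiffOn_cotton (hΓ : IsTorsionFreeConnection n V Γ) {m : ℕ∞} (hm : m + 2 ≤ n)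
    (b : Fin 2) : ContDiffOn ℝ m (fun x => cotton (thomas Γ) x b) V := by
  have hm1 : (m + 1) + 1 ≤ n := by rwa [add_assoc]
  have hS := contDiffOn_schouten hΓ hm1
  have hle : (m : WithTop ℕ∞) ≤ ((m + 1 : ℕ∞) : WithTop ℕ∞) := WithTop.coe_le_coe.2 le_self_add
  have hT (c a b) : ContDiffOn ℝ m (fun x => thomas Γ x c a b) V :=
    (contDiffOn_thomas hΓ c a b).of_le (WithTop.coe_le_coe.2 (le_self_add.trans hm))
  have hP (d a b) : ContDiffOn ℝ m (pd d fun x => schouten (thomas Γ) x a b) V :=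
    contDiffOn_pd V.isOpen (hS a b) le_rfl d
  unfold cotton nablaTwoTensor
  exact ContDiffOn.sum fun c _ => ContDiffOn.sum fun d _ => contDiffOn_const.mul
    ((hP _ _ _).sub (ContDiffOn.sum fun e _ => ((hT _ _ _).mul ((hS _ _).of_le hle)).add
      ((hT _ _ _).mul ((hS _ _).of_le hle))))

theorem IsTorsionFreeConnection.mono {W : Opens Plane} (h : IsTorsionFreeConnection n V Γ)
    (hW : W ≤ V) : IsTorsionFreeConnection n W Γ :=
  ⟨fun c a b => (h.contDiffOn c a b).mono hW, fun x hx => h.symm x (hW hx)⟩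

end Components

/-! ### Killing forms: regularity and integrability condition. -/

section KillingForm

/-- The one-form `ω` of class `C²` satisfies the Killing equation `∇_(a ω_b) = 0` on `V` for the
connection given by the Thomas symbols. -/
structure IsKillingForm (V : Opens Plane) (Γ : Christoffel) (ω : Plane → Fin 2 → ℝ) : Prop where
  contDiffOn : ∀ a, ContDiffOn ℝ 2 (fun x => ω x a) (V : Set Plane)
  killing : ∀ x ∈ V, ∀ a b,
    nablaCovector (thomas Γ) ω x a b + nablaCovector (thomas Γ) ω x b a = 0

variable {n : ℕ∞} {V : Opens Plane} {Γ : Christoffel} {ω : Plane → Fin 2 → ℝ}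

theorem IsKillingForm.pd_add_pd (hΓ : IsTorsionFreeConnection n V Γ) (h : IsKillingForm V Γ ω)
    {x : Plane} (hx : x ∈ V) (a b : Fin 2) :
    pd a (fun y => ω y b) x + pd b (fun y => ω y a) x = 2 * ∑ d, thomas Γ x d a b * ω x d := by
  have := h.killing x hx a b
  simp only [nablaCovector, thomas_symm hΓ hx _ b a] at this
  linarith

/-- Bootstrapping: all second derivatives of `ω` are first derivatives of the products `Γ ω`, so
each round gains one derivative until the class of the connection is reached. -/
theorem IsKillingForm.contDiffOn_nat (hΓ : IsTorsionFreeConnection n V Γ)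
    (h : IsKillingForm V Γ ω) (k : ℕ) (hk : ((k + 1 : ℕ) : ℕ∞) ≤ n) (c : Fin 2) :
    ContDiffOn ℝ ((k + 2 : ℕ) : WithTop ℕ∞) (fun x => ω x c) V := by
  have hO := V.isOpen
  induction k generalizing c with
  | zero => exact h.contDiffOn c
  | succ k ih =>
    have ih' := fun c => ih ((Nat.cast_le.2 (by omega)).trans hk) c
    let A : Fin 2 → Fin 2 → Plane → ℝ := fun a b x => ∑ d, thomas Γ x d a b * ω x d
    have hA (a b) : ContDiffOn ℝ ((k + 2 : ℕ) : WithTop ℕ∞) (A a b) V :=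
      ContDiffOn.sum fun d _ => ((contDiffOn_thomas hΓ d a b).of_le
        (WithTop.coe_le_coe.2 hk)).mul (ih' d)
    have hpA (c a b) : ContDiffOn ℝ ((k + 1 : ℕ) : WithTop ℕ∞) (pd c (A a b)) V :=
      contDiffOn_pd hO (hA a b) (by norm_cast) c
    have hAd (a b) {x} (hx : x ∈ V) : DifferentiableAt ℝ (A a b) x :=
      (hA a b).differentiableAt_of_isOpen hO (by norm_cast) hx
    have hdd (b c) {x} (hx : x ∈ V) : DifferentiableAt ℝ (pd b fun x => ω x c) x :=
      (contDiffOn_pd hO (m := 1) (h.contDiffOn c) (by norm_num) b).differentiableAt_of_isOpen hO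
        one_ne_zero hx
    -- As in Koszul's formula: a tensor symmetric in its first two indices is determined by its
    -- symmetrisation over the last two.
    have key (a b c) : ∀ x ∈ (V : Set Plane), pd a (pd b fun x => ω x c) x
        = pd a (A b c) x + pd b (A a c) x - pd c (A a b) x := by
      intro x hx
      have e (a b c) : pd a (pd b fun x => ω x c) x + pd a (pd c fun x => ω x b) x
          = 2 * pd a (A b c) x := by
        rw [← pd_add (hdd b c hx) (hdd c b hx), ← pd_const_mul 2 (hAd b c hx)]
        exact pd_congr_of_eqOn hO (fun y hy => h.pd_add_pd hΓ hy b c) hx a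
      have s (a b c) := pd_comm ((h.contDiffOn c).contDiffAt (hO.mem_nhds hx)) a b
      linarith [e a b c, e b a c, e c a b, s a b c, s a c b, s b c a]
    have h1 (b c) : ContDiffOn ℝ ((k + 2 : ℕ) : WithTop ℕ∞) (pd b fun x => ω x c) V :=
      contDiffOn_succ_of_pd hO (fun x hx => hdd b c hx) fun a =>
        (((hpA a b c).add (hpA b a c)).sub (hpA c a b)).congr (key a b c)
    exact contDiffOn_succ_of_pd hO (fun x hx =>
      (h.contDiffOn c).differentiableAt_of_isOpen hO two_ne_zero hx) fun a => h1 a c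

/-- Killing forms obtained from linear systems are only known to be `C²`, while their squares must
be of class `C^(n+1)` to count as solutions. -/
theorem IsKillingForm.contDiffOn_succ (hn : 1 ≤ n) (hΓ : IsTorsionFreeConnection n V Γ)
    (h : IsKillingForm V Γ ω) (c : Fin 2) :
    ContDiffOn ℝ ((n + 1 : ℕ∞) : WithTop ℕ∞) (fun x => ω x c) V := by
  cases n with
  | top =>
    refine contDiffOn_infty.2 fun m => ?_
    exact (h.contDiffOn_nat hΓ m le_top c).of_le (by exact_mod_cast Nat.le_add_right m 2)
  | coe n =>
    obtain ⟨k, rfl⟩ : ∃ k, n = k + 1 := ⟨n - 1, by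
      have : 1 ≤ n := by exact_mod_cast hn
      omega⟩
    exact h.contDiffOn_nat hΓ k le_rfl c

/-- The square of a Killing form solves the metrisability equations. -/
theorem IsKillingForm.isMetrisabilitySolution (hn : 1 ≤ n) (hΓ : IsTorsionFreeConnection n V Γ)
    (h : IsKillingForm V Γ ω) : IsMetrisabilitySolution n V Γ fun x a b => ω x a * ω x b := by
  have hC := h.contDiffOn_succ hn hΓ
  refine ⟨fun a b => (hC a).mul (hC b), fun x _ a b => mul_comm _ _, fun x hx a b c => ?_⟩
  have hd (a) : DifferentiableAt ℝ (fun x => ω x a) x :=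
    (h.contDiffOn a).differentiableAt_of_isOpen V.isOpen two_ne_zero hx
  have e1 := h.pd_add_pd hΓ hx a b
  have e2 := h.pd_add_pd hΓ hx b c
  have e3 := h.pd_add_pd hΓ hx c a
  simp only [nablaTwoTensor, pd_mul (hd _) (hd _), Fin.sum_univ_two, thomas_symm hΓ hx _ b a,
    thomas_symm hΓ hx _ c b, thomas_symm hΓ hx _ c a] at e1 e2 e3 ⊢
  linear_combination ω x c * e1 + ω x a * e2 + ω x b * e3

/-- A Killing form is annihilated by `L^a`. -/
theorem IsKillingForm.cotton_mul_eq (hn : 2 ≤ n) (hΓ : IsTorsionFreeConnection n V Γ)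
    (h : IsKillingForm V Γ ω) {x : Plane} (hx : x ∈ V) :
    cotton (thomas Γ) x 1 * ω x 0 = cotton (thomas Γ) x 0 * ω x 1 := by
  have hO := V.isOpen
  have hn1 : (1 : ℕ∞) ≤ n := le_trans (by norm_num) hn
  have C3 (c) : ContDiffOn ℝ 3 (fun x => ω x c) V := by
    have : (3 : ℕ∞) ≤ n + 1 := le_trans (by norm_num) (add_le_add_left hn 1)
    exact (h.contDiffOn_succ hn1 hΓ c).of_le (WithTop.coe_le_coe.2 this)
  have hT (c a b) : ContDiffOn ℝ 2 (fun x => thomas Γ x c a b) V :=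
    (contDiffOn_thomas hΓ c a b).of_le (WithTop.coe_le_coe.2 hn)
  have dT (c a b) {y} (hy : y ∈ V) : DifferentiableAt ℝ (fun x => thomas Γ x c a b) y :=
    (hT c a b).differentiableAt_of_isOpen hO two_ne_zero hy
  have dω (c) {y} (hy : y ∈ V) : DifferentiableAt ℝ (fun x => ω x c) y :=
    (C3 c).differentiableAt_of_isOpen hO three_ne_zero hy
  have dP (a b) {y} (hy : y ∈ V) : DifferentiableAt ℝ (fun x => schouten (thomas Γ) x a b) y :=
    (contDiffOn_schouten hΓ (m := 1) (by rwa [one_add_one_eq_two]) a b).differentiableAt_of_isOpen hO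
      one_ne_zero hy
  -- `μ = ∇₀ω₁ = -∇₁ω₀` is the skew part of `∇ω`, the one component that the Killing equation leaves
  -- free.
  set μ : Plane → ℝ := fun y => pd 0 (fun x => ω x 1) y + thomas Γ y 1 1 1 * ω y 0
    + thomas Γ y 0 0 0 * ω y 1 with hμ
  have hμC : ContDiffOn ℝ 2 μ V :=
    ((contDiffOn_pd hO (C3 1) (by norm_num) 0).add ((hT 1 1 1).mul
      ((C3 0).of_le (by norm_num)))).add ((hT 0 0 0).mul ((C3 1).of_le (by norm_num)))
  have dμ {y} (hy : y ∈ V) : DifferentiableAt ℝ μ y :=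
    hμC.differentiableAt_of_isOpen hO two_ne_zero hy
  have p00 : ∀ y ∈ V, pd 0 (fun x => ω x 0) y
      = thomas Γ y 0 0 0 * ω y 0 + thomas Γ y 1 0 0 * ω y 1 := by
    intro y hy
    have := h.pd_add_pd hΓ hy 0 0
    simp only [Fin.sum_univ_two] at this
    linarith
  have p11 : ∀ y ∈ V, pd 1 (fun x => ω x 1) y
      = thomas Γ y 0 1 1 * ω y 0 + thomas Γ y 1 1 1 * ω y 1 := by
    intro y hy
    have := h.pd_add_pd hΓ hy 1 1
    simp only [Fin.sum_univ_two] at this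
    linarith
  have p01 : ∀ y ∈ V, pd 0 (fun x => ω x 1) y
      = μ y - (thomas Γ y 1 1 1 * ω y 0 + thomas Γ y 0 0 0 * ω y 1) := by
    intro y hy
    simp only [hμ]
    ring
  have p10 : ∀ y ∈ V, pd 1 (fun x => ω x 0) y
      = -(μ y + (thomas Γ y 1 1 1 * ω y 0 + thomas Γ y 0 0 0 * ω y 1)) := by
    intro y hy
    have := h.pd_add_pd hΓ hy 0 1
    simp only [Fin.sum_univ_two, thomas_zero_zero_one, thomas_one_zero_one hΓ hy, p01 y hy] at this
    linarith
  have dm (c a b d) {y} (hy : y ∈ V) : DifferentiableAt ℝ (fun x => thomas Γ x c a b * ω x d) y :=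
    (dT c a b hy).fun_mul (dω d hy)
  have dmm (c a b d c' a' b' d') {y} (hy : y ∈ V) : DifferentiableAt ℝ
      (fun x => thomas Γ x c a b * ω x d + thomas Γ x c' a' b' * ω x d') y :=
    (dm c a b d hy).fun_add (dm c' a' b' d' hy)
  -- Equality of the mixed partials of `ω₀` and of `ω₁` determines `dμ` and closes the prolonged
  -- system for `(ω₀, ω₁, μ)`.
  have m0 : ∀ y ∈ V, pd 0 μ y
      = schouten (thomas Γ) y 0 1 * ω y 0 - schouten (thomas Γ) y 0 0 * ω y 1 := by
    intro y hy
    have := pd_comm (((C3 0).contDiffAt (hO.mem_nhds hy)).of_le (by norm_num)) 1 0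
    rw [pd_congr_of_eqOn hO p00 hy, pd_congr_of_eqOn hO p10 hy, pd_neg,
      pd_add (dμ hy) (dmm _ _ _ _ _ _ _ _ hy), pd_add (dm _ _ _ _ hy) (dm _ _ _ _ hy),
      pd_add (dm _ _ _ _ hy) (dm _ _ _ _ hy)] at this
    simp only [pd_mul (dT _ _ _ hy) (dω _ hy), p00 y hy, p01 y hy, p10 y hy, p11 y hy] at this
    rw [schouten_thomas_zero_one hΓ hy, schouten_thomas_zero_zero hΓ hy]
    linear_combination this
  have m1 : ∀ y ∈ V, pd 1 μ y
      = schouten (thomas Γ) y 1 1 * ω y 0 - schouten (thomas Γ) y 0 1 * ω y 1 := by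
    intro y hy
    have := pd_comm (((C3 1).contDiffAt (hO.mem_nhds hy)).of_le (by norm_num)) 1 0
    rw [pd_congr_of_eqOn hO p11 hy, pd_congr_of_eqOn hO p01 hy,
      pd_sub (dμ hy) (dmm _ _ _ _ _ _ _ _ hy), pd_add (dm _ _ _ _ hy) (dm _ _ _ _ hy),
      pd_add (dm _ _ _ _ hy) (dm _ _ _ _ hy)] at this
    simp only [pd_mul (dT _ _ _ hy) (dω _ hy), p00 y hy, p01 y hy, p10 y hy, p11 y hy] at this
    rw [schouten_thomas_zero_one hΓ hy, schouten_thomas_one_one hΓ hy]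
    linear_combination this
  -- The last integrability condition, for `μ`, is algebraic in `ω`, with coefficients the
  -- components of the Cotton tensor.
  have := pd_comm (hμC.contDiffAt (hO.mem_nhds hx)) 1 0
  have dPω (a b c) : DifferentiableAt ℝ (fun y => schouten (thomas Γ) y a b * ω y c) x :=
    (dP a b hx).fun_mul (dω c hx)
  rw [pd_congr_of_eqOn hO m0 hx, pd_congr_of_eqOn hO m1 hx, pd_sub (dPω _ _ _) (dPω _ _ _),
    pd_sub (dPω _ _ _) (dPω _ _ _)] at this
  simp only [pd_mul (dP _ _ hx) (dω _ hx), p00 x hx, p01 x hx, p10 x hx, p11 x hx] at this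
  rw [cotton_thomas_zero hΓ hx, cotton_thomas_one hΓ hx]
  linear_combination -this

end KillingForm

/-! ### Liouville's invariants when `∇_(a L_b) = α_(a L_b)`. -/

section Liouville

variable {n : ℕ∞} {V : Opens Plane} {Γ : Christoffel}

theorem nablaCotton_eq (Γ : Christoffel) (x : Plane) (a b : Fin 2) :
    nablaCotton (thomas Γ) x a b = pd a (fun y => cotton (thomas Γ) y b) x
      - (thomas Γ x 0 a b * cotton (thomas Γ) x 0 + thomas Γ x 1 a b * cotton (thomas Γ) x 1) := by
  simp only [nablaCotton, nablaCovector, Fin.sum_univ_two]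

theorem nu5_eq (Γ : Christoffel) (x : Plane) :
    nu5 Γ x = cotton (thomas Γ) x 1 ^ 2 * nablaCotton (thomas Γ) x 0 0
      - cotton (thomas Γ) x 0 * cotton (thomas Γ) x 1
        * (nablaCotton (thomas Γ) x 0 1 + nablaCotton (thomas Γ) x 1 0)
      + cotton (thomas Γ) x 0 ^ 2 * nablaCotton (thomas Γ) x 1 1 := by
  simp [nu5, cottonUp, Fin.sum_univ_two, eps]
  ring

/-- If `∇_(a L_b) = α_(a L_b)`, then `ν₅ = 0`. -/
theorem nu5_eq_zero_of_symm {x : Plane} {α : Plane → Fin 2 → ℝ}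
    (hα : ∀ a b, nablaCotton (thomas Γ) x a b + nablaCotton (thomas Γ) x b a
      = α x a * cotton (thomas Γ) x b + α x b * cotton (thomas Γ) x a) : nu5 Γ x = 0 := by
  have h0 := hα 0 0
  have h1 := hα 0 1
  have h2 := hα 1 1
  rw [nu5_eq]
  linear_combination (1 / 2) * cotton (thomas Γ) x 1 ^ 2 * h0
    - cotton (thomas Γ) x 0 * cotton (thomas Γ) x 1 * h1
    + (1 / 2) * cotton (thomas Γ) x 0 ^ 2 * h2

/-- If `∇_(a L_b) = α_(a L_b)`, then the components `W₁₁₁` and `W₂₂₂` are those of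
`(1/27) (∂₁ α₂ - ∂₂ α₁) L_a L_b L_c`. -/
theorem WTensor_eq_of_symm (hn : 4 ≤ n) (hΓ : IsTorsionFreeConnection n V Γ)
    {α : Plane → Fin 2 → ℝ}
    (hα : ∀ y ∈ V, ∀ a b, nablaCotton (thomas Γ) y a b + nablaCotton (thomas Γ) y b a
      = α y a * cotton (thomas Γ) y b + α y b * cotton (thomas Γ) y a)
    {x : Plane} (hx : x ∈ V) (dα : ∀ a, DifferentiableAt ℝ (fun y => α y a) x) :
    27 * WTensor (thomas Γ) x 0 0 0 = (pd 0 (fun y => α y 1) x - pd 1 (fun y => α y 0) x)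
        * cotton (thomas Γ) x 0 ^ 3 ∧
    27 * WTensor (thomas Γ) x 1 1 1 = (pd 0 (fun y => α y 1) x - pd 1 (fun y => α y 0) x)
        * cotton (thomas Γ) x 1 ^ 3 := by
  have hO := V.isOpen
  have LC (b) : ContDiffOn ℝ 2 (fun y => cotton (thomas Γ) y b) V :=
    contDiffOn_cotton hΓ (m := 2) (by rwa [show (2 : ℕ∞) + 2 = 4 by norm_num]) b
  have dL (b) {y} (hy : y ∈ V) : DifferentiableAt ℝ (fun y => cotton (thomas Γ) y b) y :=
    (LC b).differentiableAt_of_isOpen hO two_ne_zero hy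
  have dT (c a b) : DifferentiableAt ℝ (fun x => thomas Γ x c a b) x := by
    refine (contDiffOn_thomas hΓ c a b).differentiableAt_of_isOpen hO ?_ hx
    have : n ≠ 0 := (lt_of_lt_of_le (by norm_num) hn).ne'
    exact_mod_cast this
  have dpL (a b) : DifferentiableAt ℝ (pd a fun y => cotton (thomas Γ) y b) x :=
    (contDiffOn_pd hO (m := 1) (LC b) (by norm_num) a).differentiableAt_of_isOpen hO
      one_ne_zero hx
  have dm (c a b d) : DifferentiableAt ℝ (fun x => thomas Γ x c a b * cotton (thomas Γ) x d) x :=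
    (dT c a b).fun_mul (dL d hx)
  have dN (a b) : DifferentiableAt ℝ (fun y => nablaCotton (thomas Γ) y a b) x := by
    simp only [nablaCotton_eq]
    exact (dpL a b).fun_sub ((dm 0 a b 0).fun_add (dm 1 a b 1))
  have pL : ∀ y ∈ V, ∀ a b, pd a (fun y => cotton (thomas Γ) y b) y
      = nablaCotton (thomas Γ) y a b
        + (thomas Γ y 0 a b * cotton (thomas Γ) y 0 + thomas Γ y 1 a b * cotton (thomas Γ) y 1) := by
    intro y _ a b
    rw [nablaCotton_eq]
    ring
  have hpp (c a b) : pd c (pd a fun y => cotton (thomas Γ) y b) x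
      = pd c (fun y => nablaCotton (thomas Γ) y a b) x
        + ((thomas Γ x 0 a b * pd c (fun y => cotton (thomas Γ) y 0) x
            + pd c (fun y => thomas Γ y 0 a b) x * cotton (thomas Γ) x 0)
          + (thomas Γ x 1 a b * pd c (fun y => cotton (thomas Γ) y 1) x
            + pd c (fun y => thomas Γ y 1 a b) x * cotton (thomas Γ) x 1)) := by
    rw [pd_congr_of_eqOn hO (fun y hy => pL y hy a b) hx,
      pd_add (dN a b) ((dm 0 a b 0).fun_add (dm 1 a b 1)), pd_add (dm 0 a b 0) (dm 1 a b 1),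
      pd_mul (dT _ _ _) (dL _ hx), pd_mul (dT _ _ _) (dL _ hx)]
  have hsym (b) := pd_comm ((LC b).contDiffAt (hO.mem_nhds hx)) 1 0
  have hdα (c a b) : pd c (fun y => nablaCotton (thomas Γ) y a b) x
      + pd c (fun y => nablaCotton (thomas Γ) y b a) x
      = α x a * pd c (fun y => cotton (thomas Γ) y b) x
        + pd c (fun y => α y a) x * cotton (thomas Γ) x b
        + (α x b * pd c (fun y => cotton (thomas Γ) y a) x
        + pd c (fun y => α y b) x * cotton (thomas Γ) x a) := by
    rw [← pd_add (dN a b) (dN b a), pd_congr_of_eqOn hO (fun y hy => hα y hy a b) hx,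
      pd_add ((dα a).fun_mul (dL b hx)) ((dα b).fun_mul (dL a hx)), pd_mul (dα a) (dL b hx),
      pd_mul (dα b) (dL a hx)]
  have t10 (a) : pd a (fun y => thomas Γ y 1 0 1) x = -pd a (fun y => thomas Γ y 0 0 0) x := by
    rw [pd_congr_of_eqOn hO (fun y hy => thomas_one_zero_one hΓ hy) hx, pd_neg]
  have t01 (a) : pd a (fun y => thomas Γ y 0 1 0) x = -pd a (fun y => thomas Γ y 1 1 1) x := by
    rw [pd_congr_of_eqOn hO (fun y hy => thomas_zero_one_zero hΓ hy) hx, pd_neg]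
  -- The second derivatives of `L` enter `W` only in combinations fixed by the differentiated
  -- hypothesis `hdα` and by the equality of mixed partials of `L₀` and `L₁`.
  have s0 := hsym 0
  have s1 := hsym 1
  rw [hpp, hpp] at s0 s1
  have n00 : nablaCotton (thomas Γ) x 0 0 = α x 0 * cotton (thomas Γ) x 0 := by
    linarith [hα x hx 0 0]
  have n11 : nablaCotton (thomas Γ) x 1 1 = α x 1 * cotton (thomas Γ) x 1 := by
    linarith [hα x hx 1 1]
  have n10 : nablaCotton (thomas Γ) x 1 0 = α x 0 * cotton (thomas Γ) x 1
      + α x 1 * cotton (thomas Γ) x 0 - nablaCotton (thomas Γ) x 0 1 := by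
    linarith [hα x hx 0 1]
  have d000 := hdα 0 0 0
  have d100 := hdα 1 0 0
  have d011 := hdα 0 1 1
  have d111 := hdα 1 1 1
  have d001 := hdα 0 0 1
  have d101 := hdα 1 0 1
  have P00 := schouten_thomas_zero_zero hΓ hx
  have P01 := schouten_thomas_zero_one hΓ hx
  have P10 := schouten_thomas_symm hΓ hx
  have P11 := schouten_thomas_one_one hΓ hx
  simp only [thomas_one_one_zero, thomas_zero_zero_one, thomas_one_zero_one hΓ hx,
    thomas_zero_one_zero hΓ hx, t10, t01, pd_neg, pL x hx, n00, n11, n10]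
    at s0 s1 d000 d100 d011 d111 d001 d101
  simp only [WTensor, FDown, MTensor, VTensor, UTensor, NForm, nablaTwoTensor, Fin.sum_univ_two]
  simp only [thomas_one_one_zero, thomas_zero_zero_one, thomas_one_zero_one hΓ hx,
    thomas_zero_one_zero hΓ hx, n00, n11, n10, P10, P00, P01, P11]
  simp [eps]
  set L0 := cotton (thomas Γ) x 0
  set L1 := cotton (thomas Γ) x 1
  constructor
  · linear_combination -(L0 * L1 / 2) * d000 + L0 ^ 2 * d001 + L0 ^ 2 * s0 - (L0 ^ 2 / 2) * d100
  · linear_combination (L0 * L1 / 2) * d111 - L1 ^ 2 * d101 + L1 ^ 2 * s1 + (L1 ^ 2 / 2) * d011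

end Liouville

/-! ### Killing forms make the invariants vanish. -/

section KillingInvariants

variable {n : ℕ∞} {V : Opens Plane} {Γ : Christoffel} {ω : Plane → Fin 2 → ℝ}

theorem contDiffOn_two_cotton (hn : 4 ≤ n) (hΓ : IsTorsionFreeConnection n V Γ) (b : Fin 2) :
    ContDiffOn ℝ 2 (fun y => cotton (thomas Γ) y b) V :=
  contDiffOn_cotton hΓ (m := 2) (by rwa [show (2 : ℕ∞) + 2 = 4 by norm_num]) b

theorem isOpen_ne_zero_inter {f : Plane → ℝ} (hf : ContinuousOn f V) :
    IsOpen {y | y ∈ V ∧ f y ≠ 0} :=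
  hf.isOpen_inter_preimage V.isOpen isOpen_compl_singleton

theorem nu5_w1_eq_zero_of_cotton_eq_zero {x : Plane} (h : ∀ b, cotton (thomas Γ) x b = 0) :
    nu5 Γ x = 0 ∧ w1 Γ x = 0 := by
  constructor
  · rw [nu5_eq, h, h]
    ring
  -- The quotient by `0 ^ 3` has the default value `0`.
  · simp [w1, h]

/-- Liouville's invariants `ν₅` and `w₁` vanish in the presence of a Killing form without zeros. -/
theorem IsKillingForm.nu5_eq_zero_and_w1_eq_zero (hn : 4 ≤ n)
    (hΓ : IsTorsionFreeConnection n V Γ) (h : IsKillingForm V Γ ω) (hne : ∀ x ∈ V, ω x ≠ 0)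
    {x : Plane} (hx : x ∈ V) : nu5 Γ x = 0 ∧ w1 Γ x = 0 := by
  by_cases hL : ∀ b, cotton (thomas Γ) x b = 0
  · exact nu5_w1_eq_zero_of_cotton_eq_zero hL
  push Not at hL
  obtain ⟨i, hi⟩ := hL
  have LC := contDiffOn_two_cotton hn hΓ
  let W : Opens Plane := ⟨{y | y ∈ V ∧ cotton (thomas Γ) y i ≠ 0},
    isOpen_ne_zero_inter (LC i).continuousOn⟩
  have hWV : W ≤ V := fun y hy => hy.1
  have hO := W.isOpen
  have hxW : x ∈ W := ⟨hx, hi⟩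
  -- By `cotton_mul_eq` the form `ω` is proportional to `L`, with this factor where `L_i ≠ 0`.
  let f : Plane → ℝ := fun y => ω y i / cotton (thomas Γ) y i
  have hfC : ContDiffOn ℝ 2 f W :=
    ((h.contDiffOn i).mono hWV).div ((LC i).mono hWV) fun y hy => hy.2
  have hωf : ∀ y ∈ W, ∀ j, ω y j = f y * cotton (thomas Γ) y j := by
    rintro y ⟨hy, hyi⟩ j
    have := h.cotton_mul_eq (le_trans (by norm_num) hn) hΓ hy
    simp only [f]
    field_simp
    fin_cases i <;> fin_cases j <;> simp only [Fin.zero_eta, Fin.mk_one, Fin.isValue] <;> linarith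
  have hf0 : ∀ y ∈ W, f y ≠ 0 := by
    intro y hy h0
    refine hne y (hWV hy) (funext fun j => ?_)
    rw [hωf y hy j, h0, zero_mul, Pi.zero_apply]
  have dL (b) {y} (hy : y ∈ W) : DifferentiableAt ℝ (fun y => cotton (thomas Γ) y b) y :=
    ((LC b).mono hWV).differentiableAt_of_isOpen hO two_ne_zero hy
  have df {y} (hy : y ∈ W) : DifferentiableAt ℝ f y :=
    hfC.differentiableAt_of_isOpen hO two_ne_zero hy
  have dpf (a) {y} (hy : y ∈ W) : DifferentiableAt ℝ (pd a f) y :=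
    (contDiffOn_pd hO (m := 1) hfC (by norm_num) a).differentiableAt_of_isOpen hO one_ne_zero hy
  -- The Killing equation for `f L` reads `∇_(a L_b) = α_(a L_b)` with `α = -d log |f|`. Such an `α`
  -- is closed, which makes the components of `W` vanish.
  let α : Plane → Fin 2 → ℝ := fun y a => -(pd a f y / f y)
  have hα : ∀ y ∈ W, ∀ a b, nablaCotton (thomas Γ) y a b + nablaCotton (thomas Γ) y b a
      = α y a * cotton (thomas Γ) y b + α y b * cotton (thomas Γ) y a := by
    intro y hy a b
    have e := h.pd_add_pd hΓ (hWV hy) a b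
    have hp (a b) : pd a (fun y => ω y b) y
        = f y * pd a (fun y => cotton (thomas Γ) y b) y + pd a f y * cotton (thomas Γ) y b := by
      rw [pd_congr_of_eqOn hO (fun y hy => hωf y hy b) hy, pd_mul (df hy) (dL b hy)]
    have h0 := hf0 y hy
    rw [hp, hp, Fin.sum_univ_two, hωf y hy, hωf y hy] at e
    rw [nablaCotton_eq, nablaCotton_eq, thomas_symm hΓ (hWV hy) 0 b a,
      thomas_symm hΓ (hWV hy) 1 b a]
    simp only [α]
    field_simp
    linear_combination e
  have dα : ∀ a, DifferentiableAt ℝ (fun y => α y a) x := fun a =>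
    (DifferentiableAt.mul (dpf a hxW) ((df hxW).inv (hf0 x hxW))).congr_of_eventuallyEq
      (Filter.Eventually.of_forall fun y => by
        simp only [div_eq_mul_inv, Pi.mul_apply, Pi.inv_apply]) |>.neg
  have κ0 : pd 0 (fun y => α y 1) x - pd 1 (fun y => α y 0) x = 0 := by
    simp only [α, pd_neg]
    rw [pd_div (dpf 1 hxW) (df hxW) (hf0 x hxW), pd_div (dpf 0 hxW) (df hxW) (hf0 x hxW),
      pd_comm (hfC.contDiffAt (hO.mem_nhds hxW)) 0 1]
    ring
  obtain ⟨w000, w111⟩ := WTensor_eq_of_symm hn (hΓ.mono hWV) hα hxW dα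
  rw [κ0] at w000 w111
  refine ⟨nu5_eq_zero_of_symm (hα x hxW), ?_⟩
  have e0 : WTensor (thomas Γ) x 0 0 0 = 0 := by linarith
  have e1 : WTensor (thomas Γ) x 1 1 1 = 0 := by linarith
  simp [w1, e0, e1]

end KillingInvariants

/-! ### Local Killing forms from vanishing invariants. -/

section Existence

variable {n : ℕ∞} {V : Opens Plane} {Γ : Christoffel}

/-- The right-hand side is as regular as the solution as long as it is at most `C¹`; two rounds lead
from continuity to `C²`. -/
theorem contDiffOn_two_of_system {k : ℕ} {O : Set Plane} (hO : IsOpen O)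
    {C : Fin 2 → Fin k → Fin k → Plane → ℝ} (hC : ∀ a i j, ContDiffOn ℝ 1 (C a i j) O)
    {Y : Fin k → Plane → ℝ}
    (hY : ∀ x ∈ O, ∀ i, DifferentiableAt ℝ (Y i) x ∧ ∀ a, pd a (Y i) x = ∑ j, C a i j x * Y j x)
    (i : Fin k) : ContDiffOn ℝ 2 (Y i) O := by
  have step (m : ℕ) (hm : m ≤ 1) (h : ∀ i, ContDiffOn ℝ m (Y i) O) (i) :
      ContDiffOn ℝ (m + 1 : ℕ) (Y i) O := by
    refine contDiffOn_succ_of_pd hO (fun x hx => (hY x hx i).1) fun a => ?_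
    refine ContDiffOn.congr ?_ fun x hx => (hY x hx i).2 a
    exact ContDiffOn.sum fun j _ => ((hC a i j).of_le (by exact_mod_cast hm)).mul (h j)
  have h0 : ∀ i, ContDiffOn ℝ (0 : ℕ) (Y i) O := fun i => by
    rw [Nat.cast_zero, contDiffOn_zero]
    exact fun x hx => (hY x hx i).1.continuousAt.continuousWithinAt
  exact step 1 le_rfl (step 0 zero_le_one h0) i

/-- A connection with vanishing Liouville one-form has a nonzero local Killing form. -/
theorem exists_isKillingForm_of_cotton_eq_zero (hn : 4 ≤ n) (hΓ : IsTorsionFreeConnection n V Γ)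
    (hV : (V : Set Plane).Nonempty) (hL : ∀ x ∈ V, ∀ b, cotton (thomas Γ) x b = 0) :
    ∃ O : Opens Plane, O ≤ V ∧ ∃ ω, IsKillingForm O Γ ω ∧ ∃ x ∈ O, ω x ≠ 0 := by
  have hO := V.isOpen
  have hn1 : (1 : ℕ∞) ≤ n := le_trans (by norm_num) hn
  have hT (c a b) : ContDiffOn ℝ 1 (fun x => thomas Γ x c a b) V :=
    (contDiffOn_thomas hΓ c a b).of_le (WithTop.coe_le_coe.2 hn1)
  have hP (a b) : ContDiffOn ℝ 1 (fun x => schouten (thomas Γ) x a b) V :=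
    contDiffOn_schouten hΓ (m := 1)
      (le_trans (by rw [one_add_one_eq_two]; norm_num) hn) a b
  let p : Plane → ℝ := fun x => thomas Γ x 0 0 0
  let q : Plane → ℝ := fun x => thomas Γ x 1 1 1
  let r : Plane → ℝ := fun x => thomas Γ x 0 1 1
  let s : Plane → ℝ := fun x => thomas Γ x 1 0 0
  let P00 : Plane → ℝ := fun x => schouten (thomas Γ) x 0 0
  let P01 : Plane → ℝ := fun x => schouten (thomas Γ) x 0 1
  let P11 : Plane → ℝ := fun x => schouten (thomas Γ) x 1 1
  -- The matrices of the prolonged Killing equation for the unknowns `(ω₀, ω₁, μ)`.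
  let C : Fin 2 → Fin 3 → Fin 3 → Plane → ℝ :=
    ![![![p, s, fun _ => 0], ![fun x => -q x, fun x => -p x, fun _ => 1],
        ![P01, fun x => -P00 x, fun _ => 0]],
      ![![fun x => -q x, fun x => -p x, fun _ => -1], ![r, q, fun _ => 0],
        ![P11, fun x => -P01 x, fun _ => 0]]]
  have hC : ∀ a i j, ContDiffOn ℝ 1 (C a i j) V := by
    intro a i j
    fin_cases a <;> fin_cases i <;> fin_cases j <;>
      simp only [C, Fin.zero_eta, Fin.mk_one, Fin.reduceFinMk, Fin.isValue, Matrix.cons_val] <;>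
      first
        | exact contDiffOn_const
        | exact hT _ _ _
        | exact hP _ _
        | exact (hT _ _ _).neg
        | exact (hP _ _).neg
  -- The curvature of this system vanishes in the rows of `ω` by the formulas for the Schouten
  -- tensor, and its row for `μ` consists of the Cotton tensor, which is zero here.
  have flat : ∀ x ∈ (V : Set Plane), ∀ i j, pd 1 (C 0 i j) x + ∑ l, C 0 i l x * C 1 l j x
      = pd 0 (C 1 i j) x + ∑ l, C 1 i l x * C 0 l j x := by
    intro x hx i j
    have e00 : P00 x = _ := schouten_thomas_zero_zero hΓ hx
    have e01 : P01 x = _ := schouten_thomas_zero_one hΓ hx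
    have e11 : P11 x = _ := schouten_thomas_one_one hΓ hx
    have c0 := cotton_thomas_zero hΓ hx
    have c1 := cotton_thomas_one hΓ hx
    rw [hL x hx] at c0 c1
    fin_cases i <;> fin_cases j <;>
      simp only [C, Fin.zero_eta, Fin.mk_one, Fin.reduceFinMk, Fin.isValue, Matrix.cons_val,
        Fin.sum_univ_three, pd_neg, pd_const] <;>
      simp only [p, q, r, s, P00, P01, P11] at e00 e01 e11 ⊢
    · linear_combination e01
    · linear_combination -e00
    · ring
    · linear_combination e11
    · linear_combination -e01
    · ring
    · linear_combination c1
    · linear_combination -c0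
    · ring
  obtain ⟨Y, O, hOo, hOV, hY, x₀, hx₀, i, hi⟩ :=
    exists_ne_zero_of_flat_system (by norm_num) hO hV C hC flat
  have hYC := contDiffOn_two_of_system hOo (fun a i j => (hC a i j).mono hOV) hY
  have hp0 (x) (hx : x ∈ O) : pd 0 (Y 0) x = p x * Y 0 x + s x * Y 1 x := by
    rw [(hY x hx 0).2 0]
    simp [C, Fin.sum_univ_three]
  have hp1 (x) (hx : x ∈ O) : pd 0 (Y 1) x = -q x * Y 0 x - p x * Y 1 x + Y 2 x := by
    rw [(hY x hx 1).2 0]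
    simp [C, Fin.sum_univ_three]
    ring
  have hp2 (x) (hx : x ∈ O) : pd 1 (Y 0) x = -q x * Y 0 x - p x * Y 1 x - Y 2 x := by
    rw [(hY x hx 0).2 1]
    simp [C, Fin.sum_univ_three]
    ring
  have hp3 (x) (hx : x ∈ O) : pd 1 (Y 1) x = r x * Y 0 x + q x * Y 1 x := by
    rw [(hY x hx 1).2 1]
    simp [C, Fin.sum_univ_three]
  refine ⟨⟨O, hOo⟩, hOV, fun x => ![Y 0 x, Y 1 x], ⟨?_, ?_⟩, ?_⟩
  · intro a
    fin_cases a
    · exact hYC 0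
    · exact hYC 1
  · intro x hx a b
    have hxV : x ∈ V := hOV hx
    fin_cases a <;> fin_cases b <;>
      simp only [nablaCovector, Fin.zero_eta, Fin.mk_one, Fin.isValue, Matrix.cons_val,
        Fin.sum_univ_two, thomas_one_one_zero, thomas_zero_zero_one, thomas_one_zero_one hΓ hxV,
        thomas_zero_one_zero hΓ hxV] <;>
      simp only [show (fun y => Y 0 y) = Y 0 from rfl, show (fun y => Y 1 y) = Y 1 from rfl,
        hp0 x hx, hp1 x hx, hp2 x hx, hp3 x hx, p, q, r, s] <;>
      ring
  -- If `ω` vanished on `O`, so would its derivatives and hence `μ`, against the choice of a nonzero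
  -- solution.
  · by_contra! hzero
    have z0 : ∀ x ∈ O, Y 0 x = 0 := fun x hx => by simpa using congrFun (hzero x hx) 0
    have z1 : ∀ x ∈ O, Y 1 x = 0 := fun x hx => by simpa using congrFun (hzero x hx) 1
    have z2 : Y 2 x₀ = 0 := by
      have h1 := hp1 x₀ hx₀
      rw [pd_congr_of_eqOn hOo z1 hx₀, pd_const, z0 x₀ hx₀, z1 x₀ hx₀] at h1
      linarith
    fin_cases i
    · exact hi (z0 x₀ hx₀)
    · exact hi (z1 x₀ hx₀)
    · exact hi z2

/-- If `∇_(a L_b) = α_(a L_b)` for a closed one-form `α`, where `L` has no zeros, then there is a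
nonzero local Killing form. -/
theorem exists_isKillingForm_of_closed (hn : 4 ≤ n) (hΓ : IsTorsionFreeConnection n V Γ)
    (hV : (V : Set Plane).Nonempty) (hL : ∀ x ∈ V, ∃ b, cotton (thomas Γ) x b ≠ 0)
    {α : Plane → Fin 2 → ℝ} (hαC : ∀ a, ContDiffOn ℝ 1 (fun y => α y a) V)
    (hα : ∀ y ∈ V, ∀ a b, nablaCotton (thomas Γ) y a b + nablaCotton (thomas Γ) y b a
      = α y a * cotton (thomas Γ) y b + α y b * cotton (thomas Γ) y a)
    (hcl : ∀ y ∈ V, pd 0 (fun y => α y 1) y = pd 1 (fun y => α y 0) y) :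
    ∃ O : Opens Plane, O ≤ V ∧ ∃ ω, IsKillingForm O Γ ω ∧ ∃ x ∈ O, ω x ≠ 0 := by
  have LC := contDiffOn_two_cotton hn hΓ
  have hC : ∀ (a : Fin 2) (_ _ : Fin 1), ContDiffOn ℝ 1 (fun y => -α y a) V :=
    fun a _ _ => (hαC a).neg
  -- The scalar system `dY = -αY` is flat because `α` is closed, and `Y L` is then a Killing form.
  obtain ⟨Y, O, hOo, hOV, hY, x₀, hx₀, i, hi⟩ :=
    exists_ne_zero_of_flat_system one_pos V.isOpen hV (fun a _ _ y => -α y a) hC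
      (fun x hx i j => by
        simp only [pd_neg, hcl x hx, Finset.univ_unique, Finset.sum_singleton]
        ring)
  have hYC := contDiffOn_two_of_system hOo (fun a i j => (hC a i j).mono hOV) hY
  rw [Subsingleton.elim i 0] at hi
  have hp (x) (hx : x ∈ O) (a) : pd a (Y 0) x = -α x a * Y 0 x := by
    rw [(hY x hx 0).2 a]
    simp
  refine ⟨⟨O, hOo⟩, hOV, fun x b => Y 0 x * cotton (thomas Γ) x b,
    ⟨fun b => (hYC 0).mul ((LC b).mono hOV), fun x hx a b => ?_⟩, x₀, hx₀, fun h0 => ?_⟩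
  · have hxV : x ∈ V := hOV hx
    have hd (a b) : pd a (fun y => Y 0 y * cotton (thomas Γ) y b) x
        = Y 0 x * pd a (fun y => cotton (thomas Γ) y b) x
          + -α x a * Y 0 x * cotton (thomas Γ) x b := by
      rw [pd_mul (hY x hx 0).1 ((LC b).differentiableAt_of_isOpen V.isOpen two_ne_zero hxV),
        hp x hx]
    have e := hα x hxV a b
    rw [nablaCotton_eq, nablaCotton_eq] at e
    simp only [nablaCovector, hd, Fin.sum_univ_two]
    linear_combination Y 0 x * e
  · obtain ⟨b, hb⟩ := hL x₀ (hOV hx₀)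
    exact mul_ne_zero hi hb (congrFun h0 b)

/-- If Liouville's invariants `ν₅` and `w₁` vanish, then there is a nonzero local Killing form. -/
theorem exists_isKillingForm (hn : 4 ≤ n) (hΓ : IsTorsionFreeConnection n V Γ)
    (hV : (V : Set Plane).Nonempty) (hν : ∀ x ∈ V, nu5 Γ x = 0) (hw : ∀ x ∈ V, w1 Γ x = 0) :
    ∃ O : Opens Plane, O ≤ V ∧ ∃ ω, IsKillingForm O Γ ω ∧ ∃ x ∈ O, ω x ≠ 0 := by
  have LC := contDiffOn_two_cotton hn hΓ
  have L1 (b) := (LC b).of_le (show (1 : WithTop ℕ∞) ≤ 2 by norm_num)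
  have NC (a b) : ContDiffOn ℝ 1 (fun y => nablaCotton (thomas Γ) y a b) V := by
    have hT (c a b) : ContDiffOn ℝ 1 (fun x => thomas Γ x c a b) V :=
      (contDiffOn_thomas hΓ c a b).of_le
        (WithTop.coe_le_coe.2 (le_trans (show (1 : ℕ∞) ≤ 4 by norm_num) hn))
    simp only [nablaCotton_eq]
    exact (contDiffOn_pd V.isOpen (LC b) (by norm_num) a).sub
      (((hT _ _ _).mul (L1 _)).add ((hT _ _ _).mul (L1 _)))
  have main (i : Fin 2) (W : Opens Plane) (hWV : W ≤ V) (hW : (W : Set Plane).Nonempty)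
      (hi : ∀ x ∈ W, cotton (thomas Γ) x i ≠ 0) (hwi : ∀ x ∈ W, WTensor (thomas Γ) x i i i = 0)
      (α : Plane → Fin 2 → ℝ) (hαC : ∀ a, ContDiffOn ℝ 1 (fun y => α y a) W)
      (hα : ∀ y ∈ W, ∀ a b, nablaCotton (thomas Γ) y a b + nablaCotton (thomas Γ) y b a
        = α y a * cotton (thomas Γ) y b + α y b * cotton (thomas Γ) y a) :
      ∃ O : Opens Plane, O ≤ V ∧ ∃ ω, IsKillingForm O Γ ω ∧ ∃ x ∈ O, ω x ≠ 0 := by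
    obtain ⟨O, hOW, ω, h⟩ := exists_isKillingForm_of_closed hn (hΓ.mono hWV) hW
      (fun x hx => ⟨i, hi x hx⟩) hαC hα (fun y hy => by
        have hd (a) : DifferentiableAt ℝ (fun y => α y a) y :=
          (hαC a).differentiableAt_of_isOpen W.isOpen one_ne_zero hy
        obtain ⟨w000, w111⟩ := WTensor_eq_of_symm hn (hΓ.mono hWV) hα hy hd
        have h1 : 27 * WTensor (thomas Γ) y i i i
            = (pd 0 (fun y => α y 1) y - pd 1 (fun y => α y 0) y) * cotton (thomas Γ) y i ^ 3 := by
          fin_cases i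
          · exact w000
          · exact w111
        rw [hwi y hy, mul_zero, eq_comm, mul_eq_zero_iff_right (pow_ne_zero 3 (hi y hy))] at h1
        exact sub_eq_zero.1 h1)
    exact ⟨O, hOW.trans hWV, ω, h⟩
  by_cases h0 : ∃ x ∈ V, cotton (thomas Γ) x 0 ≠ 0
  · obtain ⟨x₀, hx₀, hne⟩ := h0
    let W : Opens Plane := ⟨{y | y ∈ V ∧ cotton (thomas Γ) y 0 ≠ 0},
      isOpen_ne_zero_inter (LC 0).continuousOn⟩
    have hWV : W ≤ V := fun y hy => hy.1
    have hdiv {f : Plane → ℝ} (hf : ContDiffOn ℝ 1 f V) :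
        ContDiffOn ℝ 1 (fun y => f y / cotton (thomas Γ) y 0) W :=
      (hf.mono hWV).div ((L1 0).mono hWV) fun y hy => hy.2
    -- These values solve the `00` and `01` components of `∇_(a L_b) = α_(a L_b)`; the `11`
    -- component is then the equation `ν₅ = 0`.
    let α₀ : Plane → ℝ := fun y => nablaCotton (thomas Γ) y 0 0 / cotton (thomas Γ) y 0
    let α₁ : Plane → ℝ := fun y => (nablaCotton (thomas Γ) y 0 1 + nablaCotton (thomas Γ) y 1 0)
      / cotton (thomas Γ) y 0 - α₀ y * (cotton (thomas Γ) y 1 / cotton (thomas Γ) y 0)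
    refine main 0 W hWV ⟨x₀, hx₀, hne⟩ (fun x hx => hx.2) (fun x hx => ?_)
      (fun y => ![α₀ y, α₁ y]) (fun a => ?_) (fun y hy a b => ?_)
    · have := hw x hx.1
      rw [w1, if_pos hx.2, div_eq_zero_iff] at this
      exact this.resolve_right (pow_ne_zero 3 hx.2)
    · fin_cases a
      · exact hdiv (NC 0 0)
      · exact (hdiv ((NC 0 1).add (NC 1 0))).sub ((hdiv (NC 0 0)).mul (hdiv (L1 1)))
    · have hν' := hν y hy.1
      rw [nu5_eq] at hν'
      have hne := hy.2
      fin_cases a <;> fin_cases b <;> simp [α₀, α₁] <;> field_simp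
      · ring
      · ring
      · linear_combination hν'
  · push Not at h0
    by_cases h1 : ∃ x ∈ V, cotton (thomas Γ) x 1 ≠ 0
    · obtain ⟨x₀, hx₀, hne⟩ := h1
      let W : Opens Plane := ⟨{y | y ∈ V ∧ cotton (thomas Γ) y 1 ≠ 0},
        isOpen_ne_zero_inter (LC 1).continuousOn⟩
      have hWV : W ≤ V := fun y hy => hy.1
      have hdiv {f : Plane → ℝ} (hf : ContDiffOn ℝ 1 f V) :
          ContDiffOn ℝ 1 (fun y => f y / cotton (thomas Γ) y 1) W :=
        (hf.mono hWV).div ((L1 1).mono hWV) fun y hy => hy.2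
      refine main 1 W hWV ⟨x₀, hx₀, hne⟩ (fun x hx => hx.2) (fun x hx => ?_)
        -- Since `L₀` vanishes identically on `V`, the `01` and `11` components determine `α`, and
        -- `ν₅ = 0` reduces to `∇₀L₀ = 0`, the `00` component.
        (fun y => ![(nablaCotton (thomas Γ) y 0 1 + nablaCotton (thomas Γ) y 1 0)
          / cotton (thomas Γ) y 1, nablaCotton (thomas Γ) y 1 1 / cotton (thomas Γ) y 1])
        (fun a => ?_) (fun y hy a b => ?_)
      · have := hw x hx.1
        rw [w1, if_neg (by simpa using h0 x hx.1), div_eq_zero_iff] at this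
        exact this.resolve_right (pow_ne_zero 3 hx.2)
      · fin_cases a
        · exact hdiv ((NC 0 1).add (NC 1 0))
        · exact hdiv (NC 1 1)
      · have hν' := hν y hy.1
        have hne := hy.2
        rw [nu5_eq, h0 y hy.1] at hν'
        have hn00 : nablaCotton (thomas Γ) y 0 0 = 0 := by
          have : cotton (thomas Γ) y 1 ^ 2 * nablaCotton (thomas Γ) y 0 0 = 0 := by linarith
          exact (mul_eq_zero.1 this).resolve_left (pow_ne_zero 2 hne)
        fin_cases a <;> fin_cases b <;> simp [h0 y hy.1, hn00] <;> field_simp <;> ring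
    · push Not at h1
      refine exists_isKillingForm_of_cotton_eq_zero hn hΓ hV fun x hx b => ?_
      fin_cases b
      · exact h0 x hx
      · exact h1 x hx

end Existence

/-! ### Dimensions of solution spaces and algebra of degenerate tensors. -/

section SolutionSpace

variable {n : ℕ∞} {V W : Opens Plane} {Γ : Christoffel} {σ τ : Plane → Fin 2 → Fin 2 → ℝ}

theorem IsMetrisabilitySolution.mono (h : IsMetrisabilitySolution n V Γ σ) (hW : W ≤ V) :
    IsMetrisabilitySolution n W Γ σ :=
  ⟨fun a b => (h.contDiffOn a b).mono hW, fun x hx => h.symm x (hW hx),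
    fun x hx => h.killing x (hW hx)⟩

theorem IsMetrisabilitySolution.congr (h : IsMetrisabilitySolution n V Γ σ)
    (hτ : ∀ x ∈ V, τ x = σ x) : IsMetrisabilitySolution n V Γ τ := by
  refine ⟨fun a b => (h.contDiffOn a b).congr fun x hx => by rw [hτ x hx],
    fun x hx a b => by rw [hτ x hx, h.symm x hx], fun x hx a b c => ?_⟩
  have e := nablaTwoTensor_congr (thomas Γ) (fun y hy a b => by rw [hτ y hy] :
    ∀ y ∈ V, ∀ a b, τ y a b = σ y a b) hx
  rw [e, e, e]
  exact h.killing x hx a b c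

theorem IsMetrisabilitySolution.indicator_mem (h : IsMetrisabilitySolution n V Γ σ) :
    (V : Set Plane).indicator σ ∈ solutionSpace n V Γ :=
  ⟨h.congr fun _ hx => Set.indicator_of_mem hx σ, fun _ hx => Set.indicator_of_notMem hx σ⟩

theorem exists_ne_zero_of_mem_solutionSpace {s : solutionSpace n V Γ} (hs : s ≠ 0) :
    ∃ x ∈ V, (s : Plane → Fin 2 → Fin 2 → ℝ) x ≠ 0 := by
  by_contra! h
  refine hs (Subtype.ext (funext fun x => ?_))
  by_cases hx : x ∈ V
  · exact h x hx
  · exact s.2.2 x hx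

/-- Restriction of solutions of the metrisability equations to a smaller open set. -/
noncomputable def restrictSolution (n : ℕ∞) (Γ : Christoffel) (hW : W ≤ V) :
    solutionSpace n V Γ →ₗ[ℝ] solutionSpace n W Γ where
  toFun s := ⟨(W : Set Plane).indicator s, (s.2.1.mono hW).indicator_mem⟩
  map_add' _ _ := Subtype.ext (Set.indicator_add _ _ _)
  map_smul' k s := Subtype.ext (Set.indicator_const_smul (W : Set Plane) k s.1)

/-- Solutions on a connected open set are determined by their restriction to an open subset. -/
theorem restrictSolution_injective (hn : 2 ≤ n) (hΓ : IsTorsionFreeConnection n V Γ)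
    (hV : IsPreconnected (V : Set Plane)) (hW : W ≤ V) (hne : (W : Set Plane).Nonempty) :
    Function.Injective (restrictSolution n Γ hW) := by
  rw [← LinearMap.ker_eq_bot, LinearMap.ker_eq_bot']
  intro s hs
  obtain ⟨x₀, hx₀⟩ := hne
  by_contra h
  obtain ⟨x, hx, hsx⟩ := exists_ne_zero_of_mem_solutionSpace h
  refine hsx (s.2.1.eq_zero_of_eventually hn hΓ hV (hW hx₀) ?_ x hx)
  filter_upwards [W.isOpen.mem_nhds hx₀] with y hy
  have := congrFun (congrArg Subtype.val hs) y
  change (W : Set Plane).indicator s.1 y = 0 at this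
  rwa [Set.indicator_of_mem hy] at this

theorem rank_solutionSpace_mono (hn : 2 ≤ n) (hΓ : IsTorsionFreeConnection n V Γ)
    (hV : IsPreconnected (V : Set Plane)) (hW : W ≤ V) (hne : (W : Set Plane).Nonempty) :
    Module.rank ℝ (solutionSpace n V Γ) ≤ Module.rank ℝ (solutionSpace n W Γ) :=
  LinearMap.rank_le_of_injective _ (restrictSolution_injective hn hΓ hV hW hne)

theorem one_le_rank_solutionSpace (h : IsMetrisabilitySolution n V Γ σ) {x : Plane} (hx : x ∈ V)
    (hσ : σ x ≠ 0) : 1 ≤ Module.rank ℝ (solutionSpace n V Γ) := by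
  rw [Cardinal.one_le_iff_pos, rank_pos_iff_exists_ne_zero]
  refine ⟨⟨_, h.indicator_mem⟩, fun h0 => hσ ?_⟩
  have := congrFun (congrArg Subtype.val h0) x
  change (V : Set Plane).indicator σ x = 0 at this
  rwa [Set.indicator_of_mem hx] at this

theorem ne_zero_of_detTwo_ne_zero {x : Plane} (h : detTwo σ x ≠ 0) : σ x ≠ 0 := by
  intro h0
  exact h (by simp [detTwo, h0])

/-- A solution that is nondegenerate somewhere and a nonzero solution that is degenerate everywhere
are linearly independent. -/
theorem two_le_rank_solutionSpace (hσ : IsMetrisabilitySolution n V Γ σ)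
    (hτ : IsMetrisabilitySolution n V Γ τ) {x y : Plane} (hx : x ∈ V) (hσx : detTwo σ x ≠ 0)
    (hd : ∀ z ∈ V, detTwo τ z = 0) (hy : y ∈ V) (hτy : τ y ≠ 0) :
    2 ≤ Module.rank ℝ (solutionSpace n V Γ) := by
  have key : LinearIndependent ℝ ![(⟨_, hσ.indicator_mem⟩ : solutionSpace n V Γ),
      ⟨_, hτ.indicator_mem⟩] := by
    rw [LinearIndependent.pair_iff]
    intro s t h
    have e (z) (hz : z ∈ V) : s • σ z + t • τ z = 0 := by
      have := congrFun (congrArg Subtype.val h) z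
      simpa [Set.indicator_of_mem (show z ∈ (V : Set Plane) from hz)] using this
    have ex (a b) : s * σ x a b + t * τ x a b = 0 := by
      simpa using congrFun (congrFun (e x hx) a) b
    have hs : s = 0 := by
      -- From `s σ = -t τ` follows `s² det σ = t² det τ`, and `det τ` vanishes.
      have h0 : s ^ 2 * detTwo σ x = 0 := by
        have := hd x hx
        simp only [detTwo] at this ⊢
        linear_combination (s * σ x 1 1 - t * τ x 1 1) * ex 0 0
          + t ^ 2 * this - (s * σ x 0 1 - t * τ x 0 1) * ex 0 1
          + t * τ x 1 1 * ex 0 0 - t * τ x 0 0 * ex 1 1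
      exact pow_eq_zero_iff two_ne_zero |>.1 ((mul_eq_zero.1 h0).resolve_right hσx)
    refine ⟨hs, ?_⟩
    have := e y hy
    rw [hs, zero_smul, zero_add] at this
    exact (smul_eq_zero.1 this).resolve_right hτy
  simpa using key.cardinal_le_rank

theorem exists_diag_ne_zero {x : Plane} (hs : ∀ a b, σ x a b = σ x b a) (hd : detTwo σ x = 0)
    (h : σ x ≠ 0) : ∃ i, σ x i i ≠ 0 := by
  by_contra! h0
  have h01 : σ x 0 1 = 0 := by
    have : σ x 0 1 ^ 2 = 0 := by
      rw [detTwo, h0, h0] at hd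
      linarith
    exact pow_eq_zero_iff two_ne_zero |>.1 this
  refine h (funext fun a => funext fun b => ?_)
  fin_cases a <;> fin_cases b
  · exact h0 0
  · exact h01
  · exact (hs 1 0).trans h01
  · exact h0 1

/-- A symmetric tensor of rank at most one is, up to a factor, the square of any of its rows. This
is how `ω` is read off from `σ`. -/
theorem mul_eq_of_detTwo_eq_zero {x : Plane} (hs : ∀ a b, σ x a b = σ x b a)
    (hd : detTwo σ x = 0) (i a b : Fin 2) : σ x i a * σ x i b = σ x i i * σ x a b := by
  have h10 := hs 1 0
  rw [detTwo] at hd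
  fin_cases i <;> fin_cases a <;> fin_cases b <;>
    simp only [Fin.zero_eta, Fin.mk_one, Fin.isValue, h10] <;> linarith

/-- The determinant is a nondegenerate quadratic form on the three-dimensional space of symmetric
tensors. The hypotheses say that `σ` and `τ` span a totally isotropic subspace, and such a subspace
has dimension at most one. -/
theorem eq_smul_of_detTwo_eq_zero {x : Plane} (hs : ∀ a b, σ x a b = σ x b a)
    (ht : ∀ a b, τ x a b = τ x b a) (hd : detTwo σ x = 0) (hd' : detTwo τ x = 0)
    (hd'' : detTwo (σ + τ) x = 0) {i : Fin 2} (hi : σ x i i ≠ 0) (a b : Fin 2) :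
    τ x a b = τ x i i / σ x i i * σ x a b := by
  have hs' := hs 1 0
  have ht' := ht 1 0
  simp only [detTwo, Pi.add_apply] at hd hd' hd''
  have h01 : τ x 0 1 * σ x i i = τ x i i * σ x 0 1 := by
    rw [← sub_eq_zero, ← pow_eq_zero_iff two_ne_zero]
    fin_cases i <;> simp only [Fin.zero_eta, Fin.mk_one, Fin.isValue] at *
    · linear_combination σ x 0 0 * τ x 0 0 * hd'' - σ x 0 0 * (τ x 0 0 + σ x 0 0) * hd'
        - τ x 0 0 * (τ x 0 0 + σ x 0 0) * hd
    · linear_combination σ x 1 1 * τ x 1 1 * hd'' - σ x 1 1 * (τ x 1 1 + σ x 1 1) * hd'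
        - τ x 1 1 * (τ x 1 1 + σ x 1 1) * hd
  have hjj : τ x 0 0 * σ x i i = τ x i i * σ x 0 0 ∧ τ x 1 1 * σ x i i = τ x i i * σ x 1 1 := by
    fin_cases i <;> simp only [Fin.zero_eta, Fin.mk_one, Fin.isValue] at *
    · refine ⟨trivial, mul_right_cancel₀ hi ?_⟩
      linear_combination σ x 0 0 * hd'' - σ x 0 0 * hd - σ x 0 0 * hd' - 2 * τ x 0 0 * hd
        + 2 * σ x 0 1 * h01
    · refine ⟨mul_right_cancel₀ hi ?_, trivial⟩
      linear_combination σ x 1 1 * hd'' - σ x 1 1 * hd - σ x 1 1 * hd' - 2 * τ x 1 1 * hd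
        + 2 * σ x 0 1 * h01
  rw [div_mul_eq_mul_div, eq_div_iff hi]
  fin_cases a <;> fin_cases b
  · exact hjj.1
  · exact h01
  · exact ht' ▸ hs' ▸ h01
  · exact hjj.2

end SolutionSpace

/-! ### Degenerate solutions. -/

section Degenerate

variable {n : ℕ∞} {V : Opens Plane} {Γ : Christoffel} {σ τ : Plane → Fin 2 → Fin 2 → ℝ}

/-- If `σ` and `f σ` solve the metrisability equations near `x` and `σ_{ii}(x) ≠ 0`, then the
differential of `f` vanishes at `x`. -/
theorem fderiv_eq_zero_of_smul_solution (hσ : IsMetrisabilitySolution n V Γ σ)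
    (hτ : IsMetrisabilitySolution n V Γ τ) {f : Plane → ℝ} {x : Plane} (hx : x ∈ V)
    (hf : DifferentiableAt ℝ f x) (h : ∀ y ∈ V, ∀ a b, τ y a b = f y * σ y a b) {i : Fin 2}
    (hi : σ x i i ≠ 0) : fderiv ℝ f x = 0 := by
  -- Subtracting `f` times the equations for `σ` leaves the symmetrised product of `df` and `σ`. The
  -- indices `(i, i, i)` give `∂_i f = 0`, and then `(j, i, i)` gives the rest.
  have k (a b c) : pd a f x * σ x b c + pd b f x * σ x c a + pd c f x * σ x a b = 0 := by
    have e := hτ.killing x hx a b c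
    have e' := hσ.killing x hx a b c
    have hp (a b c) : nablaTwoTensor (thomas Γ) τ x a b c
        = f x * nablaTwoTensor (thomas Γ) σ x a b c + pd a f x * σ x b c := by
      simp only [nablaTwoTensor, h x hx, Fin.sum_univ_two]
      rw [pd_congr_of_eqOn V.isOpen (fun y hy => h y hy b c) hx,
        pd_mul hf (hσ.differentiableAt hx b c)]
      ring
    rw [hp, hp, hp] at e
    linear_combination e - f x * e'
  have hii : pd i f x = 0 := by
    have : pd i f x * σ x i i = 0 := by linarith [k i i i]
    exact (mul_eq_zero.1 this).resolve_right hi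
  have hall (j) : pd j f x = 0 := by
    have : pd j f x * σ x i i = 0 := by simpa [hii] using k j i i
    exact (mul_eq_zero.1 this).resolve_right hi
  ext v
  simp [fderiv_apply_eq_pd, hall]

/-- If all solutions on a connected open set are degenerate, then the space of solutions is at
most one-dimensional. -/
theorem rank_solutionSpace_le_one (hn : 2 ≤ n) (hΓ : IsTorsionFreeConnection n V Γ)
    (hV : IsPreconnected (V : Set Plane))
    (hd : ∀ σ, IsMetrisabilitySolution n V Γ σ → ∀ x ∈ V, detTwo σ x = 0) :
    Module.rank ℝ (solutionSpace n V Γ) ≤ 1 := by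
  by_cases hz : ∀ s : solutionSpace n V Γ, s = 0
  · exact rank_le_one_iff.2 ⟨0, fun v => ⟨0, by rw [hz v, smul_zero]⟩⟩
  push Not at hz
  obtain ⟨s, hs⟩ := hz
  obtain ⟨x₀, hx₀, hsx⟩ := exists_ne_zero_of_mem_solutionSpace hs
  refine rank_le_one_iff.2 ⟨s, fun t => ?_⟩
  obtain ⟨σ, hσ⟩ := s
  obtain ⟨τ, hτ⟩ := t
  simp only at hsx
  obtain ⟨i, hi⟩ := exists_diag_ne_zero (hσ.1.symm x₀ hx₀) (hd σ hσ.1 x₀ hx₀) hsx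
  let W : Opens Plane := ⟨{y | y ∈ V ∧ σ y i i ≠ 0},
    isOpen_ne_zero_inter (hσ.1.contDiffOn i i).continuousOn⟩
  have hWV : W ≤ V := fun y hy => hy.1
  -- Where `σ_ii ≠ 0` the two solutions are proportional with factor `f`, which is constant on a
  -- ball about `x₀`. Unique continuation extends `τ = f(x₀) σ` to all of `V`.
  let f : Plane → ℝ := fun y => τ y i i / σ y i i
  have hfτ (y) (hy : y ∈ W) (a b) : τ y a b = f y * σ y a b :=
    eq_smul_of_detTwo_eq_zero (hσ.1.symm y hy.1) (hτ.1.symm y hy.1) (hd σ hσ.1 y hy.1)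
      (hd τ hτ.1 y hy.1) (hd _ ((solutionSpace n V Γ).add_mem hσ hτ).1 y hy.1) hy.2 a b
  have hf (y) (hy : y ∈ W) : DifferentiableAt ℝ f y := by
    simp only [f, div_eq_mul_inv]
    exact (hτ.1.differentiableAt hy.1 i i).fun_mul
      ((hσ.1.differentiableAt hy.1 i i).fun_inv hy.2)
  have hf' (y) (hy : y ∈ W) : fderiv ℝ f y = 0 :=
    fderiv_eq_zero_of_smul_solution (hσ.1.mono hWV) (hτ.1.mono hWV) hy (hf y hy) hfτ hy.2
  obtain ⟨r, hr, hB⟩ := Metric.isOpen_iff.1 W.isOpen x₀ ⟨hx₀, hi⟩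
  have hconst (y) (hy : y ∈ Metric.ball x₀ r) : f y = f x₀ :=
    Metric.isOpen_ball.is_const_of_fderiv_eq_zero (convex_ball x₀ r).isPreconnected
      (fun z hz => (hf z (hB hz)).differentiableWithinAt) (fun z hz => hf' z (hB hz)) hy
      (Metric.mem_ball_self hr)
  refine ⟨f x₀, ?_⟩
  rw [← sub_eq_zero]
  by_contra hne
  obtain ⟨x, hx, hxne⟩ := exists_ne_zero_of_mem_solutionSpace hne
  refine hxne ((Subtype.property (_ : solutionSpace n V Γ)).1.eq_zero_of_eventually hn hΓ hV hx₀
    ?_ x hx)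
  filter_upwards [Metric.ball_mem_nhds x₀ hr] with y hy
  ext a b
  simp [hfτ y (hB hy), hconst y hy]

/-- Symmetric multiplication by a nonzero covector is injective on symmetric tensors. With `K` the
symmetrised `∇ω`, it cancels the factor `ω` in the equations for `ω ⊗ ω`. -/
theorem eq_zero_of_cyclic_eq_zero {K : Fin 2 → Fin 2 → ℝ} {w : Fin 2 → ℝ}
    (hK : ∀ a b, K a b = K b a) {i : Fin 2} (hi : w i ≠ 0)
    (h : ∀ a b c, K a b * w c + K b c * w a + K c a * w b = 0) (a b : Fin 2) : K a b = 0 := by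
  have hii : K i i = 0 := by
    have : K i i * w i = 0 := by linarith [h i i i]
    exact (mul_eq_zero.1 this).resolve_right hi
  have hij (j) : K i j = 0 := by
    have : K i j * w i = 0 := by
      have := h i i j
      rw [hii, hK j i] at this
      linarith
    exact (mul_eq_zero.1 this).resolve_right hi
  have : K a b * w i = 0 := by
    have := h a b i
    rw [hK b i, hij, hij] at this
    linarith
  exact (mul_eq_zero.1 this).resolve_right hi

/-- A degenerate nonzero solution is locally, up to sign, the square of a Killing form. -/
theorem exists_isKillingForm_of_degenerate (hn : 1 ≤ n)
    (hσ : IsMetrisabilitySolution n V Γ σ) (hd : ∀ x ∈ V, detTwo σ x = 0) {x₀ : Plane}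
    (hx₀ : x₀ ∈ V) (hne : σ x₀ ≠ 0) :
    ∃ O : Opens Plane, O ≤ V ∧ x₀ ∈ O ∧ ∃ ω, IsKillingForm O Γ ω ∧ ∀ x ∈ O, ω x ≠ 0 := by
  obtain ⟨i, hi⟩ := exists_diag_ne_zero (hσ.symm x₀ hx₀) (hd x₀ hx₀) hne
  -- A degenerate form is semidefinite; `s = ±1` is its sign, so that a square root of `s σ_ii`
  -- exists.
  obtain ⟨s, hs, hspos⟩ : ∃ s : ℝ, s ^ 2 = 1 ∧ 0 < s * σ x₀ i i := by
    rcases hi.lt_or_gt with h | h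
    · exact ⟨-1, by norm_num, by linarith⟩
    · exact ⟨1, by norm_num, by linarith⟩
  have hle : (2 : WithTop ℕ∞) ≤ ((n + 1 : ℕ∞) : WithTop ℕ∞) := by
    have : (2 : ℕ∞) ≤ n + 1 := by
      rw [← one_add_one_eq_two]
      gcongr
    exact WithTop.coe_le_coe.2 this
  have hC (a b) : ContDiffOn ℝ 2 (fun x => σ x a b) V := (hσ.contDiffOn a b).of_le hle
  have hsC : ContDiffOn ℝ 2 (fun x => s * σ x i i) V := contDiffOn_const.mul (hC i i)
  let O : Opens Plane := ⟨{y | y ∈ V ∧ 0 < s * σ y i i},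
    hsC.continuousOn.isOpen_inter_preimage V.isOpen isOpen_Ioi⟩
  have hOV : O ≤ V := fun y hy => hy.1
  let ρ : Plane → ℝ := fun y => √(s * σ y i i)
  have hρ (y) (hy : y ∈ O) : ρ y ≠ 0 := (Real.sqrt_pos.2 hy.2).ne'
  have hρ2 (y) (hy : y ∈ O) : ρ y ^ 2 = s * σ y i i := Real.sq_sqrt hy.2.le
  have hρC : ContDiffOn ℝ 2 ρ O := (hsC.mono hOV).sqrt fun y hy => hy.2.ne'
  let ω : Plane → Fin 2 → ℝ := fun y a => σ y i a / ρ y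
  have hωC (a) : ContDiffOn ℝ 2 (fun y => ω y a) O := ((hC i a).mono hOV).div hρC hρ
  have hσω (y) (hy : y ∈ O) (a b) : σ y a b = s * (ω y a * ω y b) := by
    have e := mul_eq_of_detTwo_eq_zero (hσ.symm y hy.1) (hd y hy.1) i a b
    have e2 := hρ2 y hy
    have e3 := hρ y hy
    simp only [ω]
    rw [div_mul_div_comm, e, ← sq, e2]
    have e4 : s * σ y i i ≠ 0 := hy.2.ne'
    rw [← mul_div_assoc, eq_div_iff e4]
    ring
  have hωi (y) (hy : y ∈ O) : ω y i ≠ 0 :=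
    div_ne_zero (right_ne_zero_of_mul hy.2.ne') (hρ y hy)
  refine ⟨O, hOV, ⟨hx₀, hspos⟩, ω, ⟨hωC, fun x hx => ?_⟩,
    fun x hx h0 => hωi x hx (by rw [h0, Pi.zero_apply])⟩
  have hs0 : s ≠ 0 := by
    rintro rfl
    norm_num at hs
  have hdω (a) : DifferentiableAt ℝ (fun y => ω y a) x :=
    (hωC a).differentiableAt_of_isOpen O.isOpen two_ne_zero hx
  refine eq_zero_of_cyclic_eq_zero
    (K := fun a b => nablaCovector (thomas Γ) ω x a b + nablaCovector (thomas Γ) ω x b a)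
    (fun a b => add_comm _ _) (hωi x hx) fun a b c => ?_
  have hp (a b c) : nablaTwoTensor (thomas Γ) σ x a b c
      = s * (nablaCovector (thomas Γ) ω x a b * ω x c + ω x b * nablaCovector (thomas Γ) ω x a c) := by
    simp only [nablaTwoTensor, nablaCovector, hσω x hx, Fin.sum_univ_two]
    rw [pd_congr_of_eqOn O.isOpen (fun y hy => hσω y hy b c) hx,
      pd_const_mul s ((hdω b).fun_mul (hdω c)), pd_mul (hdω b) (hdω c)]
    ring
  have e := hσ.killing x hx.1 a b c
  rw [hp, hp, hp, ← mul_add, ← mul_add] at e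
  have := (mul_eq_zero.1 e).resolve_left hs0
  linear_combination this

end Degenerate

/-! ### The four generic situations and the conclusion. -/

section Main

variable {n : ℕ∞} {U V W : Opens Plane} {Γ : Christoffel}

/-- The criterion for metrisability on `V` in terms of the solution space of the metrisability
equations and of Liouville's invariants `ν₅` and `w₁`. -/
def MetrisabilityCriterion (n : ℕ∞) (V : Opens Plane) (Γ : Christoffel) : Prop :=
  IsMetrisable n V Γ ↔ 2 ≤ Module.rank ℝ (solutionSpace n V Γ) ∨
    (Module.rank ℝ (solutionSpace n V Γ) = 1 ∧
      ¬ ((∀ x ∈ V, nu5 Γ x = 0) ∧ (∀ x ∈ V, w1 Γ x = 0)))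

theorem isOpen_detTwo_ne_zero {σ : Plane → Fin 2 → Fin 2 → ℝ}
    (hσ : IsMetrisabilitySolution n V Γ σ) : IsOpen {y | y ∈ V ∧ detTwo σ y ≠ 0} :=
  isOpen_ne_zero_inter (((hσ.contDiffOn 0 0).mul (hσ.contDiffOn 1 1)).sub
    ((hσ.contDiffOn 0 1).mul (hσ.contDiffOn 0 1))).continuousOn

/-- A connected open set carrying a nowhere vanishing Killing form and a somewhere nondegenerate
solution has at least two independent solutions. -/
theorem IsKillingForm.two_le_rank (hn : 1 ≤ n) (hΓ : IsTorsionFreeConnection n V Γ)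
    {ω : Plane → Fin 2 → ℝ} (h : IsKillingForm V Γ ω) {x y : Plane} (hy : y ∈ V) (hω : ω y ≠ 0)
    {σ : Plane → Fin 2 → Fin 2 → ℝ} (hσ : IsMetrisabilitySolution n V Γ σ) (hx : x ∈ V)
    (hd : detTwo σ x ≠ 0) : 2 ≤ Module.rank ℝ (solutionSpace n V Γ) := by
  refine two_le_rank_solutionSpace hσ (h.isMetrisabilitySolution hn hΓ) hx hd
    (fun z _ => by simp only [detTwo]; ring) hy fun h0 => hω (funext fun a => ?_)
  have : ω y a * ω y a = 0 := congrFun (congrFun h0 a) a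
  exact mul_self_eq_zero.1 this

theorem IsKillingForm.mono {ω : Plane → Fin 2 → ℝ} (h : IsKillingForm V Γ ω) (hW : W ≤ V) :
    IsKillingForm W Γ ω :=
  ⟨fun a => (h.contDiffOn a).mono hW, fun x hx => h.killing x (hW hx)⟩

/-- Every nonempty open set contains a nonempty open set on whose connected open subsets the
criterion for metrisability holds. -/
theorem exists_metrisabilityCriterion (hn : 4 ≤ n) (hΓ : IsTorsionFreeConnection n W Γ)
    (hW : (W : Set Plane).Nonempty) :
    ∃ V₀ : Opens Plane, V₀ ≤ W ∧ (V₀ : Set Plane).Nonempty ∧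
      ∀ V : Opens Plane, V ≤ V₀ → IsConnected (V : Set Plane) → MetrisabilityCriterion n V Γ := by
  have hn1 : 1 ≤ n := le_trans (by norm_num) hn
  have hn2 : 2 ≤ n := le_trans (by norm_num) hn
  -- With two independent solutions some solution is nondegenerate somewhere. On its locus of
  -- nondegeneracy every connected `V` is metrisable and inherits dimension at least two.
  by_cases hA : ∃ V₁ ≤ W, IsConnected (V₁ : Set Plane) ∧
    2 ≤ Module.rank ℝ (solutionSpace n V₁ Γ)
  · obtain ⟨V₁, hV₁, hc, hr⟩ := hA
    have hΓ₁ := hΓ.mono hV₁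
    obtain ⟨σ, hσ, x, hx, hd⟩ : ∃ σ, IsMetrisabilitySolution n V₁ Γ σ ∧
        ∃ x ∈ V₁, detTwo σ x ≠ 0 := by
      by_contra! h
      exact absurd (hr.trans (rank_solutionSpace_le_one hn2 hΓ₁ hc.isPreconnected h))
        (by norm_num)
    let V₀ : Opens Plane := ⟨_, isOpen_detTwo_ne_zero hσ⟩
    have h₀₁ : V₀ ≤ V₁ := fun y hy => hy.1
    refine ⟨V₀, h₀₁.trans hV₁, ⟨x, hx, hd⟩, fun V hV hVc => iff_of_true ?_ (.inl ?_)⟩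
    · exact isMetrisable_of_solution (hΓ₁.mono (hV.trans h₀₁)) (hσ.mono (hV.trans h₀₁))
        fun y hy => (hV hy).2
    · exact hr.trans (rank_solutionSpace_mono hn2 hΓ₁ hc.isPreconnected (hV.trans h₀₁) hVc.nonempty)
  push Not at hA
  have rank_one {V : Opens Plane} (hV : V ≤ W) (hc : IsConnected (V : Set Plane))
      {σ : Plane → Fin 2 → Fin 2 → ℝ} (hσ : IsMetrisabilitySolution n V Γ σ)
      (hd : ∀ x ∈ V, detTwo σ x ≠ 0) : Module.rank ℝ (solutionSpace n V Γ) = 1 := by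
    obtain ⟨x, hx⟩ := hc.nonempty
    refine le_antisymm ?_ (one_le_rank_solutionSpace hσ hx (ne_zero_of_detTwo_ne_zero (hd x hx)))
    have h2 : (2 : Cardinal.{0}) = Order.succ 1 := by
      have := Cardinal.succ_natCast.{0} 1
      rw [Nat.cast_one, one_add_one_eq_two] at this
      exact this.symm
    exact Order.lt_succ_iff.1 ((hA V hV hc).trans_eq h2)
  -- From here on no connected open subset of `W` has two independent solutions. A nondegenerate
  -- solution thus spans the solution space, and the invariants must be shown not to vanish
  -- together.
  by_cases hB : ∃ V₁ ≤ W, ∃ σ, IsMetrisabilitySolution n V₁ Γ σ ∧ ∃ x ∈ V₁, detTwo σ x ≠ 0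
  · obtain ⟨V₁, hV₁, σ, hσ, x, hx, hd⟩ := hB
    let V₀ : Opens Plane := ⟨_, isOpen_detTwo_ne_zero hσ⟩
    have h₀₁ : V₀ ≤ V₁ := fun y hy => hy.1
    refine ⟨V₀, h₀₁.trans hV₁, ⟨x, hx, hd⟩, fun V hV hVc => iff_of_true ?_ (.inr ⟨?_, ?_⟩)⟩
    · exact isMetrisable_of_solution (hΓ.mono (hV.trans (h₀₁.trans hV₁)))
        (hσ.mono (hV.trans h₀₁)) fun y hy => (hV hy).2
    · exact rank_one (hV.trans (h₀₁.trans hV₁)) hVc (hσ.mono (hV.trans h₀₁)) fun y hy => (hV hy).2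
    · rintro ⟨hν, hw⟩
      have hΓV := hΓ.mono (hV.trans (h₀₁.trans hV₁))
      obtain ⟨O, hOV, ω, hω, y, hy, hωy⟩ := exists_isKillingForm hn hΓV hVc.nonempty hν hw
      -- On a ball, which is connected, the square of the Killing form would be a second solution
      -- independent of `σ`, contradicting `hA`.
      obtain ⟨r, hr, hball⟩ := Metric.isOpen_iff.1 O.isOpen y hy
      let B : Opens Plane := ⟨Metric.ball y r, Metric.isOpen_ball⟩
      have hBO : B ≤ O := hball
      have hyB : y ∈ B := Metric.mem_ball_self hr
      have hBV := hBO.trans hOV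
      refine absurd (hA B (hBV.trans (hV.trans (h₀₁.trans hV₁)))
        ⟨⟨y, hyB⟩, (convex_ball y r).isPreconnected⟩) (not_lt.2 ?_)
      exact (hω.mono hBO).two_le_rank hn1 (hΓV.mono hBV) hyB hωy
        (hσ.mono (hBV.trans (hV.trans h₀₁))) hyB (hV (hBV hyB)).2
  push Not at hB
  have not_metrisable {V : Opens Plane} (hV : V ≤ W) (hc : IsConnected (V : Set Plane)) :
      ¬ IsMetrisable n V Γ := fun h => by
    obtain ⟨σ, hσ, hd⟩ := exists_solution_of_isMetrisable hn1 (hΓ.mono hV) h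
    obtain ⟨x, hx⟩ := hc.nonempty
    exact hd x hx (hB V hV σ hσ x hx)
  -- Now all solutions are degenerate and nothing is metrisable. A nonzero solution yields a Killing
  -- form without zeros, which makes both invariants vanish and excludes the second alternative.
  by_cases hC : ∃ V₁ ≤ W, ∃ σ, IsMetrisabilitySolution n V₁ Γ σ ∧ ∃ x ∈ V₁, σ x ≠ 0
  · obtain ⟨V₁, hV₁, σ, hσ, x, hx, hne⟩ := hC
    obtain ⟨O, hO, hxO, ω, hω, hω0⟩ :=
      exists_isKillingForm_of_degenerate hn1 hσ (hB V₁ hV₁ σ hσ) hx hne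
    refine ⟨O, hO.trans hV₁, ⟨x, hxO⟩, fun V hV hVc => iff_of_false
      (not_metrisable (hV.trans (hO.trans hV₁)) hVc) ?_⟩
    have hΓO := hΓ.mono (hO.trans hV₁)
    rintro (h | ⟨-, h⟩)
    · exact absurd h (not_le.2 (hA V (hV.trans (hO.trans hV₁)) hVc))
    · exact h ⟨fun y hy => (hω.nu5_eq_zero_and_w1_eq_zero hn hΓO hω0 (hV hy)).1,
        fun y hy => (hω.nu5_eq_zero_and_w1_eq_zero hn hΓO hω0 (hV hy)).2⟩
  · push Not at hC
    refine ⟨W, le_rfl, hW, fun V hV hVc => iff_of_false (not_metrisable hV hVc) ?_⟩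
    have h0 : Module.rank ℝ (solutionSpace n V Γ) = 0 := by
      rw [rank_zero_iff_forall_zero]
      intro s
      by_contra hs
      obtain ⟨x, hx, hsx⟩ := exists_ne_zero_of_mem_solutionSpace hs
      exact hsx (hC V hV s s.2.1 x hx)
    rw [h0]
    simp

end Main

end ProjSurf

theorem corollary5p5 (n : ℕ∞) (hn : 4 ≤ n) (U : TopologicalSpace.Opens ProjSurf.Plane)
    (Γ : ProjSurf.Christoffel) (hΓ : ProjSurf.IsTorsionFreeConnection n U Γ) :
    ∃ G : TopologicalSpace.Opens ProjSurf.Plane,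
      G ≤ U ∧ (U : Set ProjSurf.Plane) ⊆ closure (G : Set ProjSurf.Plane) ∧
      ∀ p ∈ G, ∃ V₀ : TopologicalSpace.Opens ProjSurf.Plane, p ∈ V₀ ∧ V₀ ≤ U ∧
        ∀ V : TopologicalSpace.Opens ProjSurf.Plane, V ≤ V₀ →
          IsConnected (V : Set ProjSurf.Plane) →
          (ProjSurf.IsMetrisable n V Γ ↔
            2 ≤ Module.rank ℝ (ProjSurf.solutionSpace n V Γ) ∨
            (Module.rank ℝ (ProjSurf.solutionSpace n V Γ) = 1 ∧
              ¬ ((∀ x ∈ V, ProjSurf.nu5 Γ x = 0) ∧ (∀ x ∈ V, ProjSurf.w1 Γ x = 0)))) := by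
  -- `G` is the union of all good open sets. Its density is the existence of a good set inside `o ⊓
  -- U` for every open `o` that meets `U`.
  refine ⟨sSup {V₀ | V₀ ≤ U ∧ ∀ V : Opens ProjSurf.Plane, V ≤ V₀ →
    IsConnected (V : Set ProjSurf.Plane) → ProjSurf.MetrisabilityCriterion n V Γ},
    sSup_le fun _ h => h.1, fun x hx => ?_, fun p hp => ?_⟩
  · rw [mem_closure_iff]
    intro o ho hxo
    obtain ⟨V₀, hV₀, ⟨y, hy⟩, h⟩ := ProjSurf.exists_metrisabilityCriterion
      (W := ⟨o, ho⟩ ⊓ U) hn (hΓ.mono inf_le_right) ⟨x, hxo, hx⟩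
    exact ⟨y, (hV₀ hy).1, Opens.mem_sSup.2 ⟨V₀, ⟨hV₀.trans inf_le_right, h⟩, hy⟩⟩
  · obtain ⟨V₀, ⟨h₁, h₂⟩, hp⟩ := Opens.mem_sSup.1 hp
    exact ⟨V₀, hp, h₁, h₂⟩
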